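/- Let $f(x)=a+bx+\int_{(0,\infty)}(1-e^{-xs})\,\bar\nu(ds)$ be a Bernstein function ($a,b\ge 0$, $\int_{(0,\infty)}(s\wedge 1)\,\bar\nu(ds)<\infty$) with tail $\nu(s)=a+\bar\nu(s,\infty)$, and assume that $\bar\nu(0,\infty)=\infty$ and that $\nu$ is locally absolutely continuous on $(0,\infty)$. Let $\psi$ be any Bernstein function. For a locally absolutely continuous function $v$ on $[0,\infty)$ let $$\mathcal D^f_t v(t)=b\,v'(t)+\int_0^t \frac{\partial}{\partial t}v(t-s)\,\nu(s)\,ds .$$ Let $N$ be a Poisson process with intensity $\lambda>0$, let $H^\psi$ be a subordinator with Laplace exponent $\psi$, and let $Y^f(t)=\inf\{s\ge 0: H^f(s)>t\}$ be the inverse of a subordinator $H^f$ with Laplace exponent $f$, where $N,H^\psi,Y^f$ are independent. (A subordinator with Laplace exponent $g$ satisfies $\mathbb E e^{-xH(t)}=e^{-tg(x)}$, $x>0$; it may be killed, i.e. take the value $+\infty$, when $g(0+)>0$. We put $N(\infty)=\infty$, $e^{-\infty}=0$ and $u^\infty=0$ for $|u|<1$.) For $t>0$ the variable $Y^f(t)$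 has a density $\ell_f(t,\cdot)$ with respect to Lebesgue measure; let $\tilde\ell_f(t,\eta)=\int_0^\infty e^{-\eta x}\ell_f(t,x)\,dx$. Put $N^{\psi,f}(t)=N(H^\psi(Y^f(t)))$ and $p_k(t)=\mathbb P\{N^{\psi,f}(t)=k\}$ for $k=0,1,2,\dots$. Then: 1. For every $t>0$ the function $x\mapsto\tilde\ell_f(t,\psi(x))$ is infinitely differentiable on $(0,\infty)$, and for every $k\ge 0$ $$p_k(t)=\frac{(-\lambda)^k}{k!}\,\frac{\partial^k}{\partial\lambda^k}\,\tilde\ell_f(t,\psi(\lambda)).$$ 2. For every $k\ge0$, $p_k$ is locally absolutely continuous on $[0,\infty)$, and for every $t>0$ the derivative $\mathcal D^f_tp_k(t)$ exists and $$\mathcal D^f_t p_k(t)=-\psi(\lambda(I-B))\,p_k(t):=-\sum_{m=0}^{k}\psi^{(m)}(\lambda)\frac{(-\lambda)^m}{m!}\,p_{k-m}(t),$$ where $B$ is the backshift operator, $Bp_k=p_{k-1}$ with $p_{-1}=0$; moreover $p_0(0)=1$ and $p_k(0)=0$ for $k\ge 1$. 3. For every real $u$ with $|u|<1$, the probability generating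 function $G(u,t)=\mathbb E\,u^{N^{\psi,f}(t)}$ is locally absolutely continuous in $t\in[0,\infty)$ and satisfies, for every $t>0$, $$G(u,t)=\tilde\ell_f(t,\psi(\lambda(1-u))),\qquad \mathcal D^f_t G(u,t)=-\psi(\lambda(1-u))\,G(u,t),$$ and $G(u,0)=1$. -/

import Mathlib

open MeasureTheory ProbabilityTheory Set
open scoped NNReal ENNReal

noncomputable section

/-- The data `(a, b, ν̄)` of a Bernstein function: `a, b ≥ 0` and a measure `ν̄` carried by
`(0, ∞)` with `∫ (s ∧ 1) ν̄(ds) < ∞`. -/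
structure BernsteinData where
  a : ℝ
  b : ℝ
  levy : Measure ℝ
  a_nonneg : 0 ≤ a
  b_nonneg : 0 ≤ b
  levy_Iic : levy (Iic 0) = 0
  levy_finite : ∫⁻ s, ENNReal.ofReal (min s 1) ∂levy < ∞

namespace BernsteinData

/-- The Bernstein function `f(x) = a + b x + ∫_{(0,∞)} (1 - e^{-xs}) ν̄(ds)`, used for `x > 0`. -/
def eval (f : BernsteinData) (x : ℝ) : ℝ :=
  f.a + f.b * x + ∫ s in Ioi 0, (1 - Real.exp (-(x * s))) ∂f.levy

/-- The tail `ν(s) = a + ν̄(s, ∞)`, used for `s > 0`. -/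
def tail (f : BernsteinData) (s : ℝ) : ℝ :=
  f.a + f.levy.real (Ioi s)

/-- `ν̄(0, ∞) = ∞` and the tail `ν` is (locally) absolutely continuous on `(0, ∞)`. -/
def ConditionI (f : BernsteinData) : Prop :=
  f.levy (Ioi 0) = ∞ ∧ ∀ c d : ℝ, 0 < c → c < d → AbsolutelyContinuousOnInterval f.tail c d

/-- The generalized Caputo-Djrbashian derivative
`𝒟^f u (t) = b u'(t) + ∫_0^t (∂/∂t) u(t - s) ν(s) ds`. -/
def caputo (f : BernsteinData) (u : ℝ → ℝ) (t : ℝ) : ℝ :=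
  f.b * deriv u t + ∫ s in (0 : ℝ)..t, deriv (fun τ => u (τ - s)) t * f.tail s

/-- `𝒟^f u (t)` exists and equals `d`: `u` is absolutely continuous on bounded intervals of
`[0, ∞)`, every term of the definition of `𝒟^f u (t)` is meaningful (no default values), and the
value is `d`. -/
def HasCaputo (f : BernsteinData) (u : ℝ → ℝ) (t d : ℝ) : Prop :=
  (∀ T : ℝ, 0 < T → AbsolutelyContinuousOnInterval u 0 T) ∧
  (0 < f.b → DifferentiableAt ℝ u t) ∧
  IntervalIntegrable (fun s => deriv (fun τ => u (τ - s)) t * f.tail s) volume 0 t ∧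
  f.caputo u t = d

end BernsteinData

/-- `e^{-x h}` for `h ∈ [0, ∞]`, with `e^{-x ∞} = 0`. -/
def expNegMul (x : ℝ) (h : ℝ≥0∞) : ℝ :=
  if h = ∞ then 0 else Real.exp (-(x * h.toReal))

/-- A (possibly killed) subordinator `H` with Laplace exponent `f`, with values in `[0, ∞]`
(`∞` is the cemetery; when `f.a = 0` it is a.s. never reached): it starts at `0`, has
nondecreasing right-continuous paths, its increments after time `s` are, on the event `H s < ∞`,
independent of the past and distributed as `H`, and `E e^{-x H(t)} = e^{-t f(x)}`. -/
structure IsSubordinator {Ω : Type*} [MeasurableSpace Ω] (H : ℝ≥0 → Ω → ℝ≥0∞)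
    (f : BernsteinData) (P : Measure Ω) : Prop where
  measurable : ∀ t, Measurable (H t)
  zero : ∀ᵐ ω ∂P, H 0 ω = 0
  mono : ∀ᵐ ω ∂P, Monotone fun t => H t ω
  rightCont : ∀ᵐ ω ∂P, ∀ t, ContinuousWithinAt (fun r => H r ω) (Ici t) t
  increments : ∀ s t : ℝ≥0, ∀ A : Set Ω,
    MeasurableSet[⨆ r ∈ Iic s, MeasurableSpace.comap (H r) inferInstance] A →
    ∀ B : Set ℝ≥0∞, MeasurableSet B →
      P (A ∩ {ω | H s ω ≠ ∞} ∩ {ω | H (s + t) ω - H s ω ∈ B}) =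
        P (A ∩ {ω | H s ω ≠ ∞}) * P {ω | H t ω ∈ B}
  laplace : ∀ t : ℝ≥0, ∀ x : ℝ, 0 < x →
    ∫ ω, expNegMul x (H t ω) ∂P = Real.exp (-(t * f.eval x))

/-- A Poisson process with intensity `lam`. -/
structure IsPoissonProc {Ω : Type*} [MeasurableSpace Ω] (N : ℝ≥0 → Ω → ℕ)
    (lam : ℝ≥0) (P : Measure Ω) : Prop where
  measurable : ∀ t, Measurable (N t)
  zero : ∀ᵐ ω ∂P, N 0 ω = 0
  mono : ∀ᵐ ω ∂P, Monotone fun t => N t ω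
  rightCont : ∀ᵐ ω ∂P, ∀ t, ContinuousWithinAt (fun r => N r ω) (Ici t) t
  indep : HasIndepIncrements N P
  law : ∀ s t : ℝ≥0, s ≤ t → P.map (fun ω => N t ω - N s ω) = poissonMeasure (lam * (t - s))

section Objects

variable {Ω : Type*}

/-- The inverse process `Y(t) = inf {s ≥ 0 : H(s) > t}`. -/
def inverseProc (H : ℝ≥0 → Ω → ℝ≥0∞) (t : ℝ≥0) (ω : Ω) : ℝ≥0 :=
  sInf {s : ℝ≥0 | (t : ℝ≥0∞) < H s ω}

/-- `N(h)` for `h ∈ [0, ∞]`, with `N(∞) = ∞`. -/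
def countAt (N : ℝ≥0 → Ω → ℕ) (h : ℝ≥0∞) (ω : Ω) : ℕ∞ :=
  if h = ∞ then ⊤ else (N h.toNNReal ω : ℕ∞)

/-- The doubly time-changed process `N(H(Y(t)))`. -/
def timeChanged (N : ℝ≥0 → Ω → ℕ) (H : ℝ≥0 → Ω → ℝ≥0∞) (Y : ℝ≥0 → Ω → ℝ≥0)
    (t : ℝ≥0) (ω : Ω) : ℕ∞ :=
  countAt N (H (Y t ω) ω) ω

/-- `u ^ n` for `n ∈ ℕ ∪ {∞}` and `|u| < 1`, with `u ^ ∞ = 0`. -/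
def powENat (u : ℝ) (n : ℕ∞) : ℝ :=
  if n = ⊤ then 0 else u ^ n.toNat

variable [MeasurableSpace Ω]

/-- The probabilities `p_k(t) = P(X(t) = k)`, for real times `t ≥ 0`. -/
def probAt (P : Measure Ω) (X : ℝ≥0 → Ω → ℕ∞) (k : ℕ) (t : ℝ) : ℝ :=
  P.real {ω | X t.toNNReal ω = k}

/-- The probability generating function `G(u, t) = E u^{X(t)}`, for real times `t ≥ 0`. -/
def pgf (P : Measure Ω) (X : ℝ≥0 → Ω → ℕ∞) (u t : ℝ) : ℝ :=
  ∫ ω, powENat u (X t.toNNReal ω) ∂P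

/-- The law of `Y(t)` as a measure on `ℝ`. -/
def lawAt (P : Measure Ω) (Y : ℝ≥0 → Ω → ℝ≥0) (t : ℝ) : Measure ℝ :=
  P.map fun ω => (Y t.toNNReal ω : ℝ)

/-- The density `ℓ(t, x)` of `Y(t)` with respect to Lebesgue measure. -/
def density (P : Measure Ω) (Y : ℝ≥0 → Ω → ℝ≥0) (t x : ℝ) : ℝ :=
  ((lawAt P Y t).rnDeriv volume x).toReal

/-- The space Laplace transform `ℓ̃(t, η) = ∫_0^∞ e^{-ηx} ℓ(t, x) dx` of the density. -/
def densityLaplace (P : Measure Ω) (Y : ℝ≥0 → Ω → ℝ≥0) (t η : ℝ) : ℝ :=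
  ∫ x in Ioi (0 : ℝ), Real.exp (-(η * x)) * density P Y t x

end Objects

/-- The backshift operator `(B p)_k = p_{k-1}`, with `p_{-1} = 0`. -/
def backshift (p : ℕ → ℝ) : ℕ → ℝ
  | 0 => 0
  | k + 1 => p k

/-- The difference operator `ψ(lam (I - B))`, expanded in powers of the backshift:
`ψ(lam (I - B)) p_k = ∑_{m ≤ k} ψ^{(m)}(lam) (-lam)^m / m! · B^m p_k`
(the terms with `m > k` vanish). -/
def shiftOperator (ψ : ℝ → ℝ) (lam : ℝ) (p : ℕ → ℝ) (k : ℕ) : ℝ :=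
  ∑ m ∈ Finset.range (k + 1),
    iteratedDeriv m ψ lam * ((-lam) ^ m / (m.factorial : ℝ)) * (backshift^[m] p) k

end

/-! Write ρ_s for the law of H^f(s) on finite values and m_t for the law of Y^f(t). Averaging first
over N and then over H^ψ gives p_k(t) = E w_k(Y^f(t)) with w_k(s) = ((-λ)^k / k!) ∂_λ^k e^{-sψ(λ)},
and G(u, t) = E e^{-ηY^f(t)} with η = ψ(λ(1-u)). The formulas of parts 1 and 3 follow by
differentiating the Laplace transform of H^ψ(Y^f(t)). By Leibniz's rule w_k' = -ψ(λ(I-B)) w_k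
(`hasDerivAt_subordinatedWeight`), so both governing equations are instances of one statement
(`hasCaputo_integral`): if functions φ_i with values in [0, 1] satisfy φ_i' = ∑ c_ij φ_j, then
q_i(t) = E φ_i(Y^f(t)) satisfies 𝒟^f q_i = ∑ c_ij q_j.

For this, q_i(t) = φ_i(0) + ∑ c_ij E ∫_0^{Y(t)} φ_j(s) ds, and since P(Y(t) > s) = ρ_s[0, t] the
expectation is U_j[0, t], where U_j = ∫ φ_j(s) ρ_s ds. If u_j is a density of U_j, the claim becomes
the renewal equation b u_j + ν * u_j = E φ_j(Y(t)). Both sides have the Laplace transform (f(x)/x) ∫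
e^{-s f(x)} φ_j(s) ds, which settles almost every t (`ae_potential_add_convolution`).

The equation is claimed at every t. If b = 0, the Markov property at a small level σ lets the
absolutely continuous law ρ_σ average out the exceptional times, and then σ → 0
(`convolution_eq_of_drift_eq_zero`). If b > 0, the equation itself selects a continuous version of
u_j (`exists_density`). The same averaging shows that m_t has a density for every t > 0
(`m_absolutelyContinuous`).

Absolute continuity of ρ_s comes from the infinite Lévy measure with absolutely continuous tail:
jumps larger than ε form a compound Poisson law whose only singular part is an atom of mass e^{-s
ν̄(ε,∞)}, which tends to 0 with ε. -/

noncomputable section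

open Filter Topology

/-! ### Laplace transforms of measures on the half-line -/

/-- The Laplace transform of a measure, as an extended nonnegative number. -/
def laplaceTransform (μ : Measure ℝ) (x : ℝ) : ℝ≥0∞ :=
  ∫⁻ r, ENNReal.ofReal (Real.exp (-(x * r))) ∂μ

lemma measurable_ofReal_exp_neg_mul (x : ℝ) :
    Measurable fun r : ℝ => ENNReal.ofReal (Real.exp (-(x * r))) := by fun_prop

lemma integrable_comp_exp_neg {κ : Measure ℝ} [IsFiniteMeasure κ] (h0 : ∀ᵐ r ∂κ, 0 ≤ r)
    {g : ℝ → ℝ} (hg : Continuous g) : Integrable (fun r => g (Real.exp (-r))) κ := by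
  obtain ⟨C, hC⟩ := (isCompact_Icc (a := (0 : ℝ)) (b := 1)).exists_bound_of_continuousOn
    hg.continuousOn
  refine Integrable.of_bound (C := C) ?_ ?_
  · exact (hg.comp (by fun_prop)).aestronglyMeasurable
  · filter_upwards [h0] with r hr
    exact hC _ ⟨(Real.exp_pos _).le, Real.exp_le_one_iff.2 (by linarith)⟩

lemma integral_exp_neg_pow {κ : Measure ℝ} (k : ℕ) :
    ∫ r, Real.exp (-r) ^ k ∂κ = (laplaceTransform κ k).toReal := by
  rw [laplaceTransform, integral_eq_lintegral_of_nonneg_ae (ae_of_all _ fun r => by positivity)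
    (by fun_prop)]
  congr 2 with r
  rw [← Real.exp_nat_mul]; ring_nf

lemma laplaceTransform_ne_top {κ : Measure ℝ} [IsFiniteMeasure κ] (h0 : ∀ᵐ r ∂κ, 0 ≤ r)
    {x : ℝ} (hx : 0 ≤ x) : laplaceTransform κ x ≠ ∞ := by
  refine ne_top_of_le_ne_top (measure_ne_top κ univ) ?_
  calc laplaceTransform κ x ≤ ∫⁻ _, 1 ∂κ := by
        refine lintegral_mono_ae ?_
        filter_upwards [h0] with r hr
        rw [ENNReal.ofReal_le_one, Real.exp_le_one_iff]
        nlinarith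
    _ = κ univ := by simp

/-- The substitution y = e^{-r} turns Laplace transforms at integers into moments on [0, 1], so
Weierstrass approximation applies. Only orders k ≥ 1 are tested, because mass may escape to r = ∞,
that is to y = 0; hence the condition `g 0 = 0` and approximants without constant term. -/
lemma tendsto_integral_comp_exp_neg {κ : Measure ℝ} [IsFiniteMeasure κ] {κn : ℕ → Measure ℝ}
    [∀ n, IsFiniteMeasure (κn n)] (h0 : ∀ᵐ r ∂κ, 0 ≤ r) (hn0 : ∀ n, ∀ᵐ r ∂κn n, 0 ≤ r)
    {C : ℝ} (hκ : κ.real univ ≤ C) (hκn : ∀ n, (κn n).real univ ≤ C)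
    (hlim : ∀ k : ℕ, 1 ≤ k →
      Tendsto (fun n => laplaceTransform (κn n) k) atTop (𝓝 (laplaceTransform κ k)))
    {g : ℝ → ℝ} (hg : Continuous g) (hg0 : g 0 = 0) :
    Tendsto (fun n => ∫ r, g (Real.exp (-r)) ∂κn n) atTop
      (𝓝 (∫ r, g (Real.exp (-r)) ∂κ)) := by
  have hC0 : 0 ≤ C := measureReal_nonneg.trans hκ
  have hpoly : ∀ q : Polynomial ℝ,
      Tendsto (fun n => ∫ r, q.eval (Real.exp (-r)) * Real.exp (-r) ∂κn n) atTop
        (𝓝 (∫ r, q.eval (Real.exp (-r)) * Real.exp (-r) ∂κ)) := by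
    intro q
    have key : ∀ (κ' : Measure ℝ) [IsFiniteMeasure κ'], (∀ᵐ r ∂κ', 0 ≤ r) →
        ∫ r, q.eval (Real.exp (-r)) * Real.exp (-r) ∂κ' =
          ∑ i ∈ Finset.range (q.natDegree + 1),
            q.coeff i * (laplaceTransform κ' ((i + 1 : ℕ) : ℝ)).toReal := by
      intro κ' _ h'
      simp_rw [Polynomial.eval_eq_sum_range, Finset.sum_mul, mul_assoc, ← pow_succ]
      rw [integral_finsetSum]
      · simp_rw [integral_const_mul, integral_exp_neg_pow]
      · intro i _
        exact (integrable_comp_exp_neg h' (g := fun y => y ^ (i + 1)) (by fun_prop)).const_mul _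
    rw [key κ h0]
    simp_rw [fun n => key (κn n) (hn0 n)]
    refine tendsto_finsetSum _ fun i _ => Tendsto.const_mul _ ?_
    exact (ENNReal.tendsto_toReal (laplaceTransform_ne_top h0 (by positivity))).comp
      (hlim (i + 1) (by omega))
  rw [Metric.tendsto_atTop]
  intro ε hε
  -- Dropping the constant term of p costs a second error of the same size, as `g 0 = 0`. With
  -- masses at most C, each of the two replacements of g then costs less than ε/3, and the last
  -- third is left for the moments.
  obtain ⟨p, hp⟩ := exists_polynomial_near_of_continuousOn 0 1 g hg.continuousOn
    (ε / (6 * (C + 1))) (by positivity)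
  set q := p.divX with hq
  have hqp : ∀ y, q.eval y * y = p.eval y - p.eval 0 := by
    intro y
    have := congrArg (Polynomial.eval y) (Polynomial.divX_mul_X_add p)
    simp only [Polynomial.eval_add, Polynomial.eval_mul, Polynomial.eval_X,
      Polynomial.eval_C] at this
    rw [← this, ← Polynomial.coeff_zero_eq_eval_zero]; ring
  have hclose : ∀ y ∈ Icc (0 : ℝ) 1, |g y - q.eval y * y| ≤ ε / (3 * (C + 1)) := by
    intro y hy
    have h1 := hp y hy
    have h2 := hp 0 (by simp)
    rw [hg0] at h2
    have : ε / (3 * (C + 1)) = ε / (6 * (C + 1)) + ε / (6 * (C + 1)) := by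
      field_simp; ring
    rw [hqp, this]
    rw [abs_lt] at h1 h2
    rw [abs_le]; constructor <;> linarith [h1.1, h1.2, h2.1, h2.2]
  have hint : ∀ (κ' : Measure ℝ) [IsFiniteMeasure κ'], (∀ᵐ r ∂κ', 0 ≤ r) → κ'.real univ ≤ C →
      |∫ r, g (Real.exp (-r)) ∂κ' - ∫ r, q.eval (Real.exp (-r)) * Real.exp (-r) ∂κ'| < ε / 3 := by
    intro κ' _ h' hC'
    rw [← integral_sub (integrable_comp_exp_neg h' hg)
      (integrable_comp_exp_neg h' (g := fun y => q.eval y * y) (by fun_prop))]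
    calc |∫ r, (g (Real.exp (-r)) - q.eval (Real.exp (-r)) * Real.exp (-r)) ∂κ'|
        ≤ ε / (3 * (C + 1)) * κ'.real univ := by
          rw [← Real.norm_eq_abs]
          refine norm_integral_le_of_norm_le_const ?_
          filter_upwards [h'] with r hr
          exact hclose _ ⟨(Real.exp_pos _).le, Real.exp_le_one_iff.2 (by linarith)⟩
      _ ≤ ε / (3 * (C + 1)) * C := by gcongr
      _ < ε / 3 := by
          rw [div_mul_eq_mul_div, div_lt_div_iff₀ (by positivity) (by positivity)]
          nlinarith
  obtain ⟨M, hM⟩ := Metric.tendsto_atTop.1 (hpoly q) (ε / 3) (by positivity)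
  refine ⟨M, fun n hn => ?_⟩
  have h1 := hint (κn n) (hn0 n) (hκn n)
  have h2 := hint κ h0 hκ
  have h3 := hM n hn
  rw [Real.dist_eq] at h3 ⊢
  rw [abs_lt] at *
  constructor <;> linarith [h1.1, h1.2, h2.1, h2.2, h3.1, h3.2]

/-- If the Laplace transforms converge, a common bound for the masses of an open set passes to the
limit. -/
lemma measureReal_le_of_tendsto_laplaceTransform {κ : Measure ℝ} [IsFiniteMeasure κ]
    {κn : ℕ → Measure ℝ} [∀ n, IsFiniteMeasure (κn n)] (h0 : ∀ᵐ r ∂κ, 0 ≤ r)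
    (hn0 : ∀ n, ∀ᵐ r ∂κn n, 0 ≤ r)
    {C : ℝ} (hκ : κ.real univ ≤ C) (hκn : ∀ n, (κn n).real univ ≤ C)
    (hlim : ∀ k : ℕ, 1 ≤ k →
      Tendsto (fun n => laplaceTransform (κn n) k) atTop (𝓝 (laplaceTransform κ k)))
    {A : Set ℝ} (hA : IsOpen A) {K : ℝ} (hK : ∀ n, (κn n).real A ≤ K) : κ.real A ≤ K := by
  -- S is the image of A under r ↦ e^{-r}. It omits 0, so the continuous minorants `g j` of its
  -- indicator vanish at 0, as `tendsto_integral_comp_exp_neg` demands.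
  set S : Set ℝ := Ioi 0 ∩ Real.log ⁻¹' (-A) with hS
  have hSo : IsOpen S := by
    refine ContinuousOn.isOpen_inter_preimage ?_ isOpen_Ioi hA.neg
    exact Real.continuousOn_log.mono fun x hx => ne_of_gt hx
  have hmem : ∀ r, Real.exp (-r) ∈ S ↔ r ∈ A := fun r => by
    simp [hS, Real.exp_pos]
  have h0S : (0 : ℝ) ∈ Sᶜ := by simp [hS]
  have hSc : IsClosed Sᶜ := hSo.isClosed_compl
  let g : ℕ → ℝ → ℝ := fun j y => min 1 (j * Metric.infDist y Sᶜ)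
  have hgc : ∀ j, Continuous (g j) := fun j =>
    continuous_const.min (continuous_const.mul (Metric.continuous_infDist_pt _))
  have hg0 : ∀ j, g j 0 = 0 := fun j => by simp [g, Metric.infDist_zero_of_mem h0S]
  have hgnn : ∀ j y, 0 ≤ g j y := fun j y =>
    le_min zero_le_one (mul_nonneg (Nat.cast_nonneg _) Metric.infDist_nonneg)
  have hgle : ∀ j r, g j (Real.exp (-r)) ≤ A.indicator 1 r := by
    intro j r
    by_cases hr : r ∈ A
    · simp [hr, g]
    · have : Real.exp (-r) ∈ Sᶜ := fun h => hr ((hmem r).1 h)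
      simp [hr, g, Metric.infDist_zero_of_mem this]
  have hint1 : ∀ (κ' : Measure ℝ), ∫ r, A.indicator (1 : ℝ → ℝ) r ∂κ' = κ'.real A := fun κ' =>
    integral_indicator_one hA.measurableSet
  have hb : ∀ j, ∫ r, g j (Real.exp (-r)) ∂κ ≤ K := by
    intro j
    refine le_of_tendsto (tendsto_integral_comp_exp_neg h0 hn0 hκ hκn hlim (hgc j) (hg0 j))
      (Eventually.of_forall fun n => ?_)
    refine le_trans ?_ (hK n)
    rw [← hint1]
    refine integral_mono (integrable_comp_exp_neg (hn0 n) (hgc j)) ?_ (hgle j)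
    exact (integrable_const (1 : ℝ)).indicator hA.measurableSet
  rw [← hint1]
  refine le_of_tendsto (f := fun j => ∫ r, g j (Real.exp (-r)) ∂κ) (x := atTop) ?_
    (Eventually.of_forall hb)
  refine tendsto_integral_of_dominated_convergence (fun _ => (1 : ℝ)) ?_ (integrable_const _) ?_ ?_
  · exact fun j => ((hgc j).comp (by fun_prop)).aestronglyMeasurable
  · refine fun j => ae_of_all _ fun r => ?_
    rw [Real.norm_of_nonneg (hgnn _ _)]; exact min_le_left _ _
  · refine ae_of_all _ fun r => ?_
    by_cases hr : r ∈ A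
    · have hpos : 0 < Metric.infDist (Real.exp (-r)) Sᶜ := by
        rw [← hSc.notMem_iff_infDist_pos ⟨0, h0S⟩]
        exact fun h => h ((hmem r).2 hr)
      simp only [hr, indicator_of_mem, Pi.one_apply]
      refine tendsto_const_nhds.congr' ?_
      obtain ⟨M, hM⟩ := exists_nat_gt (1 / Metric.infDist (Real.exp (-r)) Sᶜ)
      filter_upwards [eventually_ge_atTop M] with j hj
      have : (1 : ℝ) ≤ j * Metric.infDist (Real.exp (-r)) Sᶜ := by
        rw [div_lt_iff₀ hpos] at hM
        have : (M : ℝ) ≤ j := by exact_mod_cast hj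
        nlinarith
      simp [g, this]
    · have : Real.exp (-r) ∈ Sᶜ := fun h => hr ((hmem r).1 h)
      simp [hr, g, Metric.infDist_zero_of_mem this]

/-- The bound for open sets, applied to constant sequences in both directions, gives equality on a
π-system that contains the whole line; so the total masses agree although order 0 is not tested. -/
lemma measure_eq_of_laplaceTransform_eq {κ κ' : Measure ℝ} [IsFiniteMeasure κ]
    [IsFiniteMeasure κ'] (h0 : ∀ᵐ r ∂κ, 0 ≤ r) (h0' : ∀ᵐ r ∂κ', 0 ≤ r)
    (h : ∀ k : ℕ, 1 ≤ k → laplaceTransform κ k = laplaceTransform κ' k) : κ = κ' := by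
  have hopen : ∀ A : Set ℝ, IsOpen A → κ A = κ' A := by
    intro A hA
    have h1 : κ.real A ≤ κ'.real A :=
      measureReal_le_of_tendsto_laplaceTransform (κn := fun _ => κ') h0 (fun _ => h0')
        (le_max_left _ (κ'.real univ)) (fun _ => le_max_right _ _)
        (fun k hk => by rw [h k hk]; exact tendsto_const_nhds) hA fun _ => le_rfl
    have h2 : κ'.real A ≤ κ.real A :=
      measureReal_le_of_tendsto_laplaceTransform (κn := fun _ => κ) h0' (fun _ => h0)
        (le_max_left _ (κ.real univ)) (fun _ => le_max_right _ _)
        (fun k hk => by rw [h k hk]; exact tendsto_const_nhds) hA fun _ => le_rfl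
    exact (measureReal_eq_measureReal_iff).1 (le_antisymm h1 h2)
  exact ext_of_generate_finite _ (BorelSpace.measurable_eq (α := ℝ)) isPiSystem_isOpen hopen
    (hopen _ isOpen_univ)

/-- Measures on `[0, ∞)` with the same finite Laplace transform are equal. -/
lemma measure_eq_of_laplaceTransform_eq_of_ne_top {κ κ' : Measure ℝ}
    (h0 : ∀ᵐ r ∂κ, 0 ≤ r) (h0' : ∀ᵐ r ∂κ', 0 ≤ r)
    (hfin : laplaceTransform κ 1 ≠ ∞)
    (h : ∀ x : ℝ, 0 < x → laplaceTransform κ x = laplaceTransform κ' x) : κ = κ' := by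
  -- Tilting by e^{-r} makes both measures finite and shifts their transforms by 1; the density w is
  -- invertible, so nothing is lost.
  set w : ℝ → ℝ≥0∞ := fun r => ENNReal.ofReal (Real.exp (-(1 * r))) with hw
  have hwm : Measurable w := measurable_ofReal_exp_neg_mul 1
  have hw0 : ∀ r, w r ≠ 0 := fun r => by simp [hw, Real.exp_pos]
  have hwt : ∀ r, w r ≠ ∞ := fun r => by simp [hw]
  have hlt : ∀ (μ : Measure ℝ) (x : ℝ),
      laplaceTransform (μ.withDensity w) x = laplaceTransform μ (1 + x) := by
    intro μ x
    rw [laplaceTransform, lintegral_withDensity_eq_lintegral_mul _ hwm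
      (measurable_ofReal_exp_neg_mul x), laplaceTransform]
    congr with r
    rw [Pi.mul_apply, hw, ← ENNReal.ofReal_mul (Real.exp_pos _).le, ← Real.exp_add]
    ring_nf
  have hf : IsFiniteMeasure (κ.withDensity w) := isFiniteMeasure_withDensity hfin
  have hf' : IsFiniteMeasure (κ'.withDensity w) :=
    isFiniteMeasure_withDensity (by rw [h 1 one_pos] at hfin; exact hfin)
  have : κ.withDensity w = κ'.withDensity w := by
    refine measure_eq_of_laplaceTransform_eq
      ((withDensity_absolutelyContinuous κ w).ae_le h0)
      ((withDensity_absolutelyContinuous κ' w).ae_le h0') fun k _ => ?_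
    rw [hlt, hlt, h _ (by positivity)]
  rw [← withDensity_inv_same (μ := κ) hwm (ae_of_all _ hw0) (ae_of_all _ hwt), this,
    withDensity_inv_same hwm (ae_of_all _ hw0) (ae_of_all _ hwt)]

lemma laplaceTransform_conv (μ ν : Measure ℝ) [SFinite μ] [SFinite ν] (x : ℝ) :
    laplaceTransform (μ ∗ ν) x = laplaceTransform μ x * laplaceTransform ν x := by
  rw [laplaceTransform, Measure.lintegral_conv (measurable_ofReal_exp_neg_mul x)]
  simp_rw [mul_add, neg_add, Real.exp_add, ENNReal.ofReal_mul (Real.exp_pos _).le]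
  simp_rw [lintegral_const_mul _ (measurable_ofReal_exp_neg_mul x)]
  rw [lintegral_mul_const _ (measurable_ofReal_exp_neg_mul x)]
  rfl

lemma ae_nonneg_conv {μ ν : Measure ℝ} [SFinite μ] [SFinite ν] (hμ : ∀ᵐ r ∂μ, 0 ≤ r)
    (hν : ∀ᵐ r ∂ν, 0 ≤ r) : ∀ᵐ r ∂(μ ∗ ν), 0 ≤ r := by
  rw [ae_iff, ← lintegral_indicator_one (by simp only [not_le]; exact measurableSet_Iio),
    Measure.lintegral_conv (measurable_one.indicator
      (by simp only [not_le]; exact measurableSet_Iio)), lintegral_eq_zero_iff' ]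
  · filter_upwards [hμ] with r hr
    rw [Pi.zero_apply, lintegral_eq_zero_iff']
    · filter_upwards [hν] with s hs
      simp; linarith
    · exact ((measurable_one.indicator (by simp only [not_le]; exact measurableSet_Iio)).comp
        (measurable_const_add r)).aemeasurable
  · refine Measurable.aemeasurable (Measurable.lintegral_prod_right'
      (f := fun p : ℝ × ℝ => {a : ℝ | ¬0 ≤ a}.indicator (1 : ℝ → ℝ≥0∞) (p.1 + p.2)) ?_)
    exact (measurable_one.indicator (by simp only [not_le]; exact measurableSet_Iio)).comp
      (measurable_fst.add measurable_snd)

/-! ### The Lévy measure and its tail -/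

namespace BernsteinData

variable (f : BernsteinData)

lemma ae_levy_pos : ∀ᵐ s ∂f.levy, 0 < s := by
  rw [ae_iff]
  simp only [not_lt]
  exact f.levy_Iic

/-- The measure (s ∧ 1) ν̄(ds) is finite, and its density can be divided out since it is positive
ν̄-almost everywhere. Needed to exchange integrals in `laplace_tailExt`. -/
lemma sFinite_levy : SFinite f.levy := by
  set w : ℝ → ℝ≥0∞ := fun s => ENNReal.ofReal (min s 1) with hw
  have hwm : Measurable w := by fun_prop
  have : IsFiniteMeasure (f.levy.withDensity w) := isFiniteMeasure_withDensity f.levy_finite.ne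
  rw [← withDensity_inv_same (μ := f.levy) hwm ?_ (ae_of_all _ fun s => by simp [hw])]
  · infer_instance
  · filter_upwards [f.ae_levy_pos] with s hs
    simp [hw, hs]

lemma levy_Ioi_lt_top {δ : ℝ} (hδ : 0 < δ) : f.levy (Ioi δ) < ∞ := by
  have h1 : ENNReal.ofReal (min δ 1) * f.levy (Ioi δ) ≤
      ∫⁻ s, ENNReal.ofReal (min s 1) ∂f.levy := by
    rw [← setLIntegral_const]
    refine (setLIntegral_mono (by fun_prop) fun s hs => ?_).trans (setLIntegral_le_lintegral _ _)
    exact ENNReal.ofReal_le_ofReal (min_le_min_right _ (le_of_lt hs))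
  have h2 := h1.trans_lt f.levy_finite
  by_contra h
  rw [not_lt, top_le_iff] at h
  rw [h, ENNReal.mul_top (by simp [hδ])] at h2
  exact lt_irrefl _ h2

lemma integrable_one_sub_exp {x : ℝ} (hx : 0 ≤ x) :
    Integrable (fun s => 1 - Real.exp (-(x * s))) f.levy := by
  have hmin : Integrable (fun s => min s 1) f.levy := by
    refine ⟨by fun_prop, ?_⟩
    rw [hasFiniteIntegral_iff_ofReal]
    · exact f.levy_finite
    · filter_upwards [f.ae_levy_pos] with s hs
      exact le_min hs.le zero_le_one
  refine (hmin.const_mul (max x 1)).mono' (by fun_prop) ?_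
  filter_upwards [f.ae_levy_pos] with s hs
  have h1 : Real.exp (-(x * s)) ≤ 1 := Real.exp_le_one_iff.2 (by nlinarith)
  rw [Real.norm_of_nonneg (by linarith)]
  have h2 : 1 - Real.exp (-(x * s)) ≤ x * s := by
    have := Real.add_one_le_exp (-(x * s)); linarith
  have h3 := Real.exp_pos (-(x * s))
  rcases le_total s 1 with h | h
  · rw [min_eq_left h]
    exact h2.trans (mul_le_mul_of_nonneg_right (le_max_left _ _) hs.le)
  · rw [min_eq_right h]
    have := le_max_right x 1
    linarith

lemma setIntegral_levy_nonneg {x : ℝ} (hx : 0 ≤ x) (s : Set ℝ) :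
    0 ≤ ∫ s in s, (1 - Real.exp (-(x * s))) ∂f.levy := by
  refine integral_nonneg_of_ae (ae_restrict_of_ae ?_)
  filter_upwards [f.ae_levy_pos] with s hs
  have : Real.exp (-(x * s)) ≤ 1 := Real.exp_le_one_iff.2 (by nlinarith)
  simpa using this

lemma eval_nonneg {x : ℝ} (hx : 0 ≤ x) : 0 ≤ f.eval x := by
  have := f.a_nonneg
  have := mul_nonneg f.b_nonneg hx
  have := f.setIntegral_levy_nonneg hx (Ioi 0)
  unfold eval
  linarith

lemma tail_nonneg (s : ℝ) : 0 ≤ f.tail s := add_nonneg f.a_nonneg measureReal_nonneg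

lemma ofReal_tail {s : ℝ} (hs : 0 < s) :
    ENNReal.ofReal (f.tail s) = ENNReal.ofReal f.a + f.levy (Ioi s) := by
  rw [tail, ENNReal.ofReal_add f.a_nonneg measureReal_nonneg, ofReal_measureReal
    (f.levy_Ioi_lt_top hs).ne]

lemma tail_antitoneOn : AntitoneOn f.tail (Ioi 0) := by
  intro x hx y _ hxy
  unfold tail
  gcongr
  exact (f.levy_Ioi_lt_top hx).ne

lemma measurable_levy_Ioi : Measurable fun s => f.levy (Ioi s) :=
  Antitone.measurable fun _ _ h => measure_mono (Ioi_subset_Ioi h)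

lemma measurable_tail : Measurable f.tail :=
  (f.measurable_levy_Ioi.ennreal_toReal).const_add _

variable {f}

lemma ConditionI.eval_pos (hf : f.ConditionI) {x : ℝ} (hx : 0 < x) : 0 < f.eval x := by
  have h1 : 0 < ∫ s in Ioi 0, (1 - Real.exp (-(x * s))) ∂f.levy := by
    rw [setIntegral_pos_iff_support_of_nonneg_ae]
    · rw [Set.inter_eq_self_of_subset_right, hf.1]
      · simp
      · intro s hs
        have : Real.exp (-(x * s)) < 1 := by
          rw [Real.exp_lt_one_iff]
          exact neg_lt_zero.2 (mul_pos hx hs)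
        simp only [Function.mem_support]
        linarith
    · refine ae_restrict_of_ae ?_
      filter_upwards [f.ae_levy_pos] with s hs
      have : Real.exp (-(x * s)) ≤ 1 := Real.exp_le_one_iff.2 (by nlinarith)
      simpa using this
    · exact (f.integrable_one_sub_exp hx.le).integrableOn
  have := f.a_nonneg
  have := mul_nonneg f.b_nonneg hx.le
  unfold eval
  linarith

/-- On (c, d] the tail is the integral of its derivative and its decrements are the masses of
intervals, so -ν' is a Lebesgue density there. Countably many such intervals exhaust (0, ∞). -/
lemma ConditionI.levy_absolutelyContinuous (hf : f.ConditionI) : f.levy ≪ volume := by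
  have key : ∀ c d : ℝ, 0 < c → c < d → f.levy.restrict (Ioc c d) ≪ volume := by
    intro c d hc hcd
    have hac := hf.2 c d hc hcd
    have hfin : IsFiniteMeasure (f.levy.restrict (Ioc c d)) :=
      ⟨by
        rw [Measure.restrict_apply_univ]
        exact (measure_mono Ioc_subset_Ioi_self).trans_lt (f.levy_Ioi_lt_top hc)⟩
    have hder : ∀ x ∈ Ioo c d, deriv f.tail x ≤ 0 := by
      intro x hx
      rw [← derivWithin_of_isOpen isOpen_Ioi (mem_Ioi.2 (hc.trans hx.1))]
      exact f.tail_antitoneOn.derivWithin_nonpos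
    have hint : IntervalIntegrable (deriv f.tail) volume c d := hac.intervalIntegrable_deriv
    have hae : ∀ᵐ x ∂(volume.restrict (Ioc c d)), 0 ≤ -deriv f.tail x := by
      rw [← restrict_Ioo_eq_restrict_Ioc]
      filter_upwards [self_mem_ae_restrict measurableSet_Ioo] with x hx
      linarith [hder x hx]
    have : f.levy.restrict (Ioc c d) =
        (volume.restrict (Ioc c d)).withDensity fun x => ENNReal.ofReal (-deriv f.tail x) := by
      refine Measure.ext_of_Ioc _ _ fun a b hab => ?_
      rw [Measure.restrict_apply measurableSet_Ioc, withDensity_apply _ measurableSet_Ioc,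
        Measure.restrict_restrict measurableSet_Ioc, Ioc_inter_Ioc]
      rcases le_or_gt (b ⊓ d) (a ⊔ c) with h | h
      · simp [Ioc_eq_empty_of_le h]
      set p := a ⊔ c with hp
      set q := b ⊓ d with hq
      have hcp : c ≤ p := le_sup_right
      have hqd : q ≤ d := inf_le_right
      have hsub : Ioc p q ⊆ Ioc c d := Ioc_subset_Ioc hcp hqd
      rw [← ofReal_integral_eq_lintegral_ofReal]
      · rw [integral_neg, ← intervalIntegral.integral_of_le h.le,
          (hac.mono ?_).integral_deriv_eq_sub]
        · have hfp : f.levy (Ioi p) ≠ ∞ := (f.levy_Ioi_lt_top (hc.trans_le hcp)).ne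
          have : f.levy.real (Ioi p) = f.levy.real (Ioc p q) + f.levy.real (Ioi q) := by
            rw [← Ioc_union_Ioi_eq_Ioi h.le]
            refine measureReal_union Ioc_disjoint_Ioi_same measurableSet_Ioi ?_ ?_
            · exact ((measure_mono Ioc_subset_Ioi_self).trans_lt hfp.lt_top).ne
            · exact ((measure_mono (Ioi_subset_Ioi h.le)).trans_lt hfp.lt_top).ne
          rw [tail, tail, this, show -(f.a + f.levy.real (Ioi q) -
            (f.a + (f.levy.real (Ioc p q) + f.levy.real (Ioi q)))) = f.levy.real (Ioc p q) by ring,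
            ofReal_measureReal ((measure_mono Ioc_subset_Ioi_self).trans_lt hfp.lt_top).ne]
        · rw [uIcc_of_le h.le, uIcc_of_le hcd.le]
          exact Icc_subset_Icc hcp hqd
      · exact (hint.1.mono_set hsub).neg
      · exact ae_mono (Measure.restrict_mono hsub le_rfl) hae
    rw [this]
    exact (withDensity_absolutelyContinuous _ _).trans Measure.absolutelyContinuous_restrict
  intro A hA
  have hU : A ⊆ Iic 0 ∪ ⋃ n : ℕ, (A ∩ Ioc (1 / ((n : ℝ) + 1)) ((n : ℝ) + 2)) := by
    intro x hx
    rcases le_or_gt x 0 with h | h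
    · exact Or.inl h
    · obtain ⟨n, hn⟩ := exists_nat_gt (max x (1 / x))
      refine Or.inr (mem_iUnion.2 ⟨n, hx, ?_, ?_⟩)
      · have : 1 / x < n := (le_max_right _ _).trans_lt hn
        rw [div_lt_iff₀ (by positivity)]
        rw [div_lt_iff₀ h] at this
        linarith
      · have : x < n := (le_max_left _ _).trans_lt hn
        linarith
  refine measure_mono_null hU (measure_union_null f.levy_Iic (measure_iUnion_null fun n => ?_))
  have h0 : (0 : ℝ) < 1 / ((n : ℝ) + 1) := by positivity
  have h1 : 1 / ((n : ℝ) + 1) < (n : ℝ) + 2 := by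
    rw [div_lt_iff₀ (by positivity)]; nlinarith [(Nat.cast_nonneg n : (0 : ℝ) ≤ n)]
  have := key _ _ h0 h1 hA
  rwa [Measure.restrict_apply' measurableSet_Ioc] at this

variable (f)

/-- The tail `ν` extended by zero to `(-∞, 0]`, with values in `[0, ∞]`. -/
def tailExt (s : ℝ) : ℝ≥0∞ := (Ioi 0).indicator (fun s => ENNReal.ofReal (f.tail s)) s

lemma measurable_tailExt : Measurable f.tailExt :=
  (f.measurable_tail.ennreal_ofReal).indicator measurableSet_Ioi

lemma setLIntegral_exp_neg {x : ℝ} (hx : 0 < x) {y : ℝ} (hy : 0 < y) :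
    ∫⁻ s in Ioo 0 y, ENNReal.ofReal (Real.exp (-(x * s))) =
      ENNReal.ofReal ((1 - Real.exp (-(x * y))) / x) := by
  rw [← ofReal_integral_eq_lintegral_ofReal]
  · congr 1
    rw [← integral_Ioc_eq_integral_Ioo, ← intervalIntegral.integral_of_le hy.le]
    have : ∀ s ∈ uIcc 0 y, HasDerivAt (fun s => -Real.exp (-(x * s)) / x)
        (Real.exp (-(x * s))) s := by
      intro s _
      have h := (((hasDerivAt_id s).const_mul x).neg.exp.neg).div_const x
      convert! h using 1
      simp only [id_eq]
      field_simp
      rfl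
    rw [intervalIntegral.integral_eq_sub_of_hasDerivAt this
      (Continuous.intervalIntegrable (by fun_prop) _ _)]
    simp only [mul_zero, neg_zero, Real.exp_zero]
    ring
  · exact (Continuous.integrableOn_Icc (by fun_prop)).mono_set Ioo_subset_Icc_self
  · exact ae_of_all _ fun s => (Real.exp_pos _).le

lemma lintegral_exp_neg_Ioi {x : ℝ} (hx : 0 < x) (c : ℝ) :
    ∫⁻ s in Ioi c, ENNReal.ofReal (Real.exp (-(x * s))) =
      ENNReal.ofReal (Real.exp (-(x * c)) / x) := by
  rw [← ofReal_integral_eq_lintegral_ofReal]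
  · congr 1
    have := integral_exp_mul_Ioi (a := -x) (by linarith) c
    simp only [neg_mul] at this
    rw [this, neg_div_neg_eq]
  · have := integrableOn_exp_mul_Ioi (a := -x) (by linarith) c
    simp only [neg_mul] at this
    exact this
  · exact ae_of_all _ fun s => (Real.exp_pos _).le

/-- The Laplace transform of the tail: `b + ∫ e^{-xs} ν(s) ds = f(x) / x`. -/
lemma laplace_tailExt {x : ℝ} (hx : 0 < x) :
    ENNReal.ofReal f.b + ∫⁻ s, ENNReal.ofReal (Real.exp (-(x * s))) * f.tailExt s =
      ENNReal.ofReal (f.eval x / x) := by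
  have := f.sFinite_levy
  have h1 : ∫⁻ s, ENNReal.ofReal (Real.exp (-(x * s))) * f.tailExt s =
      ENNReal.ofReal f.a * ENNReal.ofReal (1 / x) +
        ∫⁻ s in Ioi 0, ENNReal.ofReal (Real.exp (-(x * s))) * f.levy (Ioi s) := by
    have : ∀ s, ENNReal.ofReal (Real.exp (-(x * s))) * f.tailExt s =
        (Ioi 0).indicator (fun s => ENNReal.ofReal f.a * ENNReal.ofReal (Real.exp (-(x * s))) +
          ENNReal.ofReal (Real.exp (-(x * s))) * f.levy (Ioi s)) s := by
      intro s
      by_cases hs : s ∈ Ioi (0 : ℝ)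
      · rw [tailExt, indicator_of_mem hs, indicator_of_mem hs, ofReal_tail _ hs]; ring
      · rw [tailExt, indicator_of_notMem hs, indicator_of_notMem hs, mul_zero]
    simp_rw [this]
    rw [lintegral_indicator measurableSet_Ioi, lintegral_add_left (by fun_prop),
      lintegral_const_mul _ (by fun_prop), lintegral_exp_neg_Ioi hx]
    simp
  have h2 : ∫⁻ s in Ioi 0, ENNReal.ofReal (Real.exp (-(x * s))) * f.levy (Ioi s) =
      ENNReal.ofReal ((∫ s in Ioi 0, (1 - Real.exp (-(x * s))) ∂f.levy) / x) := by
    -- Tonelli over {0 < s < y}: the inner integral of e^{-xs} over (0, y) is (1 - e^{-xy}) / x.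
    have hE : ∀ s, ENNReal.ofReal (Real.exp (-(x * s))) * f.levy (Ioi s) =
        ∫⁻ y, (Ioi s).indicator (fun _ => ENNReal.ofReal (Real.exp (-(x * s)))) y ∂f.levy := by
      intro s
      rw [lintegral_indicator measurableSet_Ioi, setLIntegral_const]
    simp_rw [hE]
    have hm : Measurable fun p : ℝ × ℝ =>
        (Ioi p.1).indicator (fun _ => ENNReal.ofReal (Real.exp (-(x * p.1)))) p.2 := by
      have : (fun p : ℝ × ℝ =>
          (Ioi p.1).indicator (fun _ => ENNReal.ofReal (Real.exp (-(x * p.1)))) p.2) =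
          {p : ℝ × ℝ | p.1 < p.2}.indicator
            fun p => ENNReal.ofReal (Real.exp (-(x * p.1))) := by
        ext p; simp [indicator]
      rw [this]
      exact Measurable.indicator (by fun_prop) (measurableSet_lt measurable_fst measurable_snd)
    rw [lintegral_lintegral_swap hm.aemeasurable]
    have hI : Ioi (0 : ℝ) =ᵐ[f.levy] univ := by
      filter_upwards [f.ae_levy_pos] with s hs
      exact propext ⟨fun _ => trivial, fun _ => hs⟩
    rw [setIntegral_congr_set hI, setIntegral_univ, ← integral_div,
      ofReal_integral_eq_lintegral_ofReal ((f.integrable_one_sub_exp hx.le).div_const x)]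
    · refine lintegral_congr_ae ?_
      filter_upwards [f.ae_levy_pos] with y hy
      rw [← setLIntegral_exp_neg hx hy, ← Iio_inter_Ioi,
        ← setLIntegral_indicator measurableSet_Iio]
      · refine lintegral_congr fun s => ?_
        simp [indicator]
    · filter_upwards [f.ae_levy_pos] with s hs
      have : Real.exp (-(x * s)) ≤ 1 := Real.exp_le_one_iff.2 (by nlinarith)
      exact div_nonneg (by linarith) hx.le
  have h3 := f.setIntegral_levy_nonneg hx.le (Ioi 0)
  rw [h1, h2, ← ENNReal.ofReal_mul f.a_nonneg, ← ENNReal.ofReal_add, ← ENNReal.ofReal_add]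
  · congr 1
    unfold eval
    field_simp
    ring
  · exact f.b_nonneg
  · have := f.a_nonneg
    positivity
  · have := f.a_nonneg
    positivity
  · positivity

end BernsteinData

/-! ### Compound Poisson laws -/

/-- The convolution powers of a measure. -/
def convPow (μ : Measure ℝ) : ℕ → Measure ℝ
  | 0 => Measure.dirac 0
  | n + 1 => convPow μ n ∗ μ

/-- The compound Poisson law at time `σ` with jump measure `μ`. -/
def compoundPoisson (μ : Measure ℝ) (σ : ℝ) : Measure ℝ :=
  Measure.sum fun n : ℕ =>
    ENNReal.ofReal (Real.exp (-(σ * μ.real univ)) * (σ ^ n / n.factorial)) • convPow μ n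

section CompoundPoisson

variable {μ : Measure ℝ} [IsFiniteMeasure μ]

instance isFiniteMeasure_convPow (n : ℕ) : IsFiniteMeasure (convPow μ n) := by
  induction n with
  | zero => unfold convPow; infer_instance
  | succ n ih => unfold convPow; infer_instance

lemma laplaceTransform_dirac (r x : ℝ) :
    laplaceTransform (Measure.dirac r) x = ENNReal.ofReal (Real.exp (-(x * r))) := by
  rw [laplaceTransform, lintegral_dirac' _ (measurable_ofReal_exp_neg_mul x)]

lemma laplaceTransform_convPow (x : ℝ) (n : ℕ) :
    laplaceTransform (convPow μ n) x = laplaceTransform μ x ^ n := by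
  induction n with
  | zero => simp [convPow, laplaceTransform_dirac]
  | succ n ih => rw [convPow, laplaceTransform_conv, ih, pow_succ]

lemma ae_nonneg_convPow (h0 : ∀ᵐ r ∂μ, 0 ≤ r) (n : ℕ) : ∀ᵐ r ∂convPow μ n, 0 ≤ r := by
  induction n with
  | zero => simp [convPow, ae_dirac_eq]
  | succ n ih => exact ae_nonneg_conv ih h0

lemma ae_nonneg_compoundPoisson (h0 : ∀ᵐ r ∂μ, 0 ≤ r) (σ : ℝ) :
    ∀ᵐ r ∂compoundPoisson μ σ, 0 ≤ r := by
  rw [compoundPoisson, Measure.ae_sum_iff' measurableSet_Ici]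
  exact fun n => Measure.ae_smul_measure (ae_nonneg_convPow h0 n) _

lemma integral_one_sub_exp_eq (h0 : ∀ᵐ r ∂μ, 0 ≤ r) {x : ℝ} (hx : 0 ≤ x) :
    ∫ s, (1 - Real.exp (-(x * s))) ∂μ = μ.real univ - (laplaceTransform μ x).toReal := by
  have hint : Integrable (fun s => Real.exp (-(x * s))) μ := by
    refine Integrable.of_bound (C := 1) (by fun_prop) ?_
    filter_upwards [h0] with s hs
    rw [Real.norm_of_nonneg (Real.exp_pos _).le, Real.exp_le_one_iff]
    nlinarith
  rw [integral_sub (integrable_const _) hint, laplaceTransform,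
    integral_eq_lintegral_of_nonneg_ae (ae_of_all _ fun r => (Real.exp_pos _).le) (by fun_prop)]
  simp

lemma laplaceTransform_compoundPoisson (h0 : ∀ᵐ r ∂μ, 0 ≤ r) {σ : ℝ} (hσ : 0 ≤ σ) {x : ℝ}
    (hx : 0 ≤ x) :
    laplaceTransform (compoundPoisson μ σ) x =
      ENNReal.ofReal (Real.exp (-(σ * ∫ s, (1 - Real.exp (-(x * s))) ∂μ))) := by
  have hL := laplaceTransform_ne_top (κ := μ) h0 hx
  set ℓ := (laplaceTransform μ x).toReal with hℓ
  have hℓ0 : 0 ≤ ℓ := ENNReal.toReal_nonneg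
  rw [integral_one_sub_exp_eq h0 hx, ← hℓ, laplaceTransform, compoundPoisson, lintegral_sum_measure]
  have : ∀ n : ℕ, ∫⁻ r, ENNReal.ofReal (Real.exp (-(x * r)))
      ∂(ENNReal.ofReal (Real.exp (-(σ * μ.real univ)) * (σ ^ n / n.factorial)) • convPow μ n) =
      ENNReal.ofReal (Real.exp (-(σ * μ.real univ)) * ((σ * ℓ) ^ n / n.factorial)) := by
    intro n
    rw [lintegral_smul_measure, ← laplaceTransform, laplaceTransform_convPow,
      ← ENNReal.ofReal_toReal hL, ← hℓ, ← ENNReal.ofReal_pow hℓ0, smul_eq_mul,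
      ← ENNReal.ofReal_mul (by positivity)]
    congr 1
    rw [mul_pow]; ring
  simp_rw [this]
  have hs : HasSum (fun n : ℕ => Real.exp (-(σ * μ.real univ)) * ((σ * ℓ) ^ n / n.factorial))
      (Real.exp (-(σ * μ.real univ)) * Real.exp (σ * ℓ)) := by
    refine HasSum.mul_left _ ?_
    rw [Real.exp_eq_exp_ℝ]
    exact NormedSpace.expSeries_div_hasSum_exp (σ * ℓ)
  rw [← ENNReal.ofReal_tsum_of_nonneg (fun n => by positivity) hs.summable, hs.tsum_eq,
    ← Real.exp_add]
  ring_nf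

lemma laplaceTransform_zero (κ : Measure ℝ) : laplaceTransform κ 0 = κ univ := by
  simp [laplaceTransform]

lemma compoundPoisson_univ (h0 : ∀ᵐ r ∂μ, 0 ≤ r) {σ : ℝ} (hσ : 0 ≤ σ) :
    compoundPoisson μ σ univ = 1 := by
  rw [← laplaceTransform_zero, laplaceTransform_compoundPoisson h0 hσ le_rfl]
  simp

lemma convPow_succ_absolutelyContinuous (hμ : μ ≪ volume) (n : ℕ) :
    convPow μ (n + 1) ≪ volume :=
  Measure.conv_absolutelyContinuous hμ

/-- The ε-δ form of absolute continuity constrains only the volume of the set, so one δ serves all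
translates of a set at once. -/
lemma exists_measure_lt_of_absolutelyContinuous {θ : Measure ℝ} [IsFiniteMeasure θ]
    (hθ : θ ≪ volume) {ε : ℝ≥0∞} (hε : ε ≠ 0) :
    ∃ δ > 0, ∀ B : Set ℝ, volume B < δ → θ B ≤ ε := by
  have hfin : ∫⁻ r, θ.rnDeriv volume r ≠ ∞ := (Measure.lintegral_rnDeriv_lt_top θ volume).ne
  obtain ⟨δ, hδ, h⟩ := exists_pos_setLIntegral_lt_of_measure_lt hfin hε
  refine ⟨δ, hδ, fun B hB => ?_⟩
  rw [← Measure.setLIntegral_rnDeriv hθ]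
  exact (h B hB).le

/-- The event of no jump is the only singular contribution; its mass becomes negligible when the
total mass of the jump measure grows. -/
lemma compoundPoisson_eq_add (σ : ℝ) : ∃ θ : Measure ℝ, (μ ≪ volume → θ ≪ volume) ∧
    compoundPoisson μ σ =
      ENNReal.ofReal (Real.exp (-(σ * μ.real univ))) • Measure.dirac 0 + θ := by
  refine ⟨Measure.sum fun n : ℕ => ENNReal.ofReal (Real.exp (-(σ * μ.real univ)) *
    (σ ^ (n + 1) / (n + 1).factorial)) • convPow μ (n + 1), fun hμ => ?_, ?_⟩
  · refine Measure.absolutelyContinuous_sum_left fun n => ?_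
    exact (convPow_succ_absolutelyContinuous hμ n).smul_left _
  · ext A hA
    rw [compoundPoisson, Measure.sum_apply _ hA, Measure.add_apply, Measure.sum_apply _ hA,
      tsum_eq_zero_add' ENNReal.summable]
    simp [convPow]

end CompoundPoisson

/-- A finite measure on `[0, ∞)` with Laplace transform `e^{-σ f}` is absolutely continuous when
`f` has an infinite Lévy measure with locally absolutely continuous tail. -/
theorem BernsteinData.ConditionI.absolutelyContinuous_of_laplaceTransform {f : BernsteinData}
    (hf : f.ConditionI) {σ : ℝ} (hσ : 0 < σ) {ρ : Measure ℝ} (hρ1 : ρ univ ≤ 1)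
    (h0 : ∀ᵐ r ∂ρ, 0 ≤ r)
    (hρ : ∀ x : ℝ, 0 < x → laplaceTransform ρ x = ENNReal.ofReal (Real.exp (-(σ * f.eval x)))) :
    ρ ≪ volume := by
  have hρfin : IsFiniteMeasure ρ := ⟨hρ1.trans_lt ENNReal.one_lt_top⟩
  have hle1 : ∀ κ : Measure ℝ, κ univ ≤ 1 → κ.real univ ≤ 1 := fun κ h => by
    rw [measureReal_def]; exact ENNReal.toReal_le_of_le_ofReal zero_le_one (by simpa using h)
  -- Jumps larger than ε give a compound Poisson factor Θ. Every translate of a small open set has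
  -- Θ-mass at most the atom plus η, and convolution with the remaining factor, of mass at most 1,
  -- cannot exceed this bound.
  have main : ∀ ε : ℝ, 0 < ε → ∀ η : ℝ, 0 < η → ∃ δ : ℝ≥0∞, 0 < δ ∧
      ∀ A : Set ℝ, IsOpen A → volume A < δ →
        ρ.real A ≤ Real.exp (-(σ * f.levy.real (Ioi ε))) + η := by
    intro ε hε η hη
    set μ := f.levy.restrict (Ioi ε) with hμ
    have hpos : ∀ S : Set ℝ, ∀ᵐ r ∂f.levy.restrict S, 0 ≤ r := fun S =>
      ae_restrict_of_ae (f.ae_levy_pos.mono fun r hr => le_of_lt hr)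
    have hfinμ : IsFiniteMeasure μ :=
      ⟨by rw [hμ, Measure.restrict_apply_univ]; exact f.levy_Ioi_lt_top hε⟩
    set Θ := compoundPoisson μ σ with hΘ
    have hΘ1 : Θ univ = 1 := compoundPoisson_univ (hpos _) hσ.le
    have hΘf : IsFiniteMeasure Θ := ⟨by simp [hΘ1]⟩
    obtain ⟨θ, hθac, hθ⟩ := compoundPoisson_eq_add (μ := μ) σ
    have hθv : θ ≪ volume :=
      hθac ((Measure.absolutelyContinuous_of_le Measure.restrict_le_self).trans
        hf.levy_absolutelyContinuous)
    have hθfin : IsFiniteMeasure θ := by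
      refine isFiniteMeasure_of_le Θ ?_
      rw [hΘ, hθ]
      exact Measure.le_add_left le_rfl
    obtain ⟨δ, hδ, hδθ⟩ := exists_measure_lt_of_absolutelyContinuous hθv
      (ε := ENNReal.ofReal η) (by simpa using hη)
    refine ⟨δ, hδ, fun A hA hAδ => ?_⟩
    let d : ℕ → ℝ := fun n => ε / ((n : ℝ) + 1)
    have hd : ∀ n, 0 < d n := fun n => by positivity
    have hdε : ∀ n, d n ≤ ε := fun n => div_le_self hε.le (by
      have : (0 : ℝ) ≤ n := Nat.cast_nonneg n
      linarith)
    have hfinn : ∀ n, IsFiniteMeasure (f.levy.restrict (Ioc (d n) ε)) := fun n =>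
      ⟨by
        rw [Measure.restrict_apply_univ]
        exact (measure_mono Ioc_subset_Ioi_self).trans_lt (f.levy_Ioi_lt_top (hd n))⟩
    -- This factor collects killing, drift and the jumps in (d n, ε]. As d n decreases to 0 the
    -- transform of `κ n ∗ Θ` tends to that of ρ, which carries the bound on open sets over to ρ.
    let κ : ℕ → Measure ℝ := fun n => ENNReal.ofReal (Real.exp (-(f.a * σ))) •
      (Measure.dirac (f.b * σ) ∗ compoundPoisson (f.levy.restrict (Ioc (d n) ε)) σ)
    have hcpf : ∀ n, IsFiniteMeasure (compoundPoisson (f.levy.restrict (Ioc (d n) ε)) σ) :=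
      fun n => ⟨by rw [compoundPoisson_univ (hpos _) hσ.le]; exact ENNReal.one_lt_top⟩
    have hκlt : ∀ n, ∀ x : ℝ, 0 ≤ x → laplaceTransform (κ n) x = ENNReal.ofReal (Real.exp
        (-(σ * (f.a + f.b * x + ∫ s in Ioc (d n) ε, (1 - Real.exp (-(x * s))) ∂f.levy)))) := by
      intro n x hx
      rw [laplaceTransform, lintegral_smul_measure, ← laplaceTransform, laplaceTransform_conv,
        laplaceTransform_dirac, laplaceTransform_compoundPoisson (hpos _) hσ.le hx, smul_eq_mul,
        ← ENNReal.ofReal_mul (Real.exp_pos _).le, ← ENNReal.ofReal_mul (Real.exp_pos _).le,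
        ← Real.exp_add, ← Real.exp_add]
      ring_nf
    have hκ1 : ∀ n, κ n univ ≤ 1 := by
      intro n
      rw [← laplaceTransform_zero, hκlt n 0 le_rfl]
      have : 0 ≤ σ * f.a := mul_nonneg hσ.le f.a_nonneg
      simpa using this
    have hκf : ∀ n, IsFiniteMeasure (κ n) := fun n => ⟨(hκ1 n).trans_lt ENNReal.one_lt_top⟩
    have hκ0 : ∀ n, ∀ᵐ r ∂κ n, 0 ≤ r := by
      intro n
      refine Measure.ae_smul_measure (ae_nonneg_conv ?_ (ae_nonneg_compoundPoisson (hpos _) σ)) _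
      simpa [ae_dirac_eq] using mul_nonneg f.b_nonneg hσ.le
    have hκΘ1 : ∀ n, (κ n ∗ Θ) univ ≤ 1 := by
      intro n
      rw [← laplaceTransform_zero, laplaceTransform_conv, laplaceTransform_zero,
        laplaceTransform_zero, hΘ1, mul_one]
      exact hκ1 n
    refine measureReal_le_of_tendsto_laplaceTransform (κn := fun n => κ n ∗ Θ) h0
      (fun n => ae_nonneg_conv (hκ0 n) (ae_nonneg_compoundPoisson (hpos _) σ)) (hle1 _ hρ1)
      (fun n => hle1 _ (hκΘ1 n)) ?_ hA ?_
    · intro k hk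
      have hk0 : (0 : ℝ) < k := by exact_mod_cast hk
      rw [hρ _ hk0]
      have hlt : ∀ n, laplaceTransform (κ n ∗ Θ) k = ENNReal.ofReal (Real.exp
          (-(σ * (f.a + f.b * k + ∫ s in Ioi (d n), (1 - Real.exp (-(k * s))) ∂f.levy)))) := by
        intro n
        rw [laplaceTransform_conv, hκlt n _ hk0.le,
          laplaceTransform_compoundPoisson (hpos _) hσ.le hk0.le,
          ← ENNReal.ofReal_mul (Real.exp_pos _).le, ← Real.exp_add,
          ← Ioc_union_Ioi_eq_Ioi (hdε n), setIntegral_union Ioc_disjoint_Ioi_same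
            measurableSet_Ioi (f.integrable_one_sub_exp hk0.le).integrableOn
            (f.integrable_one_sub_exp hk0.le).integrableOn]
        ring_nf
      simp_rw [hlt]
      have hU : ⋃ n, Ioi (d n) = Ioi 0 := by
        ext y
        simp only [mem_iUnion, mem_Ioi]
        refine ⟨fun ⟨n, hn⟩ => (hd n).trans hn, fun hy => ?_⟩
        obtain ⟨n, hn⟩ := exists_nat_gt (ε / y)
        refine ⟨n, ?_⟩
        rw [div_lt_iff₀ hy] at hn
        rw [div_lt_iff₀ (by positivity)]
        nlinarith
      have hmono : Monotone fun n => Ioi (d n) := by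
        intro m n hmn
        refine Ioi_subset_Ioi ?_
        have : (m : ℝ) ≤ n := by exact_mod_cast hmn
        simp only [d]
        gcongr
      have ht := tendsto_setIntegral_of_monotone (μ := f.levy)
        (f := fun s => 1 - Real.exp (-((k : ℝ) * s))) (fun n => measurableSet_Ioi) hmono
        (f.integrable_one_sub_exp hk0.le).integrableOn
      rw [hU] at ht
      refine ENNReal.tendsto_ofReal ((Real.continuous_exp.tendsto _).comp (Tendsto.neg
        (Tendsto.const_mul _ ?_)))
      exact ht.const_add _
    · intro n
      have hbd : ∀ x : ℝ, Θ ((fun y => x + y) ⁻¹' A) ≤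
          ENNReal.ofReal (Real.exp (-(σ * f.levy.real (Ioi ε))) + η) := by
        intro x
        rw [hΘ, hθ, Measure.add_apply, Measure.smul_apply, smul_eq_mul,
          ENNReal.ofReal_add (Real.exp_pos _).le hη.le]
        refine add_le_add ?_ (hδθ _ ?_)
        · calc _ ≤ ENNReal.ofReal (Real.exp (-(σ * μ.real univ))) * 1 := by
                gcongr; exact prob_le_one
            _ = _ := by rw [mul_one, hμ, measureReal_restrict_apply_univ]
        · rwa [measure_preimage_add]
      have : (κ n ∗ Θ) A ≤ ENNReal.ofReal (Real.exp (-(σ * f.levy.real (Ioi ε))) + η) := by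
        rw [← lintegral_indicator_one hA.measurableSet,
          Measure.lintegral_conv (measurable_one.indicator hA.measurableSet)]
        calc ∫⁻ x, ∫⁻ y, A.indicator 1 (x + y) ∂Θ ∂κ n
            ≤ ∫⁻ _, ENNReal.ofReal (Real.exp (-(σ * f.levy.real (Ioi ε))) + η) ∂κ n := by
              refine lintegral_mono fun x => ?_
              refine le_trans (le_of_eq ?_) (hbd x)
              rw [← lintegral_indicator_one (hA.measurableSet.preimage (measurable_const_add x))]
              rfl
          _ ≤ _ := by
              rw [lintegral_const]
              exact mul_le_of_le_one_right' (hκ1 n)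
      exact ENNReal.toReal_le_of_le_ofReal (by positivity) this
  intro B hB
  have hall : ∀ ε : ℝ, 0 < ε → ∀ η : ℝ, 0 < η →
      ρ.real B ≤ Real.exp (-(σ * f.levy.real (Ioi ε))) + η := by
    intro ε hε η hη
    obtain ⟨δ, hδ, h⟩ := main ε hε η hη
    obtain ⟨A, hBA, hAo, hAv⟩ := B.exists_isOpen_lt_of_lt (μ := volume) δ (by rw [hB]; exact hδ)
    exact (measureReal_mono hBA).trans (h A hAo hAv)
  -- Here ν̄(0, ∞) = ∞ enters: the mass of the atom tends to 0 with ε.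
  have hlevy : Tendsto (fun n : ℕ => f.levy.real (Ioi (1 / ((n : ℝ) + 1)))) atTop atTop := by
    have hU : ⋃ n : ℕ, Ioi (1 / ((n : ℝ) + 1)) = Ioi 0 := by
      ext y
      simp only [mem_iUnion, mem_Ioi]
      refine ⟨fun ⟨n, hn⟩ => lt_trans (by positivity) hn, fun hy => ?_⟩
      obtain ⟨n, hn⟩ := exists_nat_one_div_lt hy
      exact ⟨n, hn⟩
    have hmono : Monotone fun n : ℕ => Ioi (1 / ((n : ℝ) + 1)) := by
      intro m n hmn
      refine Ioi_subset_Ioi ?_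
      have : (m : ℝ) ≤ n := by exact_mod_cast hmn
      gcongr
    have h1 := tendsto_measure_iUnion_atTop (μ := f.levy) hmono
    rw [hU, hf.1] at h1
    have h2 : ∀ n : ℕ, f.levy (Ioi (1 / ((n : ℝ) + 1))) =
        ENNReal.ofReal (f.levy.real (Ioi (1 / ((n : ℝ) + 1)))) := fun n => by
      rw [ofReal_measureReal (f.levy_Ioi_lt_top (by positivity)).ne]
    simp only [Function.comp_def, h2] at h1
    exact ENNReal.tendsto_ofReal_nhds_top.1 h1
  have hzero : ρ.real B ≤ 0 := by
    refine le_of_forall_pos_le_add fun η hη => ?_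
    have h1 : Tendsto (fun n : ℕ =>
        Real.exp (-(σ * f.levy.real (Ioi (1 / ((n : ℝ) + 1))))) + η) atTop (𝓝 (0 + η)) := by
      refine Tendsto.add_const _ (Real.tendsto_exp_neg_atTop_nhds_zero.comp ?_)
      exact Tendsto.const_mul_atTop hσ hlevy
    exact ge_of_tendsto h1 (Eventually.of_forall fun n => hall _ (by positivity) _ hη)
  exact (measureReal_eq_zero_iff).1 (le_antisymm hzero measureReal_nonneg)

/-! ### The laws of a subordinator and of its inverse -/

/-- The one-dimensional laws `ρ s` of a subordinator with Laplace exponent `f` (restricted to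
finite values) and `m t` of its inverse, related by `{Y t > s} ⊆ {H s ≤ t} ⊆ {Y t ≥ s}`. -/
structure InversePair (f : BernsteinData) (ρ m : ℝ → Measure ℝ) : Prop where
  rho_le : ∀ s, ρ s univ ≤ 1
  rho_nonneg : ∀ s, ∀ᵐ r ∂ρ s, 0 ≤ r
  lap : ∀ s, 0 ≤ s → ∀ x, 0 < x →
    laplaceTransform (ρ s) x = ENNReal.ofReal (Real.exp (-(s * f.eval x)))
  anti : ∀ t, Antitone fun s => ρ s (Iic t)
  prob : ∀ t, IsProbabilityMeasure (m t)
  m_nonneg : ∀ t, ∀ᵐ s ∂m t, 0 ≤ s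
  m_mono : ∀ s, Monotone fun t => m t (Ioi s)
  upper : ∀ s t, 0 ≤ s → 0 ≤ t → m t (Ioi s) ≤ ρ s (Iic t)
  lower : ∀ s t, 0 ≤ s → 0 ≤ t → ρ s (Iic t) ≤ m t (Ici s)

/-- The inclusions behind `InversePair` control an open half-line on one side and a closed one on
the other. Moving s by 1/(n+1) absorbs the endpoint, so two such bounds yield equality before atoms
have been excluded. -/
lemma measure_Ioi_le_of_forall_le_Ici {μ ν : Measure ℝ} (h : ∀ s, 0 ≤ s → μ (Ioi s) ≤ ν (Ici s))
    {s : ℝ} (hs : 0 ≤ s) : μ (Ioi s) ≤ ν (Ioi s) := by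
  have hU : Ioi s = ⋃ n : ℕ, Ioi (s + 1 / ((n : ℝ) + 1)) := by
    ext y
    simp only [mem_iUnion, mem_Ioi]
    refine ⟨fun hy => ?_, fun ⟨n, hn⟩ => lt_trans (lt_add_of_pos_right s (by positivity)) hn⟩
    obtain ⟨n, hn⟩ := exists_nat_one_div_lt (sub_pos.2 hy)
    exact ⟨n, by linarith⟩
  have hmono : Monotone fun n : ℕ => Ioi (s + 1 / ((n : ℝ) + 1)) := by
    intro a b hab
    refine Ioi_subset_Ioi ?_
    have : (a : ℝ) ≤ b := by exact_mod_cast hab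
    gcongr
  nth_rewrite 1 [hU]
  rw [hmono.measure_iUnion]
  refine iSup_le fun n => (h _ (by positivity)).trans (measure_mono ?_)
  exact Ici_subset_Ioi.2 (lt_add_of_pos_right s (by positivity))

lemma restrict_Ioi_eq_of_forall_Ioi_eq {μ ν : Measure ℝ} [IsFiniteMeasure μ]
    (h : ∀ s, 0 ≤ s → μ (Ioi s) = ν (Ioi s)) : μ.restrict (Ioi 0) = ν.restrict (Ioi 0) := by
  refine ext_of_generate_finite (Set.range Ioi)
    ((BorelSpace.measurable_eq (α := ℝ)).trans (borel_eq_generateFrom_Ioi ℝ)) isPiSystem_Ioi ?_ ?_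
  · rintro _ ⟨s, rfl⟩
    rw [Measure.restrict_apply measurableSet_Ioi, Measure.restrict_apply measurableSet_Ioi,
      Ioi_inter_Ioi]
    exact h _ le_sup_right
  · simpa using h 0 le_rfl

namespace InversePair

variable {f : BernsteinData} {ρ m : ℝ → Measure ℝ}

lemma isFiniteMeasure (h : InversePair f ρ m) (s : ℝ) : IsFiniteMeasure (ρ s) :=
  ⟨(h.rho_le s).trans_lt ENNReal.one_lt_top⟩

lemma measurable_rho (h : InversePair f ρ m) : Measurable ρ := by
  have := h.isFiniteMeasure
  have hI : ∀ t, Measurable fun s => ρ s (Iic t) := fun t => (h.anti t).measurable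
  refine Measurable.measure_of_isPiSystem
    ((BorelSpace.measurable_eq (α := ℝ)).trans (borel_eq_generateFrom_Iic ℝ)) isPiSystem_Iic ?_ ?_
  · rintro _ ⟨t, rfl⟩
    exact hI t
  · have : ∀ s, ρ s univ = ⨆ n : ℕ, ρ s (Iic (n : ℝ)) := by
      intro s
      rw [← Monotone.measure_iUnion]
      · congr 1
        symm
        refine eq_univ_of_forall fun y => mem_iUnion.2 ?_
        obtain ⟨n, hn⟩ := exists_nat_ge y
        exact ⟨n, hn⟩
      · intro a b hab
        exact Iic_subset_Iic.2 (by exact_mod_cast hab)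
    simp_rw [this]
    exact Measurable.iSup fun n => hI n

lemma measurable_m (h : InversePair f ρ m) : Measurable m := by
  have := h.prob
  refine Measurable.measure_of_isPiSystem_of_isProbabilityMeasure
    ((BorelSpace.measurable_eq (α := ℝ)).trans (borel_eq_generateFrom_Ioi ℝ)) isPiSystem_Ioi ?_
  rintro _ ⟨s, rfl⟩
  exact (h.m_mono s).measurable

lemma rho_absolutelyContinuous (h : InversePair f ρ m) (hf : f.ConditionI) {s : ℝ} (hs : 0 < s) :
    ρ s ≪ volume :=
  hf.absolutelyContinuous_of_laplaceTransform hs (h.rho_le s) (h.rho_nonneg s) (h.lap s hs.le)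

/-- The transforms e^{-s f} multiply as a semigroup in s. This convolution identity is the form in
which the Markov property is used below. -/
lemma rho_add (h : InversePair f ρ m) {s s' : ℝ} (hs : 0 ≤ s) (hs' : 0 ≤ s') :
    ρ (s + s') = ρ s ∗ ρ s' := by
  have := h.isFiniteMeasure
  refine measure_eq_of_laplaceTransform_eq (h.rho_nonneg _)
    (ae_nonneg_conv (h.rho_nonneg _) (h.rho_nonneg _)) fun k hk => ?_
  have hk0 : (0 : ℝ) < k := by exact_mod_cast hk
  rw [laplaceTransform_conv, h.lap _ hs _ hk0, h.lap _ hs' _ hk0, h.lap _ (add_nonneg hs hs') _ hk0,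
    ← ENNReal.ofReal_mul (Real.exp_pos _).le, ← Real.exp_add]
  ring_nf

/-- Tonelli: for fixed r ≥ 0 the integral of e^{-xt} over t ≥ r is e^{-xr} / x. -/
lemma lintegral_exp_mul_rho_Iic (h : InversePair f ρ m) {x : ℝ} (hx : 0 < x) {s : ℝ}
    (hs : 0 ≤ s) :
    ∫⁻ t in Ioi 0, ENNReal.ofReal (Real.exp (-(x * t))) * ρ s (Iic t) =
      ENNReal.ofReal (Real.exp (-(s * f.eval x)) / x) := by
  have := h.isFiniteMeasure
  have hE : ∀ t, ENNReal.ofReal (Real.exp (-(x * t))) * ρ s (Iic t) =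
      ∫⁻ r, (Iic t).indicator (fun _ => ENNReal.ofReal (Real.exp (-(x * t)))) r ∂ρ s := by
    intro t
    rw [lintegral_indicator measurableSet_Iic, setLIntegral_const]
  simp_rw [hE]
  have hm : Measurable fun p : ℝ × ℝ =>
      (Iic p.1).indicator (fun _ => ENNReal.ofReal (Real.exp (-(x * p.1)))) p.2 := by
    have : (fun p : ℝ × ℝ =>
        (Iic p.1).indicator (fun _ => ENNReal.ofReal (Real.exp (-(x * p.1)))) p.2) =
        {p : ℝ × ℝ | p.2 ≤ p.1}.indicator
          fun p => ENNReal.ofReal (Real.exp (-(x * p.1))) := by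
      ext p; simp [indicator]
    rw [this]
    exact Measurable.indicator (by fun_prop) (measurableSet_le measurable_snd measurable_fst)
  rw [lintegral_lintegral_swap hm.aemeasurable, div_eq_mul_inv,
    ENNReal.ofReal_mul (Real.exp_pos _).le, ← h.lap s hs x hx, laplaceTransform,
    ← lintegral_mul_const _ (measurable_ofReal_exp_neg_mul x)]
  refine lintegral_congr_ae ?_
  filter_upwards [h.rho_nonneg s] with r hr
  have : ∀ t, (Iic t).indicator (fun _ => ENNReal.ofReal (Real.exp (-(x * t)))) r =
      (Ici r).indicator (fun t => ENNReal.ofReal (Real.exp (-(x * t)))) t := by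
    intro t; simp [indicator]
  simp_rw [this]
  rw [setLIntegral_indicator measurableSet_Ici, ← ENNReal.ofReal_mul (Real.exp_pos _).le,
    ← div_eq_mul_inv, ← BernsteinData.lintegral_exp_neg_Ioi hx]
  refine setLIntegral_congr ?_
  have hne : ∀ c : ℝ, ∀ᵐ y : ℝ, y ≠ c := fun c => by simp [ae_iff]
  filter_upwards [hne r] with y hy
  refine propext ⟨fun hh => lt_of_le_of_ne hh.1 (Ne.symm hy), fun hh => ⟨le_of_lt hh, ?_⟩⟩
  exact hr.trans_lt hh

/-- The law of `Y` at an independent exponential time. -/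
lemma lintegral_exp_mul_lintegral_m (h : InversePair f ρ m) (hf : f.ConditionI) {x : ℝ}
    (hx : 0 < x) {g : ℝ → ℝ≥0∞} (hg : Measurable g) :
    ∫⁻ t in Ioi 0, ENNReal.ofReal (Real.exp (-(x * t))) * ∫⁻ s, g s ∂m t =
      ENNReal.ofReal (f.eval x / x) *
        ∫⁻ s in Ioi 0, ENNReal.ofReal (Real.exp (-(s * f.eval x))) * g s := by
  have := h.prob
  have := h.isFiniteMeasure
  have hF : 0 < f.eval x := hf.eval_pos hx
  set F := f.eval x with hFdef
  -- Up to the common total mass 1/x, `M₁` is the law of Y at an exponential time of rate x and `M₂`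
  -- the exponential law of rate f(x). Both inclusions of `InversePair`, integrated in t, pin `M₁`
  -- to `M₂` on half-lines.
  set wx : Measure ℝ := (volume.restrict (Ioi 0)).withDensity
    fun t => ENNReal.ofReal (Real.exp (-(x * t))) with hwx
  set M₁ : Measure ℝ := wx.bind m with hM₁
  set M₂ : Measure ℝ := ENNReal.ofReal (F / x) • (volume.restrict (Ioi 0)).withDensity
    fun s => ENNReal.ofReal (Real.exp (-(s * F))) with hM₂
  have hl₁ : ∀ g : ℝ → ℝ≥0∞, Measurable g → ∫⁻ s, g s ∂M₁ =
      ∫⁻ t in Ioi 0, ENNReal.ofReal (Real.exp (-(x * t))) * ∫⁻ s, g s ∂m t := by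
    intro g hg
    rw [hM₁, Measure.lintegral_bind h.measurable_m.aemeasurable hg.aemeasurable, hwx,
      lintegral_withDensity_eq_lintegral_mul _ (measurable_ofReal_exp_neg_mul x)]
    · rfl
    · exact (Measure.measurable_lintegral hg).comp h.measurable_m
  have hl₂ : ∀ g : ℝ → ℝ≥0∞, Measurable g → ∫⁻ s, g s ∂M₂ = ENNReal.ofReal (F / x) *
        ∫⁻ s in Ioi 0, ENNReal.ofReal (Real.exp (-(s * F))) * g s := by
    intro g hg
    rw [hM₂, lintegral_smul_measure, lintegral_withDensity_eq_lintegral_mul _ (by fun_prop) hg]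
    rfl
  have hM₁s : ∀ A : Set ℝ, MeasurableSet A →
      M₁ A = ∫⁻ t in Ioi 0, ENNReal.ofReal (Real.exp (-(x * t))) * m t A := by
    intro A hA
    rw [← lintegral_indicator_one hA, hl₁ _ (measurable_one.indicator hA)]
    simp_rw [lintegral_indicator_one hA]
  have hM₂s : ∀ s, 0 ≤ s → M₂ (Ioi s) = ENNReal.ofReal (Real.exp (-(s * F)) / x) := by
    intro s hs
    rw [← lintegral_indicator_one measurableSet_Ioi,
      hl₂ _ (measurable_one.indicator measurableSet_Ioi)]
    have : ∀ r, ENNReal.ofReal (Real.exp (-(r * F))) * (Ioi s).indicator 1 r =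
        (Ioi s).indicator (fun r => ENNReal.ofReal (Real.exp (-(F * r)))) r := by
      intro r
      by_cases hr : r ∈ Ioi s
      · simp [indicator_of_mem hr, mul_comm]
      · simp [indicator_of_notMem hr]
    simp_rw [this]
    rw [setLIntegral_indicator measurableSet_Ioi, Ioi_inter_Ioi, sup_of_le_left hs,
      BernsteinData.lintegral_exp_neg_Ioi hF, ← ENNReal.ofReal_mul (by positivity)]
    congr 1
    rw [mul_comm F s]
    field_simp
  have hM₂i : ∀ s, M₂ (Ici s) = M₂ (Ioi s) := by
    intro s
    have : M₂ ≪ volume :=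
      ((withDensity_absolutelyContinuous _ _).trans Measure.absolutelyContinuous_restrict).smul_left
        _
    refine measure_congr ?_
    exact this.ae_eq Ioi_ae_eq_Ici.symm
  have hIoi : ∀ s, 0 ≤ s → M₁ (Ioi s) = M₂ (Ioi s) := by
    intro s hs
    refine le_antisymm (measure_Ioi_le_of_forall_le_Ici (fun s hs => ?_) hs)
      (measure_Ioi_le_of_forall_le_Ici (fun s hs => ?_) hs)
    · rw [hM₂i, hM₂s s hs, ← h.lintegral_exp_mul_rho_Iic hx hs, hM₁s _ measurableSet_Ioi]
      refine setLIntegral_mono' measurableSet_Ioi fun t ht => ?_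
      refine mul_le_mul_right ?_ _
      exact h.upper s t hs (le_of_lt ht)
    · rw [hM₂s s hs, ← h.lintegral_exp_mul_rho_Iic hx hs, hM₁s _ measurableSet_Ici]
      refine setLIntegral_mono' measurableSet_Ioi fun t ht => ?_
      refine mul_le_mul_right ?_ _
      exact h.lower s t hs (le_of_lt ht)
  have hM₁u : M₁ univ = ENNReal.ofReal (1 / x) := by
    rw [hM₁s _ MeasurableSet.univ]
    simp only [measure_univ, mul_one]
    rw [BernsteinData.lintegral_exp_neg_Ioi hx]
    simp
  have hfin₁ : IsFiniteMeasure M₁ := ⟨by rw [hM₁u]; exact ENNReal.ofReal_lt_top⟩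
  -- The half-line (0, ∞) already carries the whole mass 1/x.
  have h₁0 : M₁ (Iic 0) = 0 := by
    rw [← compl_Ioi, measure_compl measurableSet_Ioi (measure_ne_top _ _), hIoi 0 le_rfl,
      hM₂s 0 le_rfl, hM₁u]
    simp
  have h₂0 : M₂.restrict (Ioi 0) = M₂ := by
    refine Measure.restrict_eq_self_of_ae_mem ?_
    refine Measure.ae_smul_measure ((withDensity_absolutelyContinuous _ _).ae_le ?_) _
    exact ae_restrict_mem measurableSet_Ioi
  have heq : M₁ = M₂ := by
    rw [← h₂0, ← restrict_Ioi_eq_of_forall_Ioi_eq hIoi]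
    refine (Measure.restrict_eq_self_of_ae_mem ?_).symm
    rw [ae_iff]
    simp only [mem_Ioi, not_lt]
    exact h₁0
  rw [← hl₁ g hg, heq, hl₂ g hg]

/-- The formula at an exponential time has right side 0 for a null test set. The exceptional times
depend on B; they are removed in `m_absolutelyContinuous`. -/
lemma ae_m_eq_zero (h : InversePair f ρ m) (hf : f.ConditionI) {B : Set ℝ} (hB : MeasurableSet B)
    (hB0 : volume B = 0) : ∀ᵐ t, 0 < t → m t B = 0 := by
  have h1 := h.lintegral_exp_mul_lintegral_m hf one_pos (measurable_one.indicator hB)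
  have h2 : ∫⁻ s in Ioi (0 : ℝ), ENNReal.ofReal (Real.exp (-(s * f.eval 1))) * B.indicator 1 s
      = 0 := by
    rw [lintegral_eq_zero_iff (by
      exact Measurable.mul (by fun_prop) (measurable_one.indicator hB))]
    refine ae_restrict_of_ae ?_
    filter_upwards [measure_eq_zero_iff_ae_notMem.1 hB0] with s hs
    simp [hs]
  rw [h2, mul_zero, lintegral_eq_zero_iff] at h1
  · rw [Filter.EventuallyEq, ae_restrict_iff' measurableSet_Ioi] at h1
    filter_upwards [h1] with t ht ht0
    have := ht ht0
    rw [lintegral_indicator_one hB] at this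
    simpa [(Real.exp_pos _).not_ge] using this
  · exact Measurable.mul (by fun_prop)
      ((Measure.measurable_lintegral (measurable_one.indicator hB)).comp h.measurable_m)

lemma rho_Iio_zero (h : InversePair f ρ m) (s : ℝ) : ρ s (Iio 0) = 0 := by
  have := h.rho_nonneg s
  rw [ae_iff] at this
  simp only [not_le] at this
  exact this

lemma rho_add_Iic (h : InversePair f ρ m) {s σ : ℝ} (hσ : 0 ≤ σ) (hs : 0 ≤ s) (t : ℝ) :
    ρ (σ + s) (Iic t) = ∫⁻ r in Iic t, ρ s (Iic (t - r)) ∂ρ σ := by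
  have := h.isFiniteMeasure
  rw [h.rho_add hσ hs, ← lintegral_indicator_one measurableSet_Iic,
    Measure.lintegral_conv (measurable_one.indicator measurableSet_Iic),
    ← lintegral_indicator measurableSet_Iic]
  refine lintegral_congr fun r => ?_
  have : ∫⁻ y, (Iic t).indicator 1 (r + y) ∂ρ s = ρ s (Iic (t - r)) := by
    rw [← lintegral_indicator_one measurableSet_Iic]
    refine lintegral_congr fun y => ?_
    have : r + y ≤ t ↔ y ≤ t - r := by constructor <;> intro <;> linarith
    simp [indicator, this]
  rw [this]
  by_cases hr : r ∈ Iic t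
  · rw [indicator_of_mem hr]
  · rw [indicator_of_notMem hr]
    refine measure_mono_null (fun y hy => ?_) (h.rho_Iio_zero s)
    simp only [mem_Iic, not_le, mem_Iio] at *
    linarith

/-- The Markov property at time `σ`, in terms of the law of the inverse. -/
lemma setLIntegral_Ioi_m (h : InversePair f ρ m) {σ : ℝ} (hσ : 0 ≤ σ) {t : ℝ} (ht : 0 ≤ t)
    {g : ℝ → ℝ≥0∞} (hg : Measurable g) :
    ∫⁻ s in Ioi σ, g s ∂m t =
      ∫⁻ r in Iic t, ∫⁻ s in Ioi 0, g (σ + s) ∂m (t - r) ∂ρ σ := by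
  have := h.prob
  have := h.isFiniteMeasure
  set J : Measure ℝ := ((ρ σ).restrict (Iic t)).bind fun r => m (t - r) with hJ
  have hmm : Measurable fun r => m (t - r) := h.measurable_m.comp (by fun_prop)
  set m' : Measure ℝ := (m t).map fun s => s - σ with hm'
  have hJl : ∀ g : ℝ → ℝ≥0∞, Measurable g →
      ∫⁻ s, g s ∂J = ∫⁻ r in Iic t, ∫⁻ s, g s ∂m (t - r) ∂ρ σ := fun g hg => by
    rw [hJ, Measure.lintegral_bind hmm.aemeasurable hg.aemeasurable]
  have hJs : ∀ A, MeasurableSet A → J A = ∫⁻ r in Iic t, m (t - r) A ∂ρ σ := fun A hA => by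
    rw [hJ, Measure.bind_apply hA hmm.aemeasurable]
  have hm'fin : IsFiniteMeasure m' := by rw [hm']; infer_instance
  have hIoi' : ∀ s, m' (Ioi s) = m t (Ioi (σ + s)) := fun s => by
    rw [hm', Measure.map_apply (by fun_prop) measurableSet_Ioi]
    congr 1
    ext y
    simp only [mem_preimage, mem_Ioi]
    constructor <;> intro <;> linarith
  have hIci' : ∀ s, m' (Ici s) = m t (Ici (σ + s)) := fun s => by
    rw [hm', Measure.map_apply (by fun_prop) measurableSet_Ici]
    congr 1
    ext y
    simp only [mem_preimage, mem_Ici]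
    constructor <;> intro <;> linarith
  -- Both half-line masses are sandwiched through ρ_{σ+s}[0, t] = ∫ ρ_s[0, t-r] ρ_σ(dr), using the
  -- inclusions once at time t and once at time t - r.
  have heq : m'.restrict (Ioi 0) = J.restrict (Ioi 0) := by
    refine restrict_Ioi_eq_of_forall_Ioi_eq fun s hs => le_antisymm
      (measure_Ioi_le_of_forall_le_Ici (fun s hs => ?_) hs)
      (measure_Ioi_le_of_forall_le_Ici (fun s hs => ?_) hs)
    · rw [hIoi', hJs _ measurableSet_Ici]
      refine (h.upper _ t (add_nonneg hσ hs) ht).trans ?_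
      rw [h.rho_add_Iic hσ hs]
      refine setLIntegral_mono' measurableSet_Iic fun r hr => ?_
      exact h.lower s _ hs (sub_nonneg.2 hr)
    · rw [hIci', hJs _ measurableSet_Ioi]
      refine le_trans ?_ (h.lower _ t (add_nonneg hσ hs) ht)
      rw [h.rho_add_Iic hσ hs]
      refine setLIntegral_mono' measurableSet_Iic fun r hr => ?_
      exact h.upper s _ hs (sub_nonneg.2 hr)
  have hgm : Measurable fun s => (Ioi 0).indicator (fun s => g (σ + s)) s :=
    (hg.comp (measurable_const_add σ)).indicator measurableSet_Ioi
  have h1 : ∫⁻ s in Ioi 0, g (σ + s) ∂m' = ∫⁻ s in Ioi 0, g (σ + s) ∂J := by rw [heq]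
  rw [← lintegral_indicator measurableSet_Ioi, ← lintegral_indicator measurableSet_Ioi,
    hJl _ hgm, hm', lintegral_map hgm (by fun_prop)] at h1
  simp_rw [lintegral_indicator measurableSet_Ioi] at h1
  rw [← h1, ← lintegral_indicator measurableSet_Ioi]
  refine lintegral_congr fun s => ?_
  simp [indicator]

/-- This is H(0+) = 0, from e^{-s f(x)} ≤ P(H(s) ≤ t) + e^{-xt}: let s → 0, then x → ∞. It yields
Y(t) > 0 almost surely for t > 0. -/
lemma tendsto_rho_Iic (h : InversePair f ρ m) {t : ℝ} (ht : 0 < t) :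
    ⨆ n : ℕ, ρ (1 / ((n : ℝ) + 1)) (Iic t) = 1 := by
  have := h.isFiniteMeasure
  refine le_antisymm (iSup_le fun n => (measure_mono (subset_univ _)).trans (h.rho_le _)) ?_
  have key : ∀ x : ℝ, 0 < x → 1 ≤ (⨆ n : ℕ, ρ (1 / ((n : ℝ) + 1)) (Iic t)) +
      ENNReal.ofReal (Real.exp (-(x * t))) := by
    intro x hx
    have h1 : ∀ n : ℕ, ENNReal.ofReal (Real.exp (-(1 / ((n : ℝ) + 1) * f.eval x))) ≤
        (⨆ n : ℕ, ρ (1 / ((n : ℝ) + 1)) (Iic t)) + ENNReal.ofReal (Real.exp (-(x * t))) := by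
      intro n
      rw [← h.lap _ (by positivity) x hx, laplaceTransform,
        ← lintegral_add_compl _ (measurableSet_Iic (a := t))]
      refine add_le_add ?_ ?_
      · refine le_trans ?_ (le_iSup _ n)
        rw [← setLIntegral_one]
        refine setLIntegral_mono_ae (by fun_prop) ?_
        filter_upwards [h.rho_nonneg (1 / ((n : ℝ) + 1))] with r hr _
        rw [ENNReal.ofReal_le_one, Real.exp_le_one_iff]
        nlinarith
      · calc _ ≤ ∫⁻ _ in (Iic t)ᶜ, ENNReal.ofReal (Real.exp (-(x * t)))
              ∂ρ (1 / ((n : ℝ) + 1)) := by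
              refine setLIntegral_mono (by fun_prop) fun r hr => ?_
              simp only [mem_compl_iff, mem_Iic, not_le] at hr
              refine ENNReal.ofReal_le_ofReal (Real.exp_le_exp.2 ?_)
              nlinarith
          _ ≤ _ := by
              rw [setLIntegral_const]
              exact mul_le_of_le_one_right' ((measure_mono (subset_univ _)).trans (h.rho_le _))
    have h2 : Tendsto (fun n : ℕ => ENNReal.ofReal (Real.exp (-(1 / ((n : ℝ) + 1) * f.eval x))))
        atTop (𝓝 (ENNReal.ofReal (Real.exp (-(0 * f.eval x))))) :=
      ENNReal.tendsto_ofReal ((Real.continuous_exp.tendsto _).comp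
        (tendsto_one_div_add_atTop_nhds_zero_nat.mul_const _).neg)
    simp only [zero_mul, neg_zero, Real.exp_zero, ENNReal.ofReal_one] at h2
    exact le_of_tendsto' h2 h1
  have h3 : Tendsto (fun x : ℝ => (⨆ n : ℕ, ρ (1 / ((n : ℝ) + 1)) (Iic t)) +
      ENNReal.ofReal (Real.exp (-(x * t)))) atTop
      (𝓝 ((⨆ n : ℕ, ρ (1 / ((n : ℝ) + 1)) (Iic t)) + ENNReal.ofReal 0)) := by
    refine Tendsto.const_add _ (ENNReal.tendsto_ofReal ?_)
    exact Real.tendsto_exp_neg_atTop_nhds_zero.comp (tendsto_id.atTop_mul_const ht)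
  simp only [ENNReal.ofReal_zero, add_zero] at h3
  refine ge_of_tendsto h3 ?_
  filter_upwards [eventually_gt_atTop 0] with x hx using key x hx

lemma m_Ioi_zero (h : InversePair f ρ m) {t : ℝ} (ht : 0 < t) : m t (Ioi 0) = 1 := by
  have := h.prob
  refine le_antisymm prob_le_one ?_
  rw [← h.tendsto_rho_Iic ht]
  refine iSup_le fun n => (h.lower _ t (by positivity) ht.le).trans (measure_mono ?_)
  exact Ici_subset_Ioi.2 (by positivity)

lemma ae_m_pos (h : InversePair f ρ m) {t : ℝ} (ht : 0 < t) : ∀ᵐ s ∂m t, 0 < s := by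
  have := h.prob
  exact (prob_compl_eq_zero_iff measurableSet_Ioi).2 (h.m_Ioi_zero ht)

/-- For every `t > 0` the inverse subordinator has a density. -/
theorem m_absolutelyContinuous (h : InversePair f ρ m) (hf : f.ConditionI) {t : ℝ} (ht : 0 < t) :
    m t ≪ volume := by
  refine Measure.AbsolutelyContinuous.mk fun B hB hB0 => ?_
  -- Beyond σ, the law m_t is a mixture of shifted laws m_{t-r} with r distributed as ρ_σ. As ρ_σ is
  -- absolutely continuous, it is enough that m_{t-r} ignores the shifted null set for almost every
  -- r.
  have key : ∀ σ : ℝ, 0 < σ → m t (B ∩ Ioi σ) = 0 := by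
    intro σ hσ
    rw [← Measure.restrict_apply hB, ← lintegral_indicator_one hB,
      h.setLIntegral_Ioi_m hσ.le ht.le (measurable_one.indicator hB)]
    set B' : Set ℝ := (fun s => σ + s) ⁻¹' B with hB'
    have hB'm : MeasurableSet B' := hB.preimage (measurable_const_add σ)
    have hB'0 : volume B' = 0 := by rw [hB', measure_preimage_add]; exact hB0
    have h1 : ∀ᵐ r, 0 < t - r → m (t - r) B' = 0 := by
      have := h.ae_m_eq_zero hf hB'm hB'0
      exact (Measure.measurePreserving_sub_left volume t).quasiMeasurePreserving.ae this
    have hne : ∀ᵐ r : ℝ, r ≠ t := by simp [ae_iff]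
    rw [setLIntegral_congr_fun_ae (g := fun _ => 0) measurableSet_Iic, lintegral_zero]
    have h2 := (h.rho_absolutelyContinuous hf hσ).ae_le (h1.and hne)
    filter_upwards [h2] with r hr hrt
    refine le_antisymm ?_ zero_le
    rw [← hr.1 (sub_pos.2 (lt_of_le_of_ne hrt hr.2)), ← lintegral_indicator_one hB'm]
    exact setLIntegral_le_lintegral _ _
  have hsub : B ⊆ {s | ¬ 0 < s} ∪ ⋃ n : ℕ, (B ∩ Ioi (1 / ((n : ℝ) + 1))) := by
    intro s hs
    by_cases h0 : 0 < s
    · obtain ⟨n, hn⟩ := exists_nat_one_div_lt h0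
      exact Or.inr (mem_iUnion.2 ⟨n, hs, hn⟩)
    · exact Or.inl h0
  refine measure_mono_null hsub (measure_union_null (h.ae_m_pos ht) ?_)
  exact measure_iUnion_null fun n => key _ (by positivity)

lemma m_Ioi (h : InversePair f ρ m) (hf : f.ConditionI) {t : ℝ} (ht : 0 < t) {s : ℝ}
    (hs : 0 ≤ s) : m t (Ioi s) = ρ s (Iic t) := by
  refine le_antisymm (h.upper s t hs ht.le) ((h.lower s t hs ht.le).trans (le_of_eq ?_))
  exact measure_congr ((h.m_absolutelyContinuous hf ht).ae_eq Ioi_ae_eq_Ici.symm)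

lemma rho_Iic_zero (h : InversePair f ρ m) (hf : f.ConditionI) {s : ℝ} (hs : 0 < s) :
    ρ s (Iic 0) = 0 := by
  rw [← measure_congr ((h.rho_absolutelyContinuous hf hs).ae_eq Iio_ae_eq_Iic)]
  exact h.rho_Iio_zero s

/-- P(Y(0) > s) ≤ P(H(s) ≤ 0) = 0, because ρ_s has no atom at 0. All initial conditions are read off
from this. -/
lemma m_zero (h : InversePair f ρ m) (hf : f.ConditionI) : m 0 = Measure.dirac 0 := by
  have := h.prob
  have h1 : m 0 {s | 0 < s} = 0 := by
    have hsub : {s : ℝ | 0 < s} ⊆ ⋃ n : ℕ, Ioi (1 / ((n : ℝ) + 1)) := fun s hs => by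
      obtain ⟨n, hn⟩ := exists_nat_one_div_lt (show 0 < s from hs)
      exact mem_iUnion.2 ⟨n, hn⟩
    refine measure_mono_null hsub (measure_iUnion_null fun n => ?_)
    refine le_antisymm ?_ zero_le
    rw [← h.rho_Iic_zero hf (s := 1 / ((n : ℝ) + 1)) (by positivity)]
    exact h.upper _ _ (by positivity) le_rfl
  have h2 : ∀ᵐ s ∂m 0, s = 0 := by
    have h3 : ∀ᵐ s ∂m 0, ¬ 0 < s := by rw [ae_iff]; simpa only [not_not] using h1
    filter_upwards [h3, h.m_nonneg 0] with s hs hs'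
    exact le_antisymm (not_lt.1 hs) hs'
  ext A hA
  rw [Measure.dirac_apply' _ hA]
  by_cases h0 : (0 : ℝ) ∈ A
  · rw [indicator_of_mem h0, Pi.one_apply, ← measure_univ (μ := m 0)]
    refine measure_congr ?_
    filter_upwards [h2] with s hs
    exact propext ⟨fun _ => trivial, fun _ => hs ▸ h0⟩
  · rw [indicator_of_notMem h0, measure_eq_zero_iff_ae_notMem]
    filter_upwards [h2] with s hs
    rw [hs]; exact h0

end InversePair

/-! ### Weighted potential measures -/

/-- The potential measure `∫_0^∞ g(s) ρ_s ds`. -/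
def potential (ρ : ℝ → Measure ℝ) (g : ℝ → ℝ≥0∞) : Measure ℝ :=
  ((volume.restrict (Ioi 0)).withDensity g).bind ρ

lemma BernsteinData.measurable_tailExt_sub (f : BernsteinData) (t : ℝ) :
    Measurable fun r => f.tailExt (t - r) :=
  f.measurable_tailExt.comp (by fun_prop)

lemma Ioi_zero_eq_iUnion : Ioi (0 : ℝ) = ⋃ n : ℕ, Ioi (1 / ((n : ℝ) + 1)) := by
  ext y
  simp only [mem_iUnion, mem_Ioi]
  refine ⟨fun hy => exists_nat_one_div_lt hy, fun ⟨n, hn⟩ => lt_trans (by positivity) hn⟩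

lemma directed_Ioi_one_div :
    Directed (· ⊆ ·) fun n : ℕ => Ioi (1 / ((n : ℝ) + 1)) := by
  refine Monotone.directed_le fun a b hab => Ioi_subset_Ioi ?_
  have : (a : ℝ) ≤ b := by exact_mod_cast hab
  gcongr

namespace InversePair

variable {f : BernsteinData} {ρ m : ℝ → Measure ℝ}

lemma m_restrict_Ioi (h : InversePair f ρ m) {t : ℝ} (ht : 0 < t) :
    (m t).restrict (Ioi 0) = m t :=
  Measure.restrict_eq_self_of_ae_mem (h.ae_m_pos ht)

lemma lintegral_potential (h : InversePair f ρ m) {g φ : ℝ → ℝ≥0∞} (hg : Measurable g)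
    (hφ : Measurable φ) :
    ∫⁻ r, φ r ∂potential ρ g = ∫⁻ s in Ioi 0, g s * ∫⁻ r, φ r ∂ρ s := by
  have hm : Measurable fun s => ∫⁻ r, φ r ∂ρ s :=
    (Measure.measurable_lintegral hφ).comp h.measurable_rho
  rw [potential, Measure.lintegral_bind h.measurable_rho.aemeasurable hφ.aemeasurable,
    lintegral_withDensity_eq_lintegral_mul _ hg hm]
  rfl

lemma potential_apply (h : InversePair f ρ m) {g : ℝ → ℝ≥0∞} (hg : Measurable g) {A : Set ℝ}
    (hA : MeasurableSet A) : potential ρ g A = ∫⁻ s in Ioi 0, g s * ρ s A := by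
  rw [← lintegral_indicator_one hA, h.lintegral_potential hg (measurable_one.indicator hA)]
  simp_rw [lintegral_indicator_one hA]

lemma sFinite_potential (h : InversePair f ρ m) (g : ℝ → ℝ≥0∞) :
    SFinite (potential ρ g) := by
  let κ : Kernel ℝ ℝ := ⟨ρ, h.measurable_rho⟩
  have : IsFiniteKernel κ := ⟨1, ENNReal.one_lt_top, fun s => h.rho_le s⟩
  exact (inferInstance : SFinite (κ ∘ₘ ((volume.restrict (Ioi 0)).withDensity g)))

lemma potential_absolutelyContinuous (h : InversePair f ρ m) (hf : f.ConditionI) {g : ℝ → ℝ≥0∞}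
    (hg : Measurable g) : potential ρ g ≪ volume := by
  refine Measure.AbsolutelyContinuous.mk fun A hA hA0 => ?_
  rw [h.potential_apply hg hA, setLIntegral_congr_fun (g := fun _ => 0) measurableSet_Ioi,
    lintegral_zero]
  intro s hs
  simp only [h.rho_absolutelyContinuous hf hs hA0, mul_zero]

lemma potential_Iio_zero (h : InversePair f ρ m) {g : ℝ → ℝ≥0∞} (hg : Measurable g) :
    potential ρ g (Iio 0) = 0 := by
  rw [h.potential_apply hg measurableSet_Iio]
  simp [h.rho_Iio_zero]

lemma ae_nonneg_potential (h : InversePair f ρ m) {g : ℝ → ℝ≥0∞} (hg : Measurable g) :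
    ∀ᵐ r ∂potential ρ g, 0 ≤ r := by
  rw [ae_iff]
  simp only [not_le]
  exact h.potential_Iio_zero hg

lemma laplaceTransform_potential (h : InversePair f ρ m) {g : ℝ → ℝ≥0∞} (hg : Measurable g)
    {x : ℝ} (hx : 0 < x) : laplaceTransform (potential ρ g) x =
      ∫⁻ s in Ioi 0, ENNReal.ofReal (Real.exp (-(s * f.eval x))) * g s := by
  rw [laplaceTransform, h.lintegral_potential hg (measurable_ofReal_exp_neg_mul x)]
  refine setLIntegral_congr_fun measurableSet_Ioi fun s hs => ?_
  rw [← laplaceTransform, h.lap s (le_of_lt hs) x hx, mul_comm]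

lemma laplaceTransform_potential_ne_top (h : InversePair f ρ m) (hf : f.ConditionI)
    {g : ℝ → ℝ≥0∞} (hg : Measurable g) (hg1 : ∀ s, g s ≤ 1) {x : ℝ} (hx : 0 < x) :
    laplaceTransform (potential ρ g) x ≠ ∞ := by
  rw [h.laplaceTransform_potential hg hx]
  refine ne_top_of_le_ne_top (b := ∫⁻ s in Ioi 0,
    ENNReal.ofReal (Real.exp (-(f.eval x * s)))) ?_ ?_
  · rw [BernsteinData.lintegral_exp_neg_Ioi (hf.eval_pos hx)]
    exact ENNReal.ofReal_ne_top
  · refine lintegral_mono fun s => ?_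
    rw [mul_comm s]
    exact mul_le_of_le_one_right' (hg1 s)

lemma potential_Iic_ne_top (h : InversePair f ρ m) (hf : f.ConditionI)
    {g : ℝ → ℝ≥0∞} (hg : Measurable g) (hg1 : ∀ s, g s ≤ 1) (t : ℝ) :
    potential ρ g (Iic t) ≠ ∞ := by
  have h1 : ENNReal.ofReal (Real.exp (-(1 * t))) * potential ρ g (Iic t) ≤
      laplaceTransform (potential ρ g) 1 := by
    rw [← setLIntegral_const]
    refine (setLIntegral_mono (measurable_ofReal_exp_neg_mul 1) fun r hr => ?_).trans
      (setLIntegral_le_lintegral _ _)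
    refine ENNReal.ofReal_le_ofReal (Real.exp_le_exp.2 ?_)
    have : r ≤ t := hr
    linarith
  intro hc
  rw [hc, ENNReal.mul_top (by simp [Real.exp_pos]), top_le_iff] at h1
  exact h.laplaceTransform_potential_ne_top hf hg hg1 one_pos h1

lemma lintegral_conv_withDensity {k : ℝ → ℝ≥0∞} (hk : Measurable k) {U : Measure ℝ} [SFinite U]
    {φ : ℝ → ℝ≥0∞} (hφ : Measurable φ) :
    ∫⁻ t, φ t ∂(U ∗ volume.withDensity k) = ∫⁻ t, φ t * ∫⁻ r, k (t - r) ∂U := by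
  rw [Measure.lintegral_conv hφ]
  have h1 : ∀ r, ∫⁻ y, φ (r + y) ∂volume.withDensity k = ∫⁻ t, φ t * k (t - r) := by
    intro r
    rw [lintegral_withDensity_eq_lintegral_mul _ hk (by fun_prop),
      ← lintegral_sub_right_eq_self _ r]
    refine lintegral_congr fun t => ?_
    simp [mul_comm]
  simp_rw [h1]
  rw [lintegral_lintegral_swap (by fun_prop)]
  refine lintegral_congr fun t => ?_
  rw [lintegral_const_mul _ (by fun_prop)]

/-- The renewal equation `b u + ν * u = E g(Y t)` for the potential density, almost everywhere. -/
lemma ae_potential_add_convolution (h : InversePair f ρ m) (hf : f.ConditionI)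
    {g : ℝ → ℝ≥0∞} (hg : Measurable g) (hg1 : ∀ s, g s ≤ 1) :
    ∀ᵐ t, 0 < t → ENNReal.ofReal f.b * (potential ρ g).rnDeriv volume t +
      ∫⁻ r, f.tailExt (t - r) ∂potential ρ g = ∫⁻ s, g s ∂m t := by
  have := h.sFinite_potential g
  have := h.prob
  set U := potential ρ g with hU
  have hUac : U ≪ volume := h.potential_absolutelyContinuous hf hg
  have hUd : volume.withDensity (U.rnDeriv volume) = U := Measure.withDensity_rnDeriv_eq _ _ hUac
  set Q : ℝ → ℝ≥0∞ := (Ioi 0).indicator fun t => ∫⁻ s, g s ∂m t with hQ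
  have hQm : Measurable Q :=
    ((Measure.measurable_lintegral hg).comp h.measurable_m).indicator measurableSet_Ioi
  set C : ℝ → ℝ≥0∞ := fun t => ∫⁻ r, f.tailExt (t - r) ∂U with hC
  have hCm : Measurable C := by
    refine Measurable.lintegral_prod_right' (f := fun p : ℝ × ℝ => f.tailExt (p.1 - p.2)) ?_
    exact f.measurable_tailExt.comp (by fun_prop)
  have hDm : Measurable fun t => ENNReal.ofReal f.b * U.rnDeriv volume t + C t :=
    ((Measure.measurable_rnDeriv _ _).const_mul _).add hCm
  -- The left side is the density of b U + U ∗ ν, with transform (b + ν̂) Û = (f(x)/x) Û; the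
  -- formula at an exponential time gives the same transform for E g(Y(t)).
  have hlap : ∀ x : ℝ, laplaceTransform
      (volume.withDensity fun t => ENNReal.ofReal f.b * U.rnDeriv volume t + C t) x =
      ENNReal.ofReal f.b * laplaceTransform U x +
        (∫⁻ s, ENNReal.ofReal (Real.exp (-(x * s))) * f.tailExt s) * laplaceTransform U x := by
    intro x
    have h1 : ∫⁻ t, ENNReal.ofReal (Real.exp (-(x * t))) * C t =
        (∫⁻ s, ENNReal.ofReal (Real.exp (-(x * s))) * f.tailExt s) * laplaceTransform U x := by
      rw [← lintegral_conv_withDensity f.measurable_tailExt (measurable_ofReal_exp_neg_mul x),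
        ← laplaceTransform, laplaceTransform_conv, mul_comm]
      congr 1
      rw [laplaceTransform, lintegral_withDensity_eq_lintegral_mul _ f.measurable_tailExt
        (measurable_ofReal_exp_neg_mul x)]
      simp_rw [Pi.mul_apply, mul_comm]
    have h2 : laplaceTransform U x =
        ∫⁻ t, U.rnDeriv volume t * ENNReal.ofReal (Real.exp (-(x * t))) := by
      rw [lintegral_rnDeriv_mul hUac (measurable_ofReal_exp_neg_mul x).aemeasurable,
        laplaceTransform]
    rw [laplaceTransform, lintegral_withDensity_eq_lintegral_mul _ hDm
      (measurable_ofReal_exp_neg_mul x),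
      ← h1, h2, ← lintegral_const_mul _ (by
        exact (Measure.measurable_rnDeriv _ _).mul (measurable_ofReal_exp_neg_mul x)),
      ← lintegral_add_right _ (by exact (measurable_ofReal_exp_neg_mul x).mul hCm)]
    refine lintegral_congr fun t => ?_
    simp only [Pi.mul_apply]
    ring
  have hlapeq : ∀ x : ℝ, 0 < x → laplaceTransform
      (volume.withDensity fun t => ENNReal.ofReal f.b * U.rnDeriv volume t + C t) x =
      ENNReal.ofReal (f.eval x / x) * laplaceTransform U x := by
    intro x hx
    rw [hlap, ← f.laplace_tailExt hx]
    ring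
  have hlapQ : ∀ x : ℝ, 0 < x → laplaceTransform (volume.withDensity Q) x =
      ENNReal.ofReal (f.eval x / x) * laplaceTransform U x := by
    intro x hx
    rw [h.laplaceTransform_potential hg hx, ← h.lintegral_exp_mul_lintegral_m hf hx hg,
      laplaceTransform, lintegral_withDensity_eq_lintegral_mul _ hQm
      (measurable_ofReal_exp_neg_mul x), ← lintegral_indicator measurableSet_Ioi]
    refine lintegral_congr fun t => ?_
    by_cases ht : t ∈ Ioi (0 : ℝ)
    · simp [hQ, indicator_of_mem ht, mul_comm]
    · simp [hQ, indicator_of_notMem ht]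
  have hUneg : ∀ᵐ t, t < 0 → U.rnDeriv volume t = 0 := by
    have h1 : ∫⁻ t in Iio 0, U.rnDeriv volume t = 0 := by
      rw [Measure.setLIntegral_rnDeriv hUac]
      exact h.potential_Iio_zero hg
    rw [lintegral_eq_zero_iff (Measure.measurable_rnDeriv _ _), Filter.EventuallyEq,
      ae_restrict_iff' measurableSet_Iio] at h1
    exact h1
  have hCneg : ∀ t, t < 0 → C t = 0 := by
    intro t ht
    rw [hC]
    simp only
    rw [lintegral_eq_zero_iff' (f.measurable_tailExt_sub _).aemeasurable]
    filter_upwards [h.ae_nonneg_potential hg] with r hr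
    simp only [BernsteinData.tailExt, Pi.zero_apply]
    rw [indicator_of_notMem]
    simp only [mem_Ioi, not_lt]
    linarith
  have heq : (volume.withDensity fun t => ENNReal.ofReal f.b * U.rnDeriv volume t + C t) =
      volume.withDensity Q := by
    refine measure_eq_of_laplaceTransform_eq_of_ne_top ?_ ?_ ?_ fun x hx => ?_
    · rw [ae_withDensity_iff hDm]
      filter_upwards [hUneg] with t ht hne
      by_contra hc
      rw [not_le] at hc
      simp [ht hc, hCneg t hc] at hne
    · rw [ae_withDensity_iff hQm]
      refine ae_of_all _ fun t hne => ?_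
      by_contra hc
      rw [hQ, indicator_of_notMem (by simp only [mem_Ioi]; linarith)] at hne
      exact hne rfl
    · rw [hlapeq 1 one_pos]
      exact ENNReal.mul_ne_top ENNReal.ofReal_ne_top
        (h.laplaceTransform_potential_ne_top hf hg hg1 one_pos)
    · rw [hlapeq x hx, hlapQ x hx]
  have hae := (withDensity_eq_iff_of_sigmaFinite hDm.aemeasurable hQm.aemeasurable).1 heq
  filter_upwards [hae] with t ht ht0
  rw [hC] at ht
  rw [ht, hQ, indicator_of_mem (mem_Ioi.2 ht0)]

/-- Without drift, the renewal equation holds at every time. -/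
lemma convolution_eq_of_drift_eq_zero (h : InversePair f ρ m) (hf : f.ConditionI) (hb : f.b = 0)
    {g : ℝ → ℝ≥0∞} (hg : Measurable g) (hg1 : ∀ s, g s ≤ 1) {t : ℝ} (ht : 0 < t) :
    ∫⁻ r, f.tailExt (t - r) ∂potential ρ g = ∫⁻ s, g s ∂m t := by
  have hfin := h.isFiniteMeasure
  -- Restricting g to (σ, ∞) factors the potential measure as ρ_σ convolved with that of the shifted
  -- g. The almost-everywhere equation can be integrated against ρ_σ, and the Markov property at σ
  -- reassembles the right side. Monotone convergence as σ → 0 finishes.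
  have key : ∀ σ : ℝ, 0 < σ →
      ∫⁻ s in Ioi σ, g s * ∫⁻ r, f.tailExt (t - r) ∂ρ s = ∫⁻ s in Ioi σ, g s ∂m t := by
    intro σ hσ
    set g₁ : ℝ → ℝ≥0∞ := (Ioi σ).indicator g with hg₁
    have hg₁m : Measurable g₁ := hg.indicator measurableSet_Ioi
    have hg₁1 : ∀ s, g₁ s ≤ 1 := fun s => (indicator_le_self _ _ s).trans (hg1 s)
    set g₂ : ℝ → ℝ≥0∞ := fun s => g (σ + s) with hg₂
    have hg₂m : Measurable g₂ := hg.comp (measurable_const_add σ)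
    have hsf := h.sFinite_potential g₂
    have hU : potential ρ g₁ = ρ σ ∗ potential ρ g₂ := by
      refine measure_eq_of_laplaceTransform_eq_of_ne_top (h.ae_nonneg_potential hg₁m)
        (ae_nonneg_conv (h.rho_nonneg σ) (h.ae_nonneg_potential hg₂m))
        (h.laplaceTransform_potential_ne_top hf hg₁m hg₁1 one_pos) fun x hx => ?_
      rw [laplaceTransform_conv, h.lap σ hσ.le x hx, h.laplaceTransform_potential hg₁m hx,
        h.laplaceTransform_potential hg₂m hx, ← lintegral_const_mul _ (by fun_prop),
        ← lintegral_indicator measurableSet_Ioi, ← lintegral_indicator measurableSet_Ioi,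
        ← lintegral_add_left_eq_self _ σ]
      refine lintegral_congr fun s => ?_
      by_cases hs : 0 < s
      · have hs1 : σ + s ∈ Ioi (0 : ℝ) := by simp only [mem_Ioi]; linarith
        have hs2 : σ + s ∈ Ioi σ := by simp only [mem_Ioi]; linarith
        rw [indicator_of_mem hs1, indicator_of_mem (mem_Ioi.2 hs), hg₁, indicator_of_mem hs2,
          ← mul_assoc, ← ENNReal.ofReal_mul (Real.exp_pos _).le, ← Real.exp_add, hg₂]
        ring_nf
      · have hs2 : σ + s ∉ Ioi σ := by simp only [mem_Ioi]; linarith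
        rw [indicator_of_notMem (s := Ioi 0) (a := s) hs, hg₁]
        simp [indicator, not_lt.1 hs]
    have hk := f.measurable_tailExt_sub t
    have h1 : ∫⁻ r, f.tailExt (t - r) ∂potential ρ g₁ =
        ∫⁻ s in Ioi σ, g s * ∫⁻ r, f.tailExt (t - r) ∂ρ s := by
      rw [h.lintegral_potential hg₁m hk, ← lintegral_indicator measurableSet_Ioi,
        ← lintegral_indicator measurableSet_Ioi]
      refine lintegral_congr fun s => ?_
      by_cases hs : s ∈ Ioi σ
      · rw [indicator_of_mem (mem_Ioi.2 (hσ.trans hs)), indicator_of_mem hs, hg₁,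
          indicator_of_mem hs]
      · rw [indicator_of_notMem hs, hg₁]
        simp [indicator_of_notMem hs]
    rw [← h1, hU, Measure.lintegral_conv hk, h.setLIntegral_Ioi_m hσ.le ht.le hg,
      ← lintegral_indicator measurableSet_Iic]
    refine lintegral_congr_ae ?_
    have hae := h.ae_potential_add_convolution hf hg₂m (fun s => hg1 _)
    simp only [hb, ENNReal.ofReal_zero, zero_mul, zero_add] at hae
    have hae' : ∀ᵐ r, 0 < t - r → ∫⁻ y, f.tailExt (t - r - y) ∂potential ρ g₂ =
        ∫⁻ s, g₂ s ∂m (t - r) :=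
      (Measure.measurePreserving_sub_left volume t).quasiMeasurePreserving.ae hae
    have hne : ∀ᵐ r : ℝ, r ≠ t := by simp [ae_iff]
    filter_upwards [(h.rho_absolutelyContinuous hf hσ).ae_le (hae'.and hne)] with r hr
    simp_rw [← sub_sub]
    rcases lt_or_gt_of_ne hr.2 with hrt | hrt
    · rw [indicator_of_mem (mem_Iic.2 hrt.le), hr.1 (sub_pos.2 hrt)]
      rw [h.m_restrict_Ioi (sub_pos.2 hrt)]
    · rw [indicator_of_notMem (by simpa using hrt), lintegral_eq_zero_iff'
        (f.measurable_tailExt_sub _).aemeasurable]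
      filter_upwards [h.ae_nonneg_potential hg₂m] with y hy
      simp only [BernsteinData.tailExt, Pi.zero_apply]
      rw [indicator_of_notMem]
      simp only [mem_Ioi, not_lt]
      linarith
  rw [h.lintegral_potential hg (f.measurable_tailExt_sub t), Ioi_zero_eq_iUnion,
    setLIntegral_iUnion_of_directed _ directed_Ioi_one_div]
  have hm0 : ∫⁻ s, g s ∂m t = ∫⁻ s in Ioi 0, g s ∂m t := by
    rw [h.m_restrict_Ioi ht]
  rw [hm0, Ioi_zero_eq_iUnion, setLIntegral_iUnion_of_directed _ directed_Ioi_one_div]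
  exact iSup_congr fun n => key _ (by positivity)

end InversePair

/-! ### Densities of weighted potential measures -/

/-- The convolution of an integrable function with a bounded function is continuous. -/
lemma continuous_convolution_of_integrable_of_bounded {k u : ℝ → ℝ} (hk : Integrable k)
    (hu : Measurable u) {M : ℝ} (hM : ∀ r, |u r| ≤ M) :
    Continuous fun t => ∫ s, k s * u (t - s) := by
  have hM0 : 0 ≤ M := (abs_nonneg _).trans (hM 0)
  have hint : ∀ (k' : ℝ → ℝ), Integrable k' → ∀ t, Integrable fun s => k' s * u (t - s) := by
    intro k' hk' t
    refine hk'.mul_bdd (c := M) (hu.comp (by fun_prop)).aestronglyMeasurable ?_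
    exact ae_of_all _ fun s => hM _
  -- Continuous compactly supported functions approximate k in L¹, and boundedness of u makes the
  -- error uniform in t.
  refine continuous_of_uniform_approx_of_continuous fun V hV => ?_
  obtain ⟨ε, hε, hεV⟩ := Metric.mem_uniformity_dist.1 hV
  obtain ⟨k', hk'c, hk'ε, hk'cont, hk'i⟩ :=
    hk.exists_hasCompactSupport_integral_sub_le (ε := ε / (2 * (M + 1))) (by positivity)
  refine ⟨fun t => ∫ s, k' s * u (t - s), ?_, fun t => hεV ?_⟩
  · have hul : LocallyIntegrable u volume := by
      intro r
      refine ⟨Ioo (r - 1) (r + 1), Ioo_mem_nhds (by linarith) (by linarith), ?_⟩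
      refine Measure.integrableOn_of_bounded (M := M) (by simp) hu.aestronglyMeasurable ?_
      exact ae_of_all _ fun s => hM s
    exact hk'c.continuous_convolution_left (ContinuousLinearMap.mul ℝ ℝ) hk'cont hul
  · rw [Real.dist_eq, ← integral_sub (hint k hk t) (hint k' hk'i t), ← Real.norm_eq_abs]
    calc ‖∫ s, (k s * u (t - s) - k' s * u (t - s))‖
        ≤ ∫ s, ‖k s * u (t - s) - k' s * u (t - s)‖ := norm_integral_le_integral_norm _
      _ ≤ ∫ s, ‖k s - k' s‖ * M := by
          refine integral_mono ((hint k hk t).sub (hint k' hk'i t)).norm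
            ((hk.sub hk'i).norm.mul_const M) fun s => ?_
          simp only
          rw [← sub_mul, norm_mul]
          exact mul_le_mul_of_nonneg_left (hM _) (norm_nonneg _)
      _ ≤ ε / (2 * (M + 1)) * M := by
          rw [integral_mul_const]
          gcongr
      _ < ε := by
          rw [div_mul_eq_mul_div, div_lt_iff₀ (by positivity)]
          nlinarith

/-- On (-∞, T] the weight e^{-s} is bounded below, and its integral against the tail is at most
f(1). -/
lemma BernsteinData.lintegral_tailExt_ne_top (f : BernsteinData) (T : ℝ) :
    ∫⁻ s in Iic T, f.tailExt s ≠ ∞ := by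
  have h1 := f.laplace_tailExt one_pos
  have h2 : ∫⁻ s, ENNReal.ofReal (Real.exp (-(1 * s))) * f.tailExt s ≠ ∞ := by
    refine ne_top_of_le_ne_top ?_ (le_add_self.trans h1.le)
    exact ENNReal.ofReal_ne_top
  have h3 : ENNReal.ofReal (Real.exp (-(1 * T))) * ∫⁻ s in Iic T, f.tailExt s ≤
      ∫⁻ s, ENNReal.ofReal (Real.exp (-(1 * s))) * f.tailExt s := by
    rw [← lintegral_const_mul _ f.measurable_tailExt]
    refine (setLIntegral_mono ((measurable_ofReal_exp_neg_mul 1).mul f.measurable_tailExt)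
      fun r hr => ?_).trans (setLIntegral_le_lintegral _ _)
    have hrT : r ≤ T := hr
    refine mul_le_mul_left (ENNReal.ofReal_le_ofReal (Real.exp_le_exp.2 ?_)) _
    linarith
  intro hc
  rw [hc, ENNReal.mul_top (by simp [Real.exp_pos]), top_le_iff] at h3
  exact h2 h3

lemma BernsteinData.integrableOn_tail (f : BernsteinData) (T : ℝ) :
    IntegrableOn f.tail (Ioc 0 T) := by
  refine ⟨f.measurable_tail.aestronglyMeasurable, ?_⟩
  rw [hasFiniteIntegral_iff_ofReal (ae_of_all _ f.tail_nonneg)]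
  refine lt_of_le_of_lt ?_ (f.lintegral_tailExt_ne_top T).lt_top
  calc ∫⁻ s in Ioc 0 T, ENNReal.ofReal (f.tail s) = ∫⁻ s in Ioc 0 T, f.tailExt s := by
        refine setLIntegral_congr_fun measurableSet_Ioc fun s hs => ?_
        rw [tailExt, indicator_of_mem (mem_Ioi.2 hs.1)]
    _ ≤ _ := lintegral_mono_set Ioc_subset_Iic_self

namespace InversePair

variable {f : BernsteinData} {ρ m : ℝ → Measure ℝ}

/-- The density of the weighted potential measure. -/
def potentialDensity (ρ : ℝ → Measure ℝ) (g : ℝ → ℝ≥0∞) (r : ℝ) : ℝ :=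
  ((potential ρ g).rnDeriv volume r).toReal

lemma measurable_potentialDensity (g : ℝ → ℝ≥0∞) : Measurable (potentialDensity ρ g) :=
  (Measure.measurable_rnDeriv _ _).ennreal_toReal

lemma potentialDensity_nonneg (g : ℝ → ℝ≥0∞) (r : ℝ) : 0 ≤ potentialDensity ρ g r :=
  ENNReal.toReal_nonneg

lemma setLIntegral_rnDeriv_potential (h : InversePair f ρ m) (hf : f.ConditionI)
    {g : ℝ → ℝ≥0∞} (hg : Measurable g) (A : Set ℝ) :
    ∫⁻ r in A, (potential ρ g).rnDeriv volume r = potential ρ g A := by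
  have := h.sFinite_potential g
  exact Measure.setLIntegral_rnDeriv (h.potential_absolutelyContinuous hf hg) A

lemma rnDeriv_potential_ae_lt_top (h : InversePair f ρ m) (hf : f.ConditionI)
    {g : ℝ → ℝ≥0∞} (hg : Measurable g) (hg1 : ∀ s, g s ≤ 1) :
    ∀ᵐ r, (potential ρ g).rnDeriv volume r < ∞ := by
  have h1 : ∀ n : ℕ, ∀ᵐ r, r ≤ (n : ℝ) → (potential ρ g).rnDeriv volume r < ∞ := by
    intro n
    refine (ae_restrict_iff' (measurableSet_Iic (a := (n : ℝ)))).1 ?_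
    refine ae_lt_top (Measure.measurable_rnDeriv _ _) ?_
    rw [h.setLIntegral_rnDeriv_potential hf hg]
    exact h.potential_Iic_ne_top hf hg hg1 _
  filter_upwards [ae_all_iff.2 h1] with r hr
  obtain ⟨n, hn⟩ := exists_nat_ge r
  exact hr n hn

lemma integrableOn_potentialDensity (h : InversePair f ρ m) (hf : f.ConditionI)
    {g : ℝ → ℝ≥0∞} (hg : Measurable g) (hg1 : ∀ s, g s ≤ 1) (T : ℝ) :
    IntegrableOn (potentialDensity ρ g) (Iic T) := by
  refine integrable_toReal_of_lintegral_ne_top (Measure.measurable_rnDeriv _ _).aemeasurable ?_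
  rw [h.setLIntegral_rnDeriv_potential hf hg]
  exact h.potential_Iic_ne_top hf hg hg1 _

lemma intervalIntegrable_potentialDensity (h : InversePair f ρ m) (hf : f.ConditionI)
    {g : ℝ → ℝ≥0∞} (hg : Measurable g) (hg1 : ∀ s, g s ≤ 1) (a b : ℝ) :
    IntervalIntegrable (potentialDensity ρ g) volume a b := by
  rw [intervalIntegrable_iff]
  exact (h.integrableOn_potentialDensity hf hg hg1 (max a b)).mono_set fun x hx => hx.2

lemma potential_Iic_zero (h : InversePair f ρ m) (hf : f.ConditionI)
    {g : ℝ → ℝ≥0∞} (hg : Measurable g) : potential ρ g (Iic 0) = 0 := by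
  rw [← measure_congr ((h.potential_absolutelyContinuous hf hg).ae_eq Iio_ae_eq_Iic)]
  exact h.potential_Iio_zero hg

lemma integral_potentialDensity (h : InversePair f ρ m) (hf : f.ConditionI)
    {g : ℝ → ℝ≥0∞} (hg : Measurable g) (hg1 : ∀ s, g s ≤ 1) {t : ℝ} (ht : 0 ≤ t) :
    ∫ r in (0 : ℝ)..t, potentialDensity ρ g r = (potential ρ g).real (Iic t) := by
  rw [intervalIntegral.integral_of_le ht]
  have h1 : potential ρ g (Iic t) = potential ρ g (Ioc 0 t) := by
    refine le_antisymm ?_ (measure_mono Ioc_subset_Iic_self)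
    rw [← Iic_union_Ioc_eq_Iic ht]
    refine (measure_union_le _ _).trans ?_
    rw [h.potential_Iic_zero hf hg, zero_add]
  rw [measureReal_def, h1, ← h.setLIntegral_rnDeriv_potential hf hg]
  exact integral_toReal (Measure.measurable_rnDeriv _ _).aemeasurable
    (ae_restrict_of_ae (h.rnDeriv_potential_ae_lt_top hf hg hg1))

lemma continuousOn_potential_Iic (h : InversePair f ρ m) (hf : f.ConditionI)
    {g : ℝ → ℝ≥0∞} (hg : Measurable g) (hg1 : ∀ s, g s ≤ 1) :
    ContinuousOn (fun t => (potential ρ g).real (Iic t)) (Ici 0) := by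
  have h1 : Continuous fun t => ∫ r in (0 : ℝ)..t, potentialDensity ρ g r :=
    intervalIntegral.continuous_primitive
      (fun a b => h.intervalIntegrable_potentialDensity hf hg hg1 a b) 0
  exact h1.continuousOn.congr fun t ht => (h.integral_potentialDensity hf hg hg1 ht).symm

lemma lintegral_tailExt_potential (h : InversePair f ρ m) (hf : f.ConditionI)
    {g : ℝ → ℝ≥0∞} (hg : Measurable g) (hg1 : ∀ s, g s ≤ 1) (t : ℝ) :
    ∫⁻ r, f.tailExt (t - r) ∂potential ρ g =
      ∫⁻ s in Ioc 0 t, ENNReal.ofReal (potentialDensity ρ g (t - s) * f.tail s) := by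
  have := h.sFinite_potential g
  have hUac := h.potential_absolutelyContinuous hf hg
  have hUneg : ∀ᵐ r, r < 0 → (potential ρ g).rnDeriv volume r = 0 := by
    have h1 : ∫⁻ t in Iio 0, (potential ρ g).rnDeriv volume t = 0 := by
      rw [h.setLIntegral_rnDeriv_potential hf hg]
      exact h.potential_Iio_zero hg
    rw [lintegral_eq_zero_iff (Measure.measurable_rnDeriv _ _), Filter.EventuallyEq,
      ae_restrict_iff' measurableSet_Iio] at h1
    exact h1
  rw [← lintegral_rnDeriv_mul hUac (f.measurable_tailExt_sub t).aemeasurable,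
    ← lintegral_sub_left_eq_self _ t, ← lintegral_indicator measurableSet_Ioc]
  have hq := (Measure.measurePreserving_sub_left volume t).quasiMeasurePreserving.ae
    (hUneg.and (h.rnDeriv_potential_ae_lt_top hf hg hg1))
  refine lintegral_congr_ae ?_
  filter_upwards [hq] with s hs
  rw [sub_sub_cancel]
  by_cases hs0 : 0 < s
  · by_cases hst : s ≤ t
    · rw [indicator_of_mem (show s ∈ Ioc 0 t from ⟨hs0, hst⟩), BernsteinData.tailExt,
        indicator_of_mem (mem_Ioi.2 hs0), ENNReal.ofReal_mul (potentialDensity_nonneg _ _),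
        potentialDensity, ENNReal.ofReal_toReal hs.2.ne]
    · rw [hs.1 (by linarith), zero_mul, indicator_of_notMem (show s ∉ Ioc 0 t from fun hh => hst hh.2)]
  · rw [BernsteinData.tailExt, indicator_of_notMem (show s ∉ Ioi 0 from hs0), mul_zero,
      indicator_of_notMem (show s ∉ Ioc 0 t from fun hh => hs0 hh.1)]

lemma convolution_potentialDensity (h : InversePair f ρ m) (hf : f.ConditionI)
    {g : ℝ → ℝ≥0∞} (hg : Measurable g) (hg1 : ∀ s, g s ≤ 1) {t : ℝ} (ht : 0 < t)
    (hfin : ∫⁻ r, f.tailExt (t - r) ∂potential ρ g ≠ ∞) :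
    IntervalIntegrable (fun s => potentialDensity ρ g (t - s) * f.tail s) volume 0 t ∧
    ∫ s in (0 : ℝ)..t, potentialDensity ρ g (t - s) * f.tail s =
      (∫⁻ r, f.tailExt (t - r) ∂potential ρ g).toReal := by
  rw [h.lintegral_tailExt_potential hf hg hg1 t] at hfin ⊢
  have hnn : ∀ s, 0 ≤ potentialDensity ρ g (t - s) * f.tail s := fun s =>
    mul_nonneg (potentialDensity_nonneg _ _) (f.tail_nonneg s)
  have hm : Measurable fun s => potentialDensity ρ g (t - s) * f.tail s :=
    ((measurable_potentialDensity g).comp (by fun_prop)).mul f.measurable_tail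
  constructor
  · rw [intervalIntegrable_iff_integrableOn_Ioc_of_le ht.le]
    refine ⟨hm.aestronglyMeasurable, ?_⟩
    rw [hasFiniteIntegral_iff_ofReal (ae_of_all _ hnn)]
    exact hfin.lt_top
  · rw [intervalIntegral.integral_of_le ht.le,
      integral_eq_lintegral_of_nonneg_ae (ae_of_all _ hnn) hm.aestronglyMeasurable]

/-- A version of the density of the weighted potential measure which solves the renewal equation
at every time. -/
theorem exists_density (h : InversePair f ρ m) (hf : f.ConditionI) {g : ℝ → ℝ}
    (hg : Measurable g) (h0 : ∀ s, 0 ≤ g s) (h1 : ∀ s, g s ≤ 1)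
    (hcont : ContinuousOn (fun t => ∫ s, g s ∂m t) (Ioi 0)) :
    ∃ u : ℝ → ℝ, (∀ T, 0 ≤ T → IntervalIntegrable u volume 0 T) ∧
      (∀ t, 0 ≤ t → ∫ r in (0 : ℝ)..t, u r =
        (potential ρ fun s => ENNReal.ofReal (g s)).real (Iic t)) ∧
      (∀ t, 0 < t → IntervalIntegrable (fun s => u (t - s) * f.tail s) volume 0 t ∧
        f.b * u t + ∫ s in (0 : ℝ)..t, u (t - s) * f.tail s = ∫ s, g s ∂m t) ∧
      (0 < f.b → ContinuousOn u (Ioi 0)) := by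
  have hprob := h.prob
  set G : ℝ → ℝ≥0∞ := fun s => ENNReal.ofReal (g s) with hG
  have hGm : Measurable G := hg.ennreal_ofReal
  have hG1 : ∀ s, G s ≤ 1 := fun s => ENNReal.ofReal_le_one.2 (h1 s)
  have hQ : ∀ t, ∫ s, g s ∂m t = (∫⁻ s, G s ∂m t).toReal := fun t =>
    integral_eq_lintegral_of_nonneg_ae (ae_of_all _ h0) hg.aestronglyMeasurable
  have hQ1 : ∀ t, ∫⁻ s, G s ∂m t ≤ 1 := fun t =>
    (lintegral_mono hG1).trans (by simp)
  -- Without drift the renewal equation already holds at every time for any version of the density.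
  -- With drift the values of u at single points matter, and a version has to be chosen.
  rcases f.b_nonneg.eq_or_lt with hb | hb
  · refine ⟨potentialDensity ρ G, fun T _ => h.intervalIntegrable_potentialDensity hf hGm hG1 _ _,
      fun t ht => h.integral_potentialDensity hf hGm hG1 ht, fun t ht => ?_,
      fun hb' => absurd hb' (by rw [← hb]; exact lt_irrefl _)⟩
    have hC := h.convolution_eq_of_drift_eq_zero hf hb.symm hGm hG1 ht
    have hCt : ∫⁻ r, f.tailExt (t - r) ∂potential ρ G ≠ ∞ := by
      rw [hC]; exact ne_top_of_le_ne_top ENNReal.one_ne_top (hQ1 t)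
    obtain ⟨hi, he⟩ := h.convolution_potentialDensity hf hGm hG1 ht hCt
    refine ⟨hi, ?_⟩
    rw [he, hC, ← hb, zero_mul, zero_add, hQ]
  · set v := potentialDensity ρ G with hv
    -- The equation forces b v ≤ 1 almost everywhere on (0, ∞). Clipping at 1/b gives a bounded
    -- version, whose convolution with the locally integrable tail is continuous.
    set u₀ : ℝ → ℝ := (Ioi 0).indicator fun r => min (v r) (1 / f.b) with hu₀
    have hvm : Measurable v := measurable_potentialDensity G
    have hu₀m : Measurable u₀ := (hvm.min measurable_const).indicator measurableSet_Ioi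
    have hu₀nn : ∀ r, 0 ≤ u₀ r := fun r => indicator_nonneg
      (fun r _ => le_min (potentialDensity_nonneg _ _) (by positivity)) r
    have hu₀le : ∀ r, u₀ r ≤ 1 / f.b := fun r =>
      indicator_le' (fun r _ => min_le_right _ _) (fun r _ => by positivity) r
    have hae := h.ae_potential_add_convolution hf hGm hG1
    have hvb : ∀ᵐ r, 0 < r → v r = u₀ r := by
      filter_upwards [hae] with r hr hr0
      have h2 : ENNReal.ofReal f.b * (potential ρ G).rnDeriv volume r ≤ 1 :=
        le_self_add.trans ((hr hr0).le.trans (hQ1 r))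
      have h3 := ENNReal.toReal_mono ENNReal.one_ne_top h2
      rw [ENNReal.toReal_mul, ENNReal.toReal_ofReal hb.le, ENNReal.toReal_one] at h3
      have h4 : v r ≤ 1 / f.b := by
        rw [le_div_iff₀ hb, mul_comm]; exact h3
      rw [hu₀, indicator_of_mem (mem_Ioi.2 hr0), min_eq_left h4]
    set W : ℝ → ℝ := fun t => ∫ s in (0 : ℝ)..t, u₀ (t - s) * f.tail s with hW
    have hint₀ : ∀ t, 0 < t → IntervalIntegrable (fun s => u₀ (t - s) * f.tail s) volume 0 t := by
      intro t ht
      rw [intervalIntegrable_iff_integrableOn_Ioc_of_le ht.le]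
      refine (f.integrableOn_tail t).bdd_mul (c := 1 / f.b)
        (hu₀m.comp (by fun_prop)).aestronglyMeasurable (ae_of_all _ fun s => ?_)
      rw [Real.norm_of_nonneg (hu₀nn _)]
      exact hu₀le _
    have hshift : ∀ t, 0 < t → ∀ w₁ w₂ : ℝ → ℝ, (∀ᵐ r, 0 < r → w₁ r = w₂ r) →
        ∀ᵐ s, s ∈ uIoc 0 t → w₁ (t - s) * f.tail s = w₂ (t - s) * f.tail s := by
      intro t ht w₁ w₂ hw
      have hne : ∀ᵐ r : ℝ, r ≠ t := by simp [ae_iff]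
      filter_upwards [(Measure.measurePreserving_sub_left volume t).quasiMeasurePreserving.ae hw,
        hne] with s hs hst hmem
      rw [uIoc_of_le ht.le] at hmem
      rw [hs (sub_pos.2 (lt_of_le_of_ne hmem.2 hst))]
    have hWcont : ContinuousOn W (Ioi 0) := by
      intro t ht
      have ht' : (0 : ℝ) < t := ht
      have hk : Integrable ((Ioc 0 (t + 1)).indicator f.tail) :=
        (integrable_indicator_iff measurableSet_Ioc).2 (f.integrableOn_tail (t + 1))
      have hc := continuous_convolution_of_integrable_of_bounded hk hu₀m (M := 1 / f.b)
        fun r => by rw [abs_of_nonneg (hu₀nn r)]; exact hu₀le r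
      refine ContinuousAt.continuousWithinAt (hc.continuousAt.congr ?_)
      filter_upwards [Ioo_mem_nhds ht' (lt_add_one t)] with τ hτ
      rw [hW]
      simp only
      rw [intervalIntegral.integral_of_le hτ.1.le, ← integral_indicator measurableSet_Ioc]
      refine integral_congr_ae ?_
      refine ae_of_all _ fun s => ?_
      simp only
      by_cases hs0 : 0 < s
      · by_cases hsτ : s ≤ τ
        · rw [indicator_of_mem (show s ∈ Ioc 0 τ from ⟨hs0, hsτ⟩),
            indicator_of_mem (show s ∈ Ioc 0 (t + 1) from ⟨hs0, hsτ.trans hτ.2.le⟩), mul_comm]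
        · rw [indicator_of_notMem (s := Ioc 0 τ) fun hh => hsτ hh.2, hu₀,
            indicator_of_notMem (s := Ioi 0) (by simp only [mem_Ioi]; linarith), mul_zero]
      · rw [indicator_of_notMem (show s ∉ Ioc 0 τ from fun hh => hs0 hh.1),
          indicator_of_notMem (show s ∉ Ioc 0 (t + 1) from fun hh => hs0 hh.1), zero_mul]
    -- The renewal equation solved for u. On (0, ∞) this alters the density only on a null set, so
    -- the convolution W is unchanged and the equation now holds at every t > 0.
    set u : ℝ → ℝ := fun t => ((∫ s, g s ∂m t) - W t) / f.b with hu
    have huv : ∀ᵐ r, 0 < r → u r = v r := by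
      filter_upwards [hae] with t ht ht0
      have h2 := ht ht0
      have hsum : ENNReal.ofReal f.b * (potential ρ G).rnDeriv volume t +
          ∫⁻ r, f.tailExt (t - r) ∂potential ρ G ≠ ∞ := by
        rw [h2]; exact ne_top_of_le_ne_top ENNReal.one_ne_top (hQ1 t)
      rw [ENNReal.add_ne_top] at hsum
      have h3 := congrArg ENNReal.toReal h2
      rw [ENNReal.toReal_add hsum.1 hsum.2, ENNReal.toReal_mul, ENNReal.toReal_ofReal hb.le,
        ← (h.convolution_potentialDensity hf hGm hG1 ht0 hsum.2).2, ← hQ t] at h3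
      have h4 : ∫ s in (0 : ℝ)..t, v (t - s) * f.tail s = W t :=
        intervalIntegral.integral_congr_ae (hshift t ht0 _ _ hvb)
      rw [← hv, h4] at h3
      rw [hu]
      simp only
      rw [← h3, add_sub_cancel_right, mul_div_cancel_left₀ _ hb.ne']
      rfl
    have huu₀ : ∀ᵐ r, 0 < r → u r = u₀ r := by
      filter_upwards [huv, hvb] with r h2 h3 hr
      rw [h2 hr, h3 hr]
    have huvI : ∀ T, 0 ≤ T → ∀ᵐ r, r ∈ uIoc 0 T → v r = u r := by
      intro T hT
      filter_upwards [huv] with r hr hmem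
      rw [uIoc_of_le hT] at hmem
      exact (hr hmem.1).symm
    refine ⟨u, fun T hT => ?_, fun t ht => ?_, fun t ht => ⟨?_, ?_⟩, fun _ => ?_⟩
    · refine (h.intervalIntegrable_potentialDensity hf hGm hG1 0 T).congr_ae ?_
      rw [Filter.EventuallyEq, ae_restrict_iff' measurableSet_uIoc]
      exact huvI T hT
    · rw [← h.integral_potentialDensity hf hGm hG1 ht]
      refine intervalIntegral.integral_congr_ae ?_
      filter_upwards [huvI t ht] with r hr hmem using (hr hmem).symm
    · refine (hint₀ t ht).congr_ae ?_
      rw [Filter.EventuallyEq, ae_restrict_iff' measurableSet_uIoc]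
      filter_upwards [hshift t ht _ _ huu₀] with s hs hmem using (hs hmem).symm
    · have : ∫ s in (0 : ℝ)..t, u (t - s) * f.tail s = W t :=
        intervalIntegral.integral_congr_ae (hshift t ht _ _ huu₀)
      rw [this, hu]
      field_simp
      ring
    · exact (hcont.sub hWcont).div_const _

end InversePair

/-! ### Generalized Caputo derivatives of expectations along the inverse -/

lemma AbsolutelyContinuousOnInterval.congr_of_eqOn {q w : ℝ → ℝ} {a b : ℝ}
    (hw : AbsolutelyContinuousOnInterval w a b) (h : ∀ t ∈ uIcc a b, q t = w t) :
    AbsolutelyContinuousOnInterval q a b := by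
  rw [absolutelyContinuousOnInterval_iff] at hw ⊢
  intro ε hε
  obtain ⟨δ, hδ, hE⟩ := hw ε hε
  refine ⟨δ, hδ, fun E hmem hlt => ?_⟩
  refine lt_of_eq_of_lt (Finset.sum_congr rfl fun i hi => ?_) (hE E hmem hlt)
  rw [h _ (hmem.1 i hi).1, h _ (hmem.1 i hi).2]

/-- A function with a primitive representation has a generalized Caputo derivative. -/
lemma BernsteinData.hasCaputo_of_eq_primitive (f : BernsteinData) {q w : ℝ → ℝ} {q₀ d t : ℝ}
    (ht : 0 < t) (hw : ∀ T, 0 ≤ T → IntervalIntegrable w volume 0 T)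
    (hq : ∀ t, 0 ≤ t → q t = q₀ + ∫ r in (0 : ℝ)..t, w r)
    (hi : IntervalIntegrable (fun s => w (t - s) * f.tail s) volume 0 t)
    (hd : f.b * w t + ∫ s in (0 : ℝ)..t, w (t - s) * f.tail s = d)
    (hc : 0 < f.b → ContinuousOn w (Ioi 0)) : f.HasCaputo q t d := by
  -- Lebesgue differentiation gives q' = w almost everywhere, which suffices under the integral. The
  -- derivative at t itself is needed only for b > 0, where w is continuous.
  have hderiv : ∀ᵐ r, r ∈ Ioo 0 t → deriv q r = w r := by
    filter_upwards [(hw t ht.le).ae_hasDerivAt_integral] with r hr hmem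
    have h1 := hr (by rw [uIcc_of_le ht.le]; exact Ioo_subset_Icc_self hmem) 0 left_mem_uIcc
    have h2 : HasDerivAt q (w r) r := by
      refine (h1.const_add q₀).congr_of_eventuallyEq ?_
      filter_upwards [Ioi_mem_nhds hmem.1] with τ hτ using hq τ (le_of_lt hτ)
    exact h2.deriv
  have hD : 0 < f.b → HasDerivAt q (w t) t := by
    intro hb
    have h1 : HasDerivAt (fun τ => ∫ r in (0 : ℝ)..τ, w r) (w t) t :=
      intervalIntegral.integral_hasDerivAt_right (hw t ht.le)
        ((hc hb).stronglyMeasurableAtFilter isOpen_Ioi t ht)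
        ((hc hb).continuousAt (Ioi_mem_nhds ht))
    refine (h1.const_add q₀).congr_of_eventuallyEq ?_
    filter_upwards [Ioi_mem_nhds ht] with τ hτ using hq τ (le_of_lt hτ)
  have hae : ∀ᵐ s, s ∈ uIoc 0 t →
      w (t - s) * f.tail s = deriv (fun τ => q (τ - s)) t * f.tail s := by
    have hne : ∀ᵐ r : ℝ, r ≠ t := by simp [ae_iff]
    filter_upwards [(Measure.measurePreserving_sub_left volume t).quasiMeasurePreserving.ae hderiv,
      hne] with s hs hst hmem
    rw [uIoc_of_le ht.le] at hmem
    rw [deriv_comp_sub_const, hs ⟨sub_pos.2 (lt_of_le_of_ne hmem.2 hst), by linarith [hmem.1]⟩]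
  refine ⟨fun T hT => ?_, fun hb => (hD hb).differentiableAt, ?_, ?_⟩
  · have h1 := (hw T hT.le).absolutelyContinuousOnInterval_intervalIntegral
      (c := 0) left_mem_uIcc
    have h2 : AbsolutelyContinuousOnInterval (fun _ : ℝ => q₀) 0 T :=
      (LipschitzWith.const q₀).lipschitzOnWith.absolutelyContinuousOnInterval
    refine (h2.add h1).congr_of_eqOn fun r hr => ?_
    rw [uIcc_of_le hT.le] at hr
    exact hq r hr.1
  · refine hi.congr_ae ?_
    rw [Filter.EventuallyEq, ae_restrict_iff' measurableSet_uIoc]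
    exact hae
  · rw [BernsteinData.caputo, ← hd, ← intervalIntegral.integral_congr_ae hae]
    congr 1
    rcases f.b_nonneg.eq_or_lt with hb | hb
    · rw [← hb, zero_mul, zero_mul]
    · rw [(hD hb).deriv]

namespace InversePair

variable {f : BernsteinData} {ρ m : ℝ → Measure ℝ}

/-- Layer-cake formula: E ∫_0^{Y(t)} g(s) ds = ∫ g(s) P(Y(t) > s) ds, and P(Y(t) > s) = ρ_s[0, t]
for t > 0. -/
lemma integral_primitive (h : InversePair f ρ m) (hf : f.ConditionI) {g : ℝ → ℝ}
    (hg : Continuous g) (h0 : ∀ s, 0 ≤ g s) (h1 : ∀ s, g s ≤ 1) {t : ℝ} (ht : 0 ≤ t) :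
    Integrable (fun y => ∫ s in (0 : ℝ)..y, g s) (m t) ∧
    ∫ y, (∫ s in (0 : ℝ)..y, g s) ∂m t =
      (potential ρ fun s => ENNReal.ofReal (g s)).real (Iic t) := by
  have hprob := h.prob
  have hfin := h.isFiniteMeasure
  set G : ℝ → ℝ≥0∞ := fun s => ENNReal.ofReal (g s) with hG
  have hGm : Measurable G := hg.measurable.ennreal_ofReal
  have hG1 : ∀ s, G s ≤ 1 := fun s => ENNReal.ofReal_le_one.2 (h1 s)
  rcases ht.eq_or_lt with rfl | ht
  · rw [h.m_zero hf, measureReal_def, h.potential_Iic_zero hf hGm]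
    exact ⟨integrable_dirac (by simp), by simp⟩
  have hcont : Continuous fun y => ∫ s in (0 : ℝ)..y, g s :=
    intervalIntegral.continuous_primitive (fun a b => hg.intervalIntegrable a b) 0
  have hnn : ∀ᵐ y ∂m t, 0 ≤ ∫ s in (0 : ℝ)..y, g s := by
    filter_upwards [h.m_nonneg t] with y hy
    exact intervalIntegral.integral_nonneg hy fun s _ => h0 s
  have hlin : ∫⁻ y, ENNReal.ofReal (∫ s in (0 : ℝ)..y, g s) ∂m t = potential ρ G (Iic t) := by
    have hE : ∀ s, G s * m t (Ioi s) = ∫⁻ y, (Ioi s).indicator (fun _ => G s) y ∂m t := by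
      intro s
      rw [lintegral_indicator measurableSet_Ioi, setLIntegral_const]
    have hm : Measurable fun p : ℝ × ℝ => (Ioi p.1).indicator (fun _ => G p.1) p.2 := by
      have : (fun p : ℝ × ℝ => (Ioi p.1).indicator (fun _ => G p.1) p.2) =
          {p : ℝ × ℝ | p.1 < p.2}.indicator fun p => G p.1 := by
        ext p; simp [indicator]
      rw [this]
      exact Measurable.indicator (hGm.comp measurable_fst)
        (measurableSet_lt measurable_fst measurable_snd)
    rw [h.potential_apply hGm measurableSet_Iic, setLIntegral_congr_fun (g := fun s =>
      G s * m t (Ioi s)) measurableSet_Ioi fun s hs => by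
        simp only; rw [h.m_Ioi hf ht (le_of_lt hs)]]
    simp_rw [hE]
    rw [lintegral_lintegral_swap hm.aemeasurable]
    refine lintegral_congr_ae ?_
    filter_upwards [h.m_nonneg t] with y hy
    have : ∀ s, (Ioi s).indicator (fun _ => G s) y = (Iio y).indicator G s := by
      intro s; simp [indicator]
    simp_rw [this]
    rw [setLIntegral_indicator measurableSet_Iio, Iio_inter_Ioi,
      intervalIntegral.integral_of_le hy, integral_Ioc_eq_integral_Ioo,
      ofReal_integral_eq_lintegral_ofReal]
    · exact (hg.integrableOn_Icc).mono_set Ioo_subset_Icc_self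
    · exact ae_of_all _ h0
  constructor
  · refine ⟨hcont.aestronglyMeasurable, ?_⟩
    rw [hasFiniteIntegral_iff_ofReal hnn, hlin]
    exact (h.potential_Iic_ne_top hf hGm hG1 t).lt_top
  · rw [integral_eq_lintegral_of_nonneg_ae hnn hcont.aestronglyMeasurable, hlin, measureReal_def]

/-- A family of functions with values in `[0, 1]` which is closed under differentiation: the
expectations along the inverse subordinator solve the corresponding system of fractional
equations. -/
theorem hasCaputo_integral (h : InversePair f ρ m) (hf : f.ConditionI) {ι : Type*}
    (S : ι → Finset ι) (c : ι → ι → ℝ) (φ : ι → ℝ → ℝ)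
    (hφ : ∀ i s, 0 ≤ s → HasDerivAt (φ i) (∑ j ∈ S i, c i j * φ j s) s)
    (h0 : ∀ i s, 0 ≤ s → 0 ≤ φ i s) (h1 : ∀ i s, 0 ≤ s → φ i s ≤ 1) (i : ι) {t : ℝ} (ht : 0 < t) :
    f.HasCaputo (fun t => ∫ s, φ i s ∂m t) t (∑ j ∈ S i, c i j * ∫ s, φ j s ∂m t) := by
  have hprob := h.prob
  -- Freezing φ at its value at 0 for negative arguments gives continuous functions into [0, 1] on
  -- the whole line. Neither m_t nor the potential measures see s < 0.
  set g : ι → ℝ → ℝ := fun j s => φ j (max s 0) with hg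
  have hgc : ∀ j, Continuous (g j) := by
    intro j
    have hc : ContinuousOn (φ j) (Ici 0) := fun s hs =>
      (hφ j s hs).continuousAt.continuousWithinAt
    exact hc.comp_continuous (continuous_id.max continuous_const) fun s =>
      mem_Ici.2 (le_max_right _ _)
  have hg0 : ∀ j s, 0 ≤ g j s := fun j s => h0 j _ (le_max_right _ _)
  have hg1 : ∀ j s, g j s ≤ 1 := fun j s => h1 j _ (le_max_right _ _)
  have hgφ : ∀ j s, 0 ≤ s → g j s = φ j s := fun j s hs => by simp only [hg, max_eq_left hs]
  have hgint : ∀ j t, ∫ s, g j s ∂m t = ∫ s, φ j s ∂m t := by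
    intro j t
    refine integral_congr_ae ?_
    filter_upwards [h.m_nonneg t] with s hs using hgφ j s hs
  set G : ι → ℝ → ℝ≥0∞ := fun j s => ENNReal.ofReal (g j s) with hG
  have hGm : ∀ j, Measurable (G j) := fun j => (hgc j).measurable.ennreal_ofReal
  have hG1 : ∀ j s, G j s ≤ 1 := fun j s => ENNReal.ofReal_le_one.2 (hg1 j s)
  have hprim : ∀ i y, 0 ≤ y →
      φ i y = φ i 0 + ∑ j ∈ S i, c i j * ∫ s in (0 : ℝ)..y, g j s := by
    intro i y hy
    have hint : ∀ j ∈ S i, IntervalIntegrable (fun s => c i j * g j s) volume 0 y := fun j _ =>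
      ((hgc j).const_mul _).intervalIntegrable _ _
    have h2 := intervalIntegral.integral_eq_sub_of_hasDerivAt (a := 0) (b := y) (f := φ i)
      (f' := fun s => ∑ j ∈ S i, c i j * g j s) (fun s hs => ?_)
      (Continuous.intervalIntegrable (continuous_finsetSum _ fun j _ => (hgc j).const_mul _) _ _)
    · rw [intervalIntegral.integral_finsetSum hint] at h2
      simp_rw [intervalIntegral.integral_const_mul] at h2
      linarith
    · rw [uIcc_of_le hy] at hs
      simp_rw [hgφ _ s hs.1]
      exact hφ i s hs.1
  -- The expectation of φ_i(Y) - φ_i(0) is a combination of potential masses of [0, t]. These are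
  -- continuous in t, which supplies the continuity hypothesis of `exists_density`.
  have hstar : ∀ i t, 0 ≤ t → ∫ s, φ i s ∂m t =
      φ i 0 + ∑ j ∈ S i, c i j * (potential ρ (G j)).real (Iic t) := by
    intro i t ht
    have h2 : ∫ s, φ i s ∂m t =
        ∫ y, (φ i 0 + ∑ j ∈ S i, c i j * ∫ s in (0 : ℝ)..y, g j s) ∂m t := by
      refine integral_congr_ae ?_
      filter_upwards [h.m_nonneg t] with y hy using hprim i y hy
    have h3 : ∀ j ∈ S i, Integrable (fun y => c i j * ∫ s in (0 : ℝ)..y, g j s) (m t) :=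
      fun j _ => (h.integral_primitive hf (hgc j) (hg0 j) (hg1 j) ht).1.const_mul _
    rw [h2, integral_add (integrable_const _) (integrable_finsetSum _ h3),
      integral_finsetSum _ h3]
    simp only [integral_const, probReal_univ, one_smul]
    congr 1
    refine Finset.sum_congr rfl fun j _ => ?_
    rw [integral_const_mul, (h.integral_primitive hf (hgc j) (hg0 j) (hg1 j) ht).2]
  have hcont : ∀ j, ContinuousOn (fun t => ∫ s, g j s ∂m t) (Ioi 0) := by
    intro j
    have h2 : ContinuousOn (fun t => φ j 0 + ∑ l ∈ S j, c j l * (potential ρ (G l)).real (Iic t))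
        (Ici 0) :=
      continuousOn_const.add (continuousOn_finsetSum _ fun l _ =>
        continuousOn_const.mul (h.continuousOn_potential_Iic hf (hGm l) (hG1 l)))
    refine (h2.mono Ioi_subset_Ici_self).congr fun t ht => ?_
    simp only
    rw [hgint, hstar j t (le_of_lt ht)]
  choose u hu1 hu2 hu3 hu4 using fun j =>
    h.exists_density hf (hgc j).measurable (hg0 j) (hg1 j) (hcont j)
  refine f.hasCaputo_of_eq_primitive (w := fun r => ∑ j ∈ S i, c i j * u j r) (q₀ := φ i 0) ht
    (fun T hT => ?_) (fun t ht => ?_) ?_ ?_ (fun hb => ?_)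
  · rw [intervalIntegrable_iff]
    exact integrable_finsetSum _ fun j _ =>
      intervalIntegrable_iff.1 ((hu1 j T hT).const_mul _)
  · rw [hstar i t ht, intervalIntegral.integral_finsetSum fun j _ => (hu1 j t ht).const_mul _]
    simp_rw [intervalIntegral.integral_const_mul, hu2 _ t ht]
    rfl
  · simp_rw [Finset.sum_mul, mul_assoc]
    rw [intervalIntegrable_iff]
    exact integrable_finsetSum _ fun j _ =>
      intervalIntegrable_iff.1 (((hu3 j t ht).1).const_mul _)
  -- The renewal equation turns each b u_j + ν * u_j into the expectation of φ_j, which closes the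
  -- system.
  · simp_rw [Finset.sum_mul, mul_assoc]
    rw [intervalIntegral.integral_finsetSum fun j _ => ((hu3 j t ht).1).const_mul _,
      Finset.mul_sum, ← Finset.sum_add_distrib]
    refine Finset.sum_congr rfl fun j _ => ?_
    rw [intervalIntegral.integral_const_mul, ← hgint, ← (hu3 j t ht).2]
    ring
  · exact continuousOn_finsetSum _ fun j _ => continuousOn_const.mul (hu4 j hb)

end InversePair

/-! ### Evaluation of a process at an independent random time -/

/-- The point of the grid `(1 / (n + 1)) ℕ` with index `j + 1`. -/
def gridPoint (n j : ℕ) : ℝ≥0 := (j + 1) / (n + 1)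

/-- The index of the last grid point before `τ`. -/
def gridIndex (n : ℕ) (τ : ℝ≥0∞) : ℕ := ⌊((n : ℝ≥0) + 1) * τ.toNNReal⌋₊

lemma measurable_gridIndex (n : ℕ) : Measurable (gridIndex n) :=
  Nat.measurable_floor.comp (ENNReal.measurable_toNNReal.const_mul _)

/-- `gridPoint` lies one step beyond the floor, so the approximation comes from the right and
right-continuous paths converge along it. -/
lemma tendsto_gridPoint (τ : ℝ≥0∞) :
    Tendsto (fun n => gridPoint n (gridIndex n τ)) atTop (𝓝[≥] τ.toNNReal) := by
  set x := τ.toNNReal with hx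
  have hpos : ∀ n : ℕ, (0 : ℝ≥0) < (n : ℝ≥0) + 1 := fun n => by positivity
  have hlow : ∀ n, x ≤ gridPoint n (gridIndex n τ) := fun n => by
    rw [gridPoint, le_div_iff₀ (hpos n), mul_comm, gridIndex]
    exact (Nat.lt_floor_add_one _).le
  have hup : ∀ n, gridPoint n (gridIndex n τ) ≤ x + 1 / ((n : ℝ≥0) + 1) := fun n => by
    rw [gridPoint, add_div, gridIndex]
    gcongr
    rw [div_le_iff₀ (hpos n), mul_comm]
    exact Nat.floor_le zero_le
  refine tendsto_nhdsWithin_iff.2 ⟨?_, Eventually.of_forall hlow⟩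
  refine tendsto_of_tendsto_of_tendsto_of_le_of_le tendsto_const_nhds ?_ hlow hup
  have h1 : Tendsto (fun n : ℕ => 1 / ((n : ℝ≥0) + 1)) atTop (𝓝 0) :=
    tendsto_one_div_add_atTop_nhds_zero_nat
  simpa using h1.const_add x

section RandomTime

variable {Ω E : Type*} [MeasurableSpace Ω] [MeasurableSpace E] {P : Measure Ω}

lemma measurable_gridEval (n : ℕ) :
    Measurable fun q : (ℝ≥0 → E) × ℝ≥0∞ => q.1 (gridPoint n (gridIndex n q.2)) := by
  have h1 : Measurable fun q : (ℝ≥0 → E) × ℕ => q.1 (gridPoint n q.2) :=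
    measurable_from_prod_countable_left fun j => measurable_pi_apply (X := fun _ => E) (gridPoint n j)
  exact h1.comp (measurable_fst.prodMk ((measurable_gridIndex n).comp measurable_snd))

/-- The value of a right-continuous process at a random time is almost surely a measurable
function of the path and the time. -/
lemma exists_measurable_randomTime {F : ℝ≥0 → Ω → ℝ≥0∞} {T : Ω → ℝ≥0}
    (hrc : ∀ᵐ ω ∂P, ∀ t, ContinuousWithinAt (fun r => F r ω) (Ici t) t) :
    ∃ G : (ℝ≥0 → ℝ≥0∞) × ℝ≥0 → ℝ≥0∞, Measurable G ∧
      ∀ᵐ ω ∂P, G ((fun t => F t ω), T ω) = F (T ω) ω := by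
  -- The map (path, time) ↦ path(time) is not measurable for the product σ-algebra on all paths. A
  -- limsup over grid times is, and it agrees with evaluation on right-continuous paths.
  refine ⟨fun q => limsup (fun n => q.1 (gridPoint n (gridIndex n q.2))) atTop, ?_, ?_⟩
  · refine Measurable.limsup fun n => ?_
    exact (measurable_gridEval n).comp
      (measurable_fst.prodMk (measurable_coe_nnreal_ennreal.comp measurable_snd))
  · filter_upwards [hrc] with ω hω
    refine Tendsto.limsup_eq ?_
    have h1 := tendsto_gridPoint (T ω : ℝ≥0∞)
    rw [ENNReal.toNNReal_coe] at h1
    exact (hω _).tendsto.comp h1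

variable [IsProbabilityMeasure P]

/-- The expectation of a right-continuous bounded functional of a process at an independent random
time with values in `[0, ∞]`. -/
lemma integral_randomTime {F : ℝ≥0 → Ω → E} (hF : ∀ t, Measurable (F t)) {T : Ω → ℝ≥0∞}
    (hT : AEMeasurable T P) (hind : IndepFun (fun ω t => F t ω) T P) {φ : E → ℝ}
    (hφ : Measurable φ) (hb : ∀ e, |φ e| ≤ 1)
    (hrc : ∀ᵐ ω ∂P, ∀ t, ContinuousWithinAt (fun r => φ (F r ω)) (Ici t) t)
    {k : ℝ≥0 → ℝ} (hk : ∀ r, ∫ ω, φ (F r ω) ∂P = k r) (hkc : Continuous k) :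
    AEStronglyMeasurable (fun ω => if T ω = ∞ then 0 else φ (F (T ω).toNNReal ω)) P ∧
    ∫ ω, (if T ω = ∞ then 0 else φ (F (T ω).toNNReal ω)) ∂P =
      ∫ ω, (if T ω = ∞ then 0 else k (T ω).toNNReal) ∂P := by
  have hpath : Measurable fun ω t => F t ω := measurable_pi_lambda _ hF
  have hkb : ∀ r, |k r| ≤ 1 := fun r => by
    rw [← hk r]
    have := norm_integral_le_of_norm_le_const (μ := P) (f := fun ω => φ (F r ω)) (C := 1)
      (ae_of_all _ fun ω => hb _)
    simpa using this
  have hS : MeasurableSet {q : (ℝ≥0 → E) × ℝ≥0∞ | q.2 = ∞} :=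
    measurable_snd (measurableSet_singleton ∞)
  let Φ : ℕ → (ℝ≥0 → E) × ℝ≥0∞ → ℝ := fun n q =>
    if q.2 = ∞ then 0 else φ (q.1 (gridPoint n (gridIndex n q.2)))
  have hΦ : ∀ n, Measurable (Φ n) := fun n =>
    Measurable.ite hS measurable_const (hφ.comp (measurable_gridEval n))
  have hΦb : ∀ n q, ‖Φ n q‖ ≤ 1 := fun n q => by
    simp only [Φ]
    split_ifs
    · simp
    · exact hb _
  have hκm : ∀ n, Measurable fun τ : ℝ≥0∞ =>
      if τ = ∞ then 0 else k (gridPoint n (gridIndex n τ)) := fun n =>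
    Measurable.ite (measurableSet_singleton ∞) measurable_const
      (hkc.measurable.comp ((measurable_of_countable (gridPoint n)).comp
        (measurable_gridIndex n)))
  have hpair : AEMeasurable (fun ω => ((fun t => F t ω), T ω)) P := hpath.aemeasurable.prodMk hT
  have hprod := (indepFun_iff_map_prod_eq_prod_map_map hpath.aemeasurable hT).1 hind
  have hmapF := Measure.isProbabilityMeasure_map (μ := P) hpath.aemeasurable
  have hmapT := Measure.isProbabilityMeasure_map (μ := P) hT
  -- At grid times evaluation is jointly measurable, so independence allows Fubini. Dominated
  -- convergence then passes to the limit on both sides.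
  have hdisc : ∀ n, ∫ ω, Φ n ((fun t => F t ω), T ω) ∂P =
      ∫ ω, (if T ω = ∞ then 0 else k (gridPoint n (gridIndex n (T ω)))) ∂P := by
    intro n
    rw [← integral_map hpair (hΦ n).aestronglyMeasurable, hprod, integral_prod_symm,
      ← integral_map hT (hκm n).aestronglyMeasurable]
    · refine integral_congr_ae (ae_of_all _ fun τ => ?_)
      simp only [Φ]
      split_ifs with hτ
      · simp
      · rw [integral_map hpath.aemeasurable, hk]
        exact (hφ.comp (measurable_pi_apply _)).aestronglyMeasurable
    · exact Integrable.of_bound (hΦ n).aestronglyMeasurable 1 (ae_of_all _ (hΦb n))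
  have hlim : ∀ᵐ ω ∂P, Tendsto (fun n => Φ n ((fun t => F t ω), T ω)) atTop
      (𝓝 (if T ω = ∞ then 0 else φ (F (T ω).toNNReal ω))) := by
    filter_upwards [hrc] with ω hω
    simp only [Φ]
    split_ifs
    · exact tendsto_const_nhds
    · exact (hω _).tendsto.comp (tendsto_gridPoint (T ω))
  have hmeas : ∀ n, AEStronglyMeasurable (fun ω => Φ n ((fun t => F t ω), T ω)) P := fun n =>
    ((hΦ n).comp_aemeasurable hpair).aestronglyMeasurable
  refine ⟨aestronglyMeasurable_of_tendsto_ae atTop hmeas hlim, ?_⟩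
  have h1 := tendsto_integral_of_dominated_convergence (fun _ => (1 : ℝ)) hmeas
    (integrable_const _) (fun n => ae_of_all _ fun ω => hΦb n _) hlim
  have h2 : Tendsto (fun n => ∫ ω, (if T ω = ∞ then 0 else k (gridPoint n (gridIndex n (T ω)))) ∂P)
      atTop (𝓝 (∫ ω, (if T ω = ∞ then 0 else k (T ω).toNNReal) ∂P)) := by
    refine tendsto_integral_of_dominated_convergence (fun _ => (1 : ℝ))
      (fun n => ((hκm n).comp_aemeasurable hT).aestronglyMeasurable) (integrable_const _)
      (fun n => ae_of_all _ fun ω => ?_) (ae_of_all _ fun ω => ?_)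
    · split_ifs
      · simp
      · exact hkb _
    · split_ifs
      · exact tendsto_const_nhds
      · exact (hkc.tendsto _).comp ((tendsto_gridPoint (T ω)).mono_right nhdsWithin_le_nhds)
  simp_rw [hdisc] at h1
  exact tendsto_nhds_unique h1 h2

end RandomTime

/-! ### Laplace transforms of random variables with values in `[0, ∞]` -/

section LaplaceRandomVariable

variable {Ω : Type*} [MeasurableSpace Ω] {P : Measure Ω}

/-- After discarding {Z = ∞}, where the integrand is 0, this is a moment generating function at -x.
Its analyticity on (-∞, 0) gives smoothness in x and derivatives under the expectation. -/
lemma integral_expNegMul_eq_mgf {Z : Ω → ℝ≥0∞} (hZ : AEMeasurable Z P) (x : ℝ) :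
    ∫ ω, expNegMul x (Z ω) ∂P =
      mgf (fun ω => (Z ω).toReal) (P.restrict {ω | Z ω ≠ ∞}) (-x) := by
  have hs : NullMeasurableSet {ω | Z ω ≠ ∞} P :=
    hZ.nullMeasurable (measurableSet_singleton ∞).compl
  rw [mgf, ← integral_indicator₀ hs]
  refine integral_congr_ae (ae_of_all _ fun ω => ?_)
  simp only [expNegMul]
  split_ifs with h
  · rw [indicator_of_notMem (by simpa using h)]
  · rw [indicator_of_mem (by simpa using h), neg_mul]

variable [IsProbabilityMeasure P]

lemma neg_mem_interior_integrableExpSet {Z : Ω → ℝ≥0∞} (hZ : AEMeasurable Z P) {x : ℝ}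
    (hx : 0 < x) : -x ∈ interior (integrableExpSet (fun ω => (Z ω).toReal)
      (P.restrict {ω | Z ω ≠ ∞})) := by
  refine mem_interior.2 ⟨Iio 0, fun y hy => ?_, isOpen_Iio, by simpa using hx⟩
  refine Integrable.of_bound (C := 1) ?_ (ae_of_all _ fun ω => ?_)
  · exact ((hZ.restrict.ennreal_toReal.const_mul y).exp).aestronglyMeasurable
  · rw [Real.norm_of_nonneg (Real.exp_pos _).le, Real.exp_le_one_iff]
    exact mul_nonpos_of_nonpos_of_nonneg (le_of_lt hy) ENNReal.toReal_nonneg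

lemma contDiffAt_integral_expNegMul {Z : Ω → ℝ≥0∞} (hZ : AEMeasurable Z P) {x : ℝ}
    (hx : 0 < x) (n : WithTop ℕ∞) :
    ContDiffAt ℝ n (fun x => ∫ ω, expNegMul x (Z ω) ∂P) x := by
  simp_rw [integral_expNegMul_eq_mgf hZ]
  exact ((analyticAt_mgf (neg_mem_interior_integrableExpSet hZ hx)).contDiffAt).comp x
    contDiffAt_id.neg

lemma iteratedDeriv_integral_expNegMul {Z : Ω → ℝ≥0∞} (hZ : AEMeasurable Z P) {x : ℝ}
    (hx : 0 < x) (k : ℕ) :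
    iteratedDeriv k (fun x => ∫ ω, expNegMul x (Z ω) ∂P) x =
      (-1) ^ k * ∫ ω, (Z ω).toReal ^ k * expNegMul x (Z ω) ∂P := by
  simp_rw [integral_expNegMul_eq_mgf hZ]
  rw [iteratedDeriv_comp_neg, iteratedDeriv_mgf (neg_mem_interior_integrableExpSet hZ hx),
    smul_eq_mul]
  congr 1
  have hs : NullMeasurableSet {ω | Z ω ≠ ∞} P :=
    hZ.nullMeasurable (measurableSet_singleton ∞).compl
  rw [← integral_indicator₀ hs]
  refine integral_congr_ae (ae_of_all _ fun ω => ?_)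
  simp only [expNegMul]
  split_ifs with h
  · rw [indicator_of_notMem (by simpa using h), mul_zero]
  · rw [indicator_of_mem (by simpa using h), neg_mul]

/-- The Poisson probability of `k` at the time `h ∈ [0, ∞]`. -/
def poissonWeight (lam : ℝ) (k : ℕ) (h : ℝ≥0∞) : ℝ :=
  if h = ∞ then 0 else
    Real.exp (-(lam * h.toReal)) * (lam * h.toReal) ^ k / k.factorial

lemma poissonWeight_nonneg {lam : ℝ} (hlam : 0 ≤ lam) (k : ℕ) (h : ℝ≥0∞) :
    0 ≤ poissonWeight lam k h := by
  unfold poissonWeight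
  split_ifs
  · exact le_rfl
  · have := ENNReal.toReal_nonneg (a := h)
    positivity

lemma poissonWeight_le_one {lam : ℝ} (hlam : 0 ≤ lam) (k : ℕ) (h : ℝ≥0∞) :
    poissonWeight lam k h ≤ 1 := by
  unfold poissonWeight
  split_ifs
  · exact zero_le_one
  · have h1 := Real.pow_div_factorial_le_exp (lam * h.toReal)
      (mul_nonneg hlam ENNReal.toReal_nonneg) k
    rw [mul_div_assoc, Real.exp_neg, inv_mul_le_iff₀ (Real.exp_pos _), mul_one]
    exact h1

/-- The Poisson weight e^{-λh}(λh)^k / k! is ((-λ)^k / k!) ∂_λ^k e^{-λh}: the signs from (-λ)^k and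
from the derivative cancel. -/
lemma integral_poissonWeight {Z : Ω → ℝ≥0∞} (hZ : AEMeasurable Z P) {lam : ℝ} (hlam : 0 < lam)
    (k : ℕ) : ∫ ω, poissonWeight lam k (Z ω) ∂P =
      (-lam) ^ k / k.factorial * iteratedDeriv k (fun x => ∫ ω, expNegMul x (Z ω) ∂P) lam := by
  rw [iteratedDeriv_integral_expNegMul hZ hlam, ← mul_assoc, ← integral_const_mul]
  refine integral_congr_ae (ae_of_all _ fun ω => ?_)
  simp only [poissonWeight, expNegMul]
  split_ifs with h
  · simp
  · have : (-lam) ^ k / (k.factorial : ℝ) * (-1) ^ k = lam ^ k / k.factorial := by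
      rw [div_mul_eq_mul_div, ← mul_pow]; simp
    rw [this, mul_pow]
    ring

end LaplaceRandomVariable

/-! ### Derivatives of `e^{-sψ(x)}` in both variables -/

lemma iteratedDeriv_congr_Ioi {F G : ℝ → ℝ} (h : ∀ x, 0 < x → F x = G x) (k : ℕ) {x : ℝ}
    (hx : 0 < x) : iteratedDeriv k F x = iteratedDeriv k G x := by
  have : F =ᶠ[𝓝 x] G := by
    filter_upwards [Ioi_mem_nhds hx] with y hy using h y hy
  exact this.iteratedDeriv_eq k

section

variable {ψ : ℝ → ℝ}

lemma ContDiffOn.exp_neg_mul_Ioi {n : WithTop ℕ∞} (hψ : ContDiffOn ℝ n ψ (Ioi 0)) (s : ℝ) :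
    ContDiffOn ℝ n (fun x => Real.exp (-(s * ψ x))) (Ioi 0) :=
  (contDiffOn_const.mul hψ).neg.exp

lemma ContDiffOn.contDiffAt_natCast {F : ℝ → ℝ}
    (hF : ContDiffOn ℝ ((⊤ : ℕ∞) : WithTop ℕ∞) F (Ioi 0)) (n : ℕ) {x : ℝ} (hx : 0 < x) :
    ContDiffAt ℝ n F x :=
  (hF.contDiffAt (Ioi_mem_nhds hx)).of_le (by exact_mod_cast le_top)

lemma iteratedDeriv_mul_Ioi {F G : ℝ → ℝ}
    (hF : ContDiffOn ℝ ((⊤ : ℕ∞) : WithTop ℕ∞) F (Ioi 0))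
    (hG : ContDiffOn ℝ ((⊤ : ℕ∞) : WithTop ℕ∞) G (Ioi 0)) (k : ℕ) {x : ℝ} (hx : 0 < x) :
    iteratedDeriv k (fun x => F x * G x) x =
      ∑ i ∈ Finset.range (k + 1), (k.choose i : ℝ) * iteratedDeriv i F x *
        iteratedDeriv (k - i) G x :=
  iteratedDeriv_fun_mul (hF.contDiffAt_natCast k hx) (hG.contDiffAt_natCast k hx)

lemma hasDerivAt_exp_neg_mul_comp (hψ : ContDiffOn ℝ ((⊤ : ℕ∞) : WithTop ℕ∞) ψ (Ioi 0))
    (s : ℝ) {y : ℝ} (hy : 0 < y) :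
    HasDerivAt (fun x => Real.exp (-(s * ψ x)))
      (-s * (deriv ψ y * Real.exp (-(s * ψ y)))) y := by
  have h1 := ((hψ.contDiffAt_natCast 1 hy).differentiableAt (by simp)).hasDerivAt
  refine ((h1.const_mul s).fun_neg.exp).congr_deriv ?_
  ring

lemma iteratedDeriv_succ_exp_neg_mul (hψ : ContDiffOn ℝ ((⊤ : ℕ∞) : WithTop ℕ∞) ψ (Ioi 0))
    (s : ℝ) (k : ℕ) {x : ℝ} (hx : 0 < x) :
    iteratedDeriv (k + 1) (fun x => Real.exp (-(s * ψ x))) x =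
      -s * iteratedDeriv k (fun x => deriv ψ x * Real.exp (-(s * ψ x))) x := by
  rw [iteratedDeriv_succ', ← iteratedDeriv_const_mul_field]
  refine iteratedDeriv_congr_Ioi (fun y hy => ?_) k hx
  exact (hasDerivAt_exp_neg_mul_comp hψ s hy).deriv

/-- Exchange of ∂_s with ∂_x^k. Since ∂_x e^{-sψ} = -s ψ' e^{-sψ}, one derivative is spent and
Leibniz's rule calls on all lower orders; hence strong induction. -/
lemma hasDerivAt_iteratedDeriv_exp_neg_mul
    (hψ : ContDiffOn ℝ ((⊤ : ℕ∞) : WithTop ℕ∞) ψ (Ioi 0)) (k : ℕ) {x : ℝ} (hx : 0 < x) (s : ℝ) :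
    HasDerivAt (fun s => iteratedDeriv k (fun x => Real.exp (-(s * ψ x))) x)
      (-iteratedDeriv k (fun x => ψ x * Real.exp (-(s * ψ x))) x) s := by
  have hψ' : ContDiffOn ℝ ((⊤ : ℕ∞) : WithTop ℕ∞) (deriv ψ) (Ioi 0) :=
    hψ.deriv_of_isOpen isOpen_Ioi (by simp)
  have hE := hψ.exp_neg_mul_Ioi
  have hψE : ContDiffOn ℝ ((⊤ : ℕ∞) : WithTop ℕ∞) (fun x => ψ x * Real.exp (-(s * ψ x)))
    (Ioi 0) := hψ.mul (hE s)
  induction k using Nat.strong_induction_on with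
  | _ k ih =>
    cases k with
    | zero =>
      simp only [iteratedDeriv_zero]
      refine (((hasDerivAt_id' s).mul_const (ψ x)).fun_neg.exp).congr_deriv ?_
      ring
    | succ k =>
      simp_rw [fun s => iteratedDeriv_succ_exp_neg_mul hψ s k hx]
      have h1 : HasDerivAt
          (fun s => iteratedDeriv k (fun x => deriv ψ x * Real.exp (-(s * ψ x))) x)
          (-iteratedDeriv k (fun x => deriv ψ x * (ψ x * Real.exp (-(s * ψ x)))) x) s := by
        simp_rw [fun s => iteratedDeriv_mul_Ioi hψ' (hE s) k hx]
        rw [iteratedDeriv_mul_Ioi hψ' hψE k hx, ← Finset.sum_neg_distrib]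
        refine HasDerivAt.fun_sum fun i _ => ?_
        rw [← mul_neg]
        exact (ih (k - i) (by omega)).const_mul _
      have h2 := (hasDerivAt_neg s).mul h1
      refine h2.congr_deriv ?_
      rw [iteratedDeriv_succ', iteratedDeriv_congr_Ioi (F :=
        deriv fun x => ψ x * Real.exp (-(s * ψ x))) (G := fun x =>
        deriv ψ x * Real.exp (-(s * ψ x)) + -s * (deriv ψ x * (ψ x * Real.exp (-(s * ψ x)))))
        (fun y hy => ?_) k hx, iteratedDeriv_fun_add, iteratedDeriv_const_mul_field]
      · ring
      · exact (hψ'.mul (hE s)).contDiffAt_natCast k hx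
      · exact (contDiffOn_const.mul (hψ'.mul hψE)).contDiffAt_natCast k hx
      · have h3 := ((hψ.contDiffAt_natCast 1 hy).differentiableAt (by simp)).hasDerivAt
        rw [(h3.fun_mul (hasDerivAt_exp_neg_mul_comp hψ s hy)).deriv]
        ring

lemma backshift_iterate (p : ℕ → ℝ) {m k : ℕ} (h : m ≤ k) : backshift^[m] p k = p (k - m) := by
  induction m generalizing p k with
  | zero => rfl
  | succ m ih =>
    rw [Function.iterate_succ_apply, ih _ (by omega), show k - m = (k - (m + 1)) + 1 by omega]
    rfl

lemma shiftOperator_eq (ψ : ℝ → ℝ) (lam : ℝ) (p : ℕ → ℝ) (k : ℕ) :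
    shiftOperator ψ lam p k = ∑ m ∈ Finset.range (k + 1),
      iteratedDeriv m ψ lam * ((-lam) ^ m / (m.factorial : ℝ)) * p (k - m) :=
  Finset.sum_congr rfl fun m hm => by
    rw [backshift_iterate p (Nat.lt_succ_iff.1 (Finset.mem_range.1 hm))]

/-- Summing over the target index j = k - m gives the matrix form expected by `hasCaputo_integral`.
-/
lemma shiftOperator_eq_reflect (ψ : ℝ → ℝ) (lam : ℝ) (p : ℕ → ℝ) (k : ℕ) :
    shiftOperator ψ lam p k = ∑ j ∈ Finset.range (k + 1),
      iteratedDeriv (k - j) ψ lam * ((-lam) ^ (k - j) / ((k - j).factorial : ℝ)) * p j := by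
  rw [shiftOperator_eq, ← Finset.sum_range_reflect]
  refine Finset.sum_congr rfl fun j hj => ?_
  have hj' : j ≤ k := Nat.lt_succ_iff.1 (Finset.mem_range.1 hj)
  rw [show k + 1 - 1 - j = k - j by omega, Nat.sub_sub_self hj']

/-- The probability of `k` points in `[0, H(s)]` for a Poisson process of intensity `lam` and an
independent subordinator `H` with Laplace exponent `ψ`. -/
def subordinatedWeight (ψ : ℝ → ℝ) (lam : ℝ) (k : ℕ) (s : ℝ) : ℝ :=
  (-lam) ^ k / (k.factorial : ℝ) * iteratedDeriv k (fun x => Real.exp (-(s * ψ x))) lam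

/-- Leibniz's rule for ∂_λ^k (ψ e^{-sψ}), where the binomial coefficients are absorbed by the
factorials. These are the forward equations of N(H(s)), before the inverse time change. -/
lemma hasDerivAt_subordinatedWeight (hψ : ContDiffOn ℝ ((⊤ : ℕ∞) : WithTop ℕ∞) ψ (Ioi 0))
    {lam : ℝ} (hlam : 0 < lam) (k : ℕ) (s : ℝ) :
    HasDerivAt (subordinatedWeight ψ lam k)
      (-shiftOperator ψ lam (fun j => subordinatedWeight ψ lam j s) k) s := by
  refine ((hasDerivAt_iteratedDeriv_exp_neg_mul hψ k hlam s).const_mul _).congr_deriv ?_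
  rw [iteratedDeriv_mul_Ioi hψ (hψ.exp_neg_mul_Ioi s) k hlam, shiftOperator_eq, mul_neg,
    Finset.mul_sum]
  congr 1
  refine Finset.sum_congr rfl fun i hi => ?_
  have hi' : i ≤ k := Nat.lt_succ_iff.1 (Finset.mem_range.1 hi)
  rw [subordinatedWeight, Nat.cast_choose ℝ hi', ← pow_mul_pow_sub (-lam) hi']
  have h1 : (k.factorial : ℝ) ≠ 0 := by positivity
  field_simp

lemma subordinatedWeight_zero (ψ : ℝ → ℝ) (lam : ℝ) (k : ℕ) :
    subordinatedWeight ψ lam k 0 = if k = 0 then 1 else 0 := by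
  cases k with
  | zero => simp [subordinatedWeight]
  | succ k => simp [subordinatedWeight, iteratedDeriv_const]

end

/-! ### Subordinators and their inverses -/

lemma expNegMul_nonneg (x : ℝ) (h : ℝ≥0∞) : 0 ≤ expNegMul x h := by
  unfold expNegMul
  split_ifs
  exacts [le_rfl, (Real.exp_pos _).le]

lemma expNegMul_le_one {x : ℝ} (hx : 0 ≤ x) (h : ℝ≥0∞) : expNegMul x h ≤ 1 := by
  unfold expNegMul
  split_ifs
  · exact zero_le_one
  · rw [Real.exp_le_one_iff, neg_nonpos]
    exact mul_nonneg hx ENNReal.toReal_nonneg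

lemma measurable_expNegMul (x : ℝ) : Measurable (expNegMul x) := by
  unfold expNegMul
  exact Measurable.ite (measurableSet_singleton ∞) measurable_const (by fun_prop)

lemma lt_of_lt_inverseProc {Ω : Type*} {H : ℝ≥0 → Ω → ℝ≥0∞} {s t : ℝ≥0} {ω : Ω}
    (h : s < inverseProc H t ω) : H s ω ≤ t :=
  not_lt.1 fun hlt => notMem_of_lt_csInf h (OrderBot.bddBelow _) hlt

namespace IsSubordinator

variable {Ω : Type*} [MeasurableSpace Ω] {P : Measure Ω} {H : ℝ≥0 → Ω → ℝ≥0∞} {f : BernsteinData}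

/-- The restriction to finite values of the law of `H(s)`. -/
def finiteLaw (P : Measure Ω) (H : ℝ≥0 → Ω → ℝ≥0∞) (s : ℝ) : Measure ℝ :=
  (P.restrict {ω | H s.toNNReal ω ≠ ∞}).map fun ω => (H s.toNNReal ω).toReal

lemma measurableSet_ne_top (hH : IsSubordinator H f P) (s : ℝ≥0) :
    MeasurableSet {ω | H s ω ≠ ∞} :=
  hH.measurable s (measurableSet_singleton ∞).compl

lemma finiteLaw_apply (hH : IsSubordinator H f P) (s : ℝ) {B : Set ℝ} (hB : MeasurableSet B) :
    finiteLaw P H s B = P {ω | (H s.toNNReal ω).toReal ∈ B ∧ H s.toNNReal ω ≠ ∞} := by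
  rw [finiteLaw, Measure.map_apply (hH.measurable _).ennreal_toReal hB,
    Measure.restrict_apply ((hH.measurable _).ennreal_toReal hB)]
  rfl

/-- Bounded continuous functionals of a subordinator, extended by `0` to the cemetery, have
right-continuous paths. -/
lemma rightCont_comp (hH : IsSubordinator H f P) {g : ℝ → ℝ} (hg : Continuous g) :
    ∀ᵐ ω ∂P, ∀ t, ContinuousWithinAt
      (fun r => if H r ω = ∞ then 0 else g (H r ω).toReal) (Ici t) t := by
  filter_upwards [hH.mono, hH.rightCont] with ω hmono hrc t
  by_cases h : H t ω = ∞
  · refine (continuousWithinAt_const (b := (0 : ℝ))).congr (fun r hr => ?_) (if_pos h)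
    exact if_pos (top_le_iff.1 (h ▸ hmono hr))
  · have h1 : ∀ᶠ r in 𝓝[≥] t, H r ω ≠ ∞ :=
      (hrc t).tendsto.eventually (isOpen_ne.mem_nhds h)
    have h2 : ContinuousWithinAt (fun r => g (H r ω).toReal) (Ici t) t :=
      (hg.tendsto _).comp ((ENNReal.tendsto_toReal h).comp (hrc t))
    refine h2.congr_of_eventuallyEq ?_ (if_neg h)
    filter_upwards [h1] with r hr using if_neg hr

variable [IsProbabilityMeasure P]

lemma integrable_expNegMul (hH : IsSubordinator H f P) (t : ℝ≥0) {x : ℝ} (hx : 0 ≤ x) :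
    Integrable (fun ω => expNegMul x (H t ω)) P := by
  refine Integrable.of_bound (C := 1)
    ((measurable_expNegMul x).comp (hH.measurable t)).aestronglyMeasurable (ae_of_all _ fun ω => ?_)
  rw [Real.norm_of_nonneg (expNegMul_nonneg _ _)]
  exact expNegMul_le_one hx _

/-- Since f(x) = -log E e^{-xH(1)}, smoothness is inherited from a positive Laplace transform,
without differentiating the Lévy integral. -/
lemma contDiffOn_eval (hH : IsSubordinator H f P) (n : WithTop ℕ∞) :
    ContDiffOn ℝ n f.eval (Ioi 0) := by
  have h1 : ∀ x ∈ Ioi (0 : ℝ), f.eval x = -Real.log (∫ ω, expNegMul x (H 1 ω) ∂P) := by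
    intro x hx
    rw [hH.laplace 1 x hx, Real.log_exp]
    simp
  refine ContDiffOn.congr (fun x hx => ?_) h1
  have hx' : 0 < x := hx
  refine ((contDiffAt_integral_expNegMul (hH.measurable 1).aemeasurable hx' n).log ?_).neg
    |>.contDiffWithinAt
  rw [hH.laplace 1 x hx]
  exact (Real.exp_pos _).ne'

/-- From P(H(n) ≤ m) e^{-m} ≤ e^{-n f(1)}, paths are almost surely unbounded. Hence the infimum
defining the inverse is almost surely not the default value 0 of an empty set. -/
lemma ae_exists_lt (hH : IsSubordinator H f P) (hf : 0 < f.eval 1) :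
    ∀ᵐ ω ∂P, ∀ t : ℝ≥0, {s | (t : ℝ≥0∞) < H s ω}.Nonempty := by
  have key : ∀ m : ℕ, ∀ᵐ ω ∂P, ∃ n : ℕ, (m : ℝ≥0∞) < H n ω := by
    intro m
    have hbound : ∀ n : ℕ, P.real {ω | ∀ n : ℕ, H n ω ≤ m} * Real.exp (-(m : ℝ)) ≤
        Real.exp (-f.eval 1) ^ n := by
      intro n
      have hms : MeasurableSet {ω | H n ω ≤ m} := measurableSet_le (hH.measurable _) measurable_const
      have h1 : P.real {ω | ∀ n : ℕ, H n ω ≤ m} ≤ P.real {ω | H n ω ≤ m} :=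
        measureReal_mono fun ω hω => hω n
      have h2 : P.real {ω | H n ω ≤ m} * Real.exp (-(m : ℝ)) ≤
          ∫ ω, expNegMul 1 (H n ω) ∂P := by
        rw [← smul_eq_mul, ← integral_indicator_const _ hms]
        refine integral_mono ((integrable_const _).indicator hms)
          (hH.integrable_expNegMul n zero_le_one) fun ω => ?_
        by_cases h : H n ω ≤ m
        · simp only [indicator_of_mem (show ω ∈ {ω | H n ω ≤ m} from h)]
          have hne : H n ω ≠ ∞ := ne_top_of_le_ne_top (ENNReal.natCast_ne_top m) h
          rw [expNegMul, if_neg hne, one_mul]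
          have := ENNReal.toReal_mono (ENNReal.natCast_ne_top m) h
          gcongr
          simpa using this
        · simp only [indicator_of_notMem (show ω ∉ {ω | H n ω ≤ m} from h)]
          exact expNegMul_nonneg _ _
      rw [hH.laplace _ 1 one_pos] at h2
      refine ((mul_le_mul_of_nonneg_right h1 (Real.exp_pos _).le).trans h2).trans_eq ?_
      rw [← Real.exp_nat_mul]
      congr 1
      push_cast
      ring
    have hlim : Tendsto (fun n : ℕ => Real.exp (-f.eval 1) ^ n) atTop (𝓝 0) :=
      tendsto_pow_atTop_nhds_zero_of_lt_one (Real.exp_pos _).le (by simpa using hf)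
    have h0 := ge_of_tendsto' hlim hbound
    have h3 : P.real {ω | ∀ n : ℕ, H n ω ≤ m} = 0 :=
      le_antisymm (nonpos_of_mul_nonpos_left h0 (Real.exp_pos _)) measureReal_nonneg
    rw [measureReal_eq_zero_iff] at h3
    rw [ae_iff]
    simpa only [not_exists, not_lt] using h3
  filter_upwards [ae_all_iff.2 key] with ω hω t
  obtain ⟨m, hm⟩ := exists_nat_ge t
  obtain ⟨n, hn⟩ := hω m
  exact ⟨n, lt_of_le_of_lt (by exact_mod_cast hm) hn⟩

/-- Monotone paths allow the infimum to run over rational times, where it is countable; negative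
rationals are sent to time 0 and do no harm. -/
lemma aemeasurable_inverseProc (hH : IsSubordinator H f P) (hf : 0 < f.eval 1) (t : ℝ≥0) :
    AEMeasurable (inverseProc H t) P := by
  refine ⟨fun ω => (⨅ q : ℚ, if (t : ℝ≥0∞) < H (q : ℝ).toNNReal ω then
    ((q : ℝ).toNNReal : ℝ≥0∞) else ∞).toNNReal, ?_, ?_⟩
  · refine (Measurable.iInf fun q => Measurable.ite ?_ measurable_const measurable_const).ennreal_toNNReal
    exact measurableSet_lt measurable_const (hH.measurable _)
  · filter_upwards [hH.mono, hH.ae_exists_lt hf] with ω hmono hne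
    have : (⨅ q : ℚ, if (t : ℝ≥0∞) < H (q : ℝ).toNNReal ω then
        ((q : ℝ).toNNReal : ℝ≥0∞) else ∞) = inverseProc H t ω := by
      refine le_antisymm (le_of_forall_gt fun b hb => ?_) (le_iInf fun q => ?_)
      · obtain ⟨c, hc1, hc2⟩ := ENNReal.lt_iff_exists_nnreal_btwn.1 hb
        rw [ENNReal.coe_lt_coe] at hc1
        obtain ⟨s, hs1, hs2⟩ := exists_lt_of_csInf_lt (hne t) hc1
        obtain ⟨q, hq1, hq2⟩ := exists_rat_btwn (NNReal.coe_lt_coe.2 hs2)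
        have hsq : s ≤ (q : ℝ).toNNReal := NNReal.le_toNNReal_of_coe_le hq1.le
        refine (iInf_le _ q).trans_lt ?_
        rw [if_pos (lt_of_lt_of_le hs1 (hmono hsq))]
        refine lt_of_le_of_lt ?_ hc2
        rw [ENNReal.coe_le_coe]
        exact Real.toNNReal_le_iff_le_coe.2 hq2.le
      · split_ifs with h
        · exact ENNReal.coe_le_coe.2 (csInf_le (OrderBot.bddBelow _) h)
        · exact le_top
    rw [this, ENNReal.toNNReal_coe]

/-- {Y(t) > s} ⊆ {H(s) ≤ t} follows from the definition of the infimum; {H(s) ≤ t} ⊆ {Y(t) ≥ s}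
holds almost surely, as paths are monotone and unbounded. -/
lemma inversePair (hH : IsSubordinator H f P) (hf : f.ConditionI) :
    InversePair f (finiteLaw P H) (lawAt P (inverseProc H)) := by
  have hf1 : 0 < f.eval 1 := hf.eval_pos one_pos
  have hY : ∀ t : ℝ, AEMeasurable (fun ω => (inverseProc H t.toNNReal ω : ℝ)) P := fun t =>
    (hH.aemeasurable_inverseProc hf1 _).coe_nnreal_real
  have hlaw : ∀ t : ℝ, ∀ {B : Set ℝ}, MeasurableSet B →
      lawAt P (inverseProc H) t B = P {ω | (inverseProc H t.toNNReal ω : ℝ) ∈ B} :=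
    fun t B hB => Measure.map_apply_of_aemeasurable (hY t) hB
  refine ⟨fun s => ?_, fun s => ?_, fun s hs x hx => ?_, fun t s s' hss => ?_, fun t => ?_,
    fun t => ?_, fun s t t' htt => ?_, fun s t hs ht => ?_, fun s t hs ht => ?_⟩
  · rw [hH.finiteLaw_apply s .univ]
    exact prob_le_one
  · rw [ae_iff, hH.finiteLaw_apply s (by measurability)]
    convert measure_empty (μ := P)
    ext ω
    simp
  · rw [laplaceTransform, finiteLaw, lintegral_map (measurable_ofReal_exp_neg_mul x)
      (hH.measurable _).ennreal_toReal, ← lintegral_indicator (hH.measurableSet_ne_top _)]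
    have h1 := hH.laplace s.toNNReal x hx
    rw [Real.coe_toNNReal s hs] at h1
    rw [← h1, ofReal_integral_eq_lintegral_ofReal (hH.integrable_expNegMul _ hx.le)
      (ae_of_all _ fun ω => expNegMul_nonneg _ _)]
    refine lintegral_congr fun ω => ?_
    by_cases h : H s.toNNReal ω = ∞
    · simp [expNegMul, h]
    · rw [indicator_of_mem (by exact h), expNegMul, if_neg h]
  · simp only
    rw [hH.finiteLaw_apply _ measurableSet_Iic, hH.finiteLaw_apply _ measurableSet_Iic]
    refine measure_mono_ae ?_
    filter_upwards [hH.mono] with ω hω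
    rintro ⟨h1, h2⟩
    have h3 := hω (Real.toNNReal_le_toNNReal hss)
    exact ⟨(ENNReal.toReal_mono h2 h3).trans h1, ne_top_of_le_ne_top h2 h3⟩
  · exact Measure.isProbabilityMeasure_map (hY t)
  · rw [ae_iff, hlaw t (by measurability)]
    convert measure_empty (μ := P)
    ext ω
    simp
  · simp only
    rw [hlaw _ measurableSet_Ioi, hlaw _ measurableSet_Ioi]
    refine measure_mono_ae ?_
    filter_upwards [hH.ae_exists_lt hf1] with ω hω
    intro h1
    refine lt_of_lt_of_le (show s < _ from h1) (NNReal.coe_le_coe.2 ?_)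
    exact csInf_le_csInf (OrderBot.bddBelow _) (hω _) fun r hr =>
      lt_of_le_of_lt (ENNReal.coe_le_coe.2 (Real.toNNReal_le_toNNReal htt)) hr
  · rw [hlaw _ measurableSet_Ioi, hH.finiteLaw_apply _ measurableSet_Iic]
    refine measure_mono fun ω hω => ?_
    have h1 : H s.toNNReal ω ≤ t.toNNReal :=
      lt_of_lt_inverseProc ((Real.toNNReal_lt_iff_lt_coe hs).2 hω)
    refine ⟨?_, ne_top_of_le_ne_top ENNReal.coe_ne_top h1⟩
    have := ENNReal.toReal_mono ENNReal.coe_ne_top h1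
    simpa [ht] using this
  · rw [hlaw _ measurableSet_Ici, hH.finiteLaw_apply _ measurableSet_Iic]
    refine measure_mono_ae ?_
    filter_upwards [hH.mono, hH.ae_exists_lt hf1] with ω hmono hω
    rintro ⟨h1, h2⟩
    refine Real.toNNReal_le_iff_le_coe.1 (le_csInf (hω _) fun r hr => ?_)
    by_contra! hlt
    have h3 : (t.toNNReal : ℝ≥0∞) < H s.toNNReal ω := lt_of_lt_of_le hr (hmono hlt.le)
    have h4 := (ENNReal.toReal_lt_toReal ENNReal.coe_ne_top h2).2 h3
    simp only [ENNReal.coe_toReal, Real.coe_toNNReal t ht] at h4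
    exact absurd h1 (not_le.2 h4)

end IsSubordinator

/-! ### The Poisson process at an independent random time -/

namespace IsPoissonProc

variable {Ω : Type*} [MeasurableSpace Ω] {P : Measure Ω} {N : ℝ≥0 → Ω → ℕ} {lam : ℝ≥0}

lemma map_eq (hN : IsPoissonProc N lam P) (r : ℝ≥0) : P.map (N r) = poissonMeasure (lam * r) := by
  have h := hN.law 0 r zero_le
  rw [tsub_zero] at h
  rw [← h]
  refine Measure.map_congr ?_
  filter_upwards [hN.zero] with ω hω
  simp [hω]

lemma integral_comp (hN : IsPoissonProc N lam P) (r : ℝ≥0) (φ : ℕ → ℝ) :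
    ∫ ω, φ (N r ω) ∂P = ∫ n, φ n ∂poissonMeasure (lam * r) := by
  rw [← hN.map_eq, integral_map (hN.measurable r).aemeasurable
    measurable_from_nat.aestronglyMeasurable]

lemma integral_eq_indicator (hN : IsPoissonProc N lam P) (r : ℝ≥0) (k : ℕ) :
    ∫ ω, (if N r ω = k then (1 : ℝ) else 0) ∂P = poissonWeight lam k r := by
  rw [hN.integral_comp r fun n => if n = k then (1 : ℝ) else 0]
  have h1 : (fun n => if n = k then (1 : ℝ) else 0) = ({k} : Set ℕ).indicator fun _ => (1 : ℝ) := by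
    ext n
    simp [indicator_apply]
  rw [h1, integral_indicator_const _ (measurableSet_singleton k), poissonMeasure_real_singleton,
    poissonWeight, if_neg ENNReal.coe_ne_top]
  simp

lemma integral_pow (hN : IsPoissonProc N lam P) (r : ℝ≥0) (u : ℝ) :
    ∫ ω, u ^ N r ω ∂P = Real.exp (-(lam * (1 - u) * r)) := by
  rw [hN.integral_comp r fun n => u ^ n, integral_poissonMeasure]
  have h1 := (NormedSpace.expSeries_div_hasSum_exp ((lam * r : ℝ≥0) * u : ℝ)).mul_left
    (Real.exp (-(lam * r : ℝ≥0)))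
  rw [← Real.exp_eq_exp_ℝ, ← Real.exp_add] at h1
  have h2 : (fun n : ℕ => (Real.exp (-(lam * r : ℝ≥0)) * ((lam * r : ℝ≥0) : ℝ) ^ n / n.factorial) •
      u ^ n) = fun n : ℕ =>
      Real.exp (-(lam * r : ℝ≥0)) * ((((lam * r : ℝ≥0) : ℝ) * u) ^ n / n.factorial) := by
    ext n
    rw [smul_eq_mul, mul_pow]
    ring
  rw [h2, h1.tsum_eq]
  congr 1
  push_cast
  ring

variable [IsProbabilityMeasure P]

lemma integral_randomTime (hN : IsPoissonProc N lam P) {Z : Ω → ℝ≥0∞} (hZ : AEMeasurable Z P)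
    (hind : IndepFun (fun ω t => N t ω) Z P) {φ : ℕ → ℝ} (hb : ∀ n, |φ n| ≤ 1) {k : ℝ≥0 → ℝ}
    (hk : ∀ r, ∫ ω, φ (N r ω) ∂P = k r) (hkc : Continuous k) :
    AEStronglyMeasurable (fun ω => if Z ω = ∞ then 0 else φ (N (Z ω).toNNReal ω)) P ∧
    ∫ ω, (if Z ω = ∞ then 0 else φ (N (Z ω).toNNReal ω)) ∂P =
      ∫ ω, (if Z ω = ∞ then 0 else k (Z ω).toNNReal) ∂P := by
  refine _root_.integral_randomTime hN.measurable hZ hind measurable_from_nat hb ?_ hk hkc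
  filter_upwards [hN.rightCont] with ω hω t
  exact (continuous_of_discreteTopology (f := φ)).continuousAt.comp_continuousWithinAt (hω t)

lemma measureReal_countAt_eq (hN : IsPoissonProc N lam P) {Z : Ω → ℝ≥0∞} (hZ : AEMeasurable Z P)
    (hind : IndepFun (fun ω t => N t ω) Z P) (k : ℕ) :
    P.real {ω | countAt N (Z ω) ω = k} = ∫ ω, poissonWeight lam k (Z ω) ∂P := by
  have hkc : Continuous fun r : ℝ≥0 => poissonWeight lam k r := by
    simp only [poissonWeight, ENNReal.coe_ne_top, if_false, ENNReal.coe_toReal]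
    fun_prop
  obtain ⟨h1, h2⟩ := hN.integral_randomTime hZ hind (φ := fun n => if n = k then 1 else 0)
    (fun n => by split_ifs <;> simp) (fun r => hN.integral_eq_indicator r k) hkc
  have h3 : (fun ω => if Z ω = ∞ then (0 : ℝ) else if N (Z ω).toNNReal ω = k then 1 else 0) =
      {ω | countAt N (Z ω) ω = k}.indicator fun _ => 1 := by
    ext ω
    by_cases h : Z ω = ∞
    · simp [countAt, h]
    · simp [indicator_apply, countAt, h]
  have h4 : {ω | countAt N (Z ω) ω = k} =
      (fun ω => if Z ω = ∞ then (0 : ℝ) else if N (Z ω).toNNReal ω = k then 1 else 0) ⁻¹' {1} := by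
    rw [h3]
    ext ω
    simp [indicator_apply]
  -- The event involves a random time that is only almost everywhere measurable; it is null
  -- measurable as a level set of the function treated by `integral_randomTime`.
  have h5 : NullMeasurableSet {ω | countAt N (Z ω) ω = k} P := by
    rw [h4]
    exact h1.aemeasurable.nullMeasurable (measurableSet_singleton 1)
  rw [h3, integral_indicator₀ h5, setIntegral_const, smul_eq_mul, mul_one] at h2
  rw [h2]
  refine integral_congr_ae (ae_of_all _ fun ω => ?_)
  simp only
  split_ifs with h
  · simp [poissonWeight, h]
  · rw [ENNReal.coe_toNNReal h]

lemma integral_powENat_countAt (hN : IsPoissonProc N lam P) {Z : Ω → ℝ≥0∞}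
    (hZ : AEMeasurable Z P) (hind : IndepFun (fun ω t => N t ω) Z P) {u : ℝ} (hu : |u| < 1) :
    ∫ ω, powENat u (countAt N (Z ω) ω) ∂P = ∫ ω, expNegMul (lam * (1 - u)) (Z ω) ∂P := by
  obtain ⟨-, h2⟩ := hN.integral_randomTime hZ hind (φ := fun n => u ^ n)
    (fun n => by rw [abs_pow]; exact pow_le_one₀ (abs_nonneg u) hu.le)
    (fun r => hN.integral_pow r u) (by fun_prop)
  convert h2 using 2
  · ext ω
    by_cases h : Z ω = ∞
    · simp [powENat, countAt, h]
    · simp [powENat, countAt, h]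
  · ext ω
    rfl

end IsPoissonProc

/-! ### A subordinator at an independent random time -/

section TimeChange

variable {Ω : Type*} [MeasurableSpace Ω] {P : Measure Ω} {H : ℝ≥0 → Ω → ℝ≥0∞} {T : Ω → ℝ≥0}

lemma IsSubordinator.aemeasurable_randomTime {ψ : BernsteinData} (hH : IsSubordinator H ψ P)
    (hT : AEMeasurable T P) : AEMeasurable (fun ω => H (T ω) ω) P := by
  obtain ⟨G, hG, hG'⟩ := exists_measurable_randomTime (T := T) hH.rightCont
  exact (hG.comp_aemeasurable
    ((measurable_pi_lambda _ hH.measurable).aemeasurable.prodMk hT)).congr hG'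

lemma IsSubordinator.indepFun_randomTime {E : Type*} [MeasurableSpace E] {ψ : BernsteinData}
    (hH : IsSubordinator H ψ P) {N : Ω → E}
    (hind : IndepFun N (fun ω => ((fun t => H t ω), T ω)) P) :
    IndepFun N (fun ω => H (T ω) ω) P := by
  obtain ⟨G, hG, hG'⟩ := exists_measurable_randomTime (T := T) hH.rightCont
  exact (hind.comp measurable_id hG).congr (ae_eq_refl _) hG'

variable [IsProbabilityMeasure P]

/-- Two infinities are kept apart: the time T is finite, while H(T) may lie in the cemetery, where
the functional is 0. -/
lemma IsSubordinator.integral_randomTime {ψ : BernsteinData} (hH : IsSubordinator H ψ P)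
    (hT : AEMeasurable T P) (hind : IndepFun (fun ω t => H t ω) T P) {g : ℝ → ℝ}
    (hg : Continuous g) (hb : ∀ r, 0 ≤ r → |g r| ≤ 1) {k : ℝ → ℝ}
    (hk : ∀ r : ℝ≥0, ∫ ω, (if H r ω = ∞ then 0 else g (H r ω).toReal) ∂P = k r)
    (hkc : Continuous k) :
    ∫ ω, (if H (T ω) ω = ∞ then 0 else g (H (T ω) ω).toReal) ∂P =
      ∫ s, k s ∂P.map fun ω => (T ω : ℝ) := by
  have h1 := (_root_.integral_randomTime (T := fun ω => (T ω : ℝ≥0∞)) hH.measurable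
    hT.coe_nnreal_ennreal (hind.comp measurable_id measurable_coe_nnreal_ennreal)
    (φ := fun h => if h = ∞ then 0 else g h.toReal)
    (Measurable.ite (measurableSet_singleton ∞) measurable_const
      (hg.measurable.comp ENNReal.measurable_toReal))
    (fun e => by
      split_ifs
      · simp
      · exact hb _ ENNReal.toReal_nonneg)
    (hH.rightCont_comp hg) hk (by fun_prop)).2
  simp only [ENNReal.coe_ne_top, if_false, ENNReal.toNNReal_coe] at h1
  rw [integral_map hT.coe_nnreal_real hkc.aestronglyMeasurable]
  convert h1
  split_ifs with h <;> simp [h]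

lemma IsSubordinator.integral_expNegMul_randomTime {ψ : BernsteinData}
    (hH : IsSubordinator H ψ P) (hT : AEMeasurable T P)
    (hind : IndepFun (fun ω t => H t ω) T P) {x : ℝ} (hx : 0 < x) :
    ∫ ω, expNegMul x (H (T ω) ω) ∂P =
      ∫ s, Real.exp (-(s * ψ.eval x)) ∂P.map fun ω => (T ω : ℝ) := by
  unfold expNegMul
  refine hH.integral_randomTime hT hind (g := fun r => Real.exp (-(x * r))) (by fun_prop)
    (fun r hr => ?_) (fun r => hH.laplace r x hx) (by fun_prop)
  rw [abs_of_pos (Real.exp_pos _), Real.exp_le_one_iff, neg_nonpos]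
  exact mul_nonneg hx.le hr

lemma IsSubordinator.integral_poissonWeight_eq {ψ : BernsteinData} (hH : IsSubordinator H ψ P)
    {lam : ℝ} (hlam : 0 < lam) (k : ℕ) (r : ℝ≥0) :
    ∫ ω, poissonWeight lam k (H r ω) ∂P = subordinatedWeight ψ.eval lam k r := by
  rw [integral_poissonWeight (hH.measurable r).aemeasurable hlam, subordinatedWeight]
  congr 1
  exact iteratedDeriv_congr_Ioi (fun x hx => hH.laplace r x hx) k hlam

/-- An expectation of Poisson probabilities lies in [0, 1], a bound not visible from the iterated
derivative but required by `hasCaputo_integral`. -/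
lemma IsSubordinator.subordinatedWeight_mem_Icc {ψ : BernsteinData} (hH : IsSubordinator H ψ P)
    {lam : ℝ} (hlam : 0 < lam) (k : ℕ) {s : ℝ} (hs : 0 ≤ s) :
    subordinatedWeight ψ.eval lam k s ∈ Icc (0 : ℝ) 1 := by
  have h1 := hH.integral_poissonWeight_eq hlam k s.toNNReal
  rw [Real.coe_toNNReal s hs] at h1
  rw [← h1]
  refine ⟨integral_nonneg fun ω => poissonWeight_nonneg hlam.le _ _, ?_⟩
  refine (integral_mono_of_nonneg (ae_of_all _ fun ω => poissonWeight_nonneg hlam.le _ _)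
    (integrable_const 1) (ae_of_all _ fun ω => poissonWeight_le_one hlam.le _ _)).trans ?_
  simp

lemma IsSubordinator.integral_poissonWeight_randomTime {ψ : BernsteinData}
    (hH : IsSubordinator H ψ P) (hT : AEMeasurable T P)
    (hind : IndepFun (fun ω t => H t ω) T P) {lam : ℝ} (hlam : 0 < lam) (k : ℕ) :
    ∫ ω, poissonWeight lam k (H (T ω) ω) ∂P =
      ∫ s, subordinatedWeight ψ.eval lam k s ∂P.map fun ω => (T ω : ℝ) := by
  have hkc : Continuous (subordinatedWeight ψ.eval lam k) :=
    continuous_iff_continuousAt.2 fun s =>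
      (hasDerivAt_subordinatedWeight (hH.contDiffOn_eval _) hlam k s).continuousAt
  have hk := hH.integral_poissonWeight_eq hlam k
  unfold poissonWeight at hk ⊢
  refine hH.integral_randomTime hT hind
    (g := fun r => Real.exp (-(lam * r)) * (lam * r) ^ k / k.factorial) (by fun_prop)
    (fun r hr => ?_) hk hkc
  have h1 := poissonWeight_nonneg hlam.le k (ENNReal.ofReal r)
  have h2 := poissonWeight_le_one hlam.le k (ENNReal.ofReal r)
  rw [poissonWeight, if_neg ENNReal.ofReal_ne_top, ENNReal.toReal_ofReal hr] at h1 h2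
  exact abs_le.2 ⟨by linarith, h2⟩

end TimeChange

/-- The Laplace transform of the density of `Y(t)` is that of its law. -/
lemma densityLaplace_eq_integral {Ω : Type*} [MeasurableSpace Ω] {P : Measure Ω}
    [IsProbabilityMeasure P] {Y : ℝ≥0 → Ω → ℝ≥0} {t : ℝ} (hac : lawAt P Y t ≪ volume)
    (hpos : ∀ᵐ s ∂lawAt P Y t, 0 < s) (η : ℝ) :
    densityLaplace P Y t η = ∫ s, Real.exp (-(s * η)) ∂lawAt P Y t := by
  have hfin : IsFiniteMeasure (lawAt P Y t) := by unfold lawAt; infer_instance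
  have h1 := setIntegral_rnDeriv_smul hac (f := fun s => Real.exp (-(s * η)))
    (measurableSet_Ioi (a := (0 : ℝ)))
  rw [Measure.restrict_eq_self_of_ae_mem (s := Ioi (0 : ℝ)) hpos] at h1
  rw [← h1, densityLaplace]
  refine integral_congr_ae (ae_of_all _ fun s => ?_)
  simp only [density, smul_eq_mul]
  rw [mul_comm, mul_comm s]

end

/-! ### Assembly of the three claims -/

theorem mainTheorem2 {Ω : Type*} [MeasurableSpace Ω] (P : Measure Ω) [IsProbabilityMeasure P]
    (f ψ : BernsteinData) (hf : f.ConditionI)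
    (lam : ℝ≥0) (hlam : 0 < lam)
    (N : ℝ≥0 → Ω → ℕ) (hN : IsPoissonProc N lam P)
    (Hψ : ℝ≥0 → Ω → ℝ≥0∞) (hHψ : IsSubordinator Hψ ψ P)
    (Hf : ℝ≥0 → Ω → ℝ≥0∞) (hHf : IsSubordinator Hf f P)
    (Y : ℝ≥0 → Ω → ℝ≥0) (hY : Y = inverseProc Hf)
    (hindep₁ : IndepFun (fun ω t => Hψ t ω) (fun ω t => Y t ω) P)
    (hindep₂ : IndepFun (fun ω t => N t ω)
      (fun ω => ((fun t => Hψ t ω), (fun t => Y t ω))) P)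
    (X : ℝ≥0 → Ω → ℕ∞) (hX : X = timeChanged N Hψ Y) :
    -- the inverse subordinator has a density, whose Laplace transform gives the probabilities
    (∀ t : ℝ, 0 < t →
      lawAt P Y t ≪ volume ∧
      ContDiffOn ℝ ((⊤ : ℕ∞) : WithTop ℕ∞) (fun x => densityLaplace P Y t (ψ.eval x)) (Ioi 0) ∧
      ∀ k : ℕ, probAt P X k t =
        (-(lam : ℝ)) ^ k / (k.factorial : ℝ) *
          iteratedDeriv k (fun x => densityLaplace P Y t (ψ.eval x)) lam) ∧
    -- the governing equations of the probabilities, with the usual initial conditions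
    (∀ k : ℕ,
      (∀ t : ℝ, 0 < t →
        f.HasCaputo (probAt P X k) t
          (-shiftOperator ψ.eval lam (fun j => probAt P X j t) k)) ∧
      probAt P X k 0 = if k = 0 then 1 else 0) ∧
    -- the probability generating function and its governing equation
    (∀ u : ℝ, |u| < 1 →
      (∀ t : ℝ, 0 < t →
        pgf P X u t = densityLaplace P Y t (ψ.eval (lam * (1 - u))) ∧
        f.HasCaputo (pgf P X u) t (-ψ.eval (lam * (1 - u)) * pgf P X u t)) ∧
      pgf P X u 0 = 1) := by
  subst hY hX
  have hlam' : (0 : ℝ) < lam := hlam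
  have hpair := hHf.inversePair hf
  have hψs := hHψ.contDiffOn_eval ((⊤ : ℕ∞) : WithTop ℕ∞)
  have hT : ∀ t, AEMeasurable (inverseProc Hf t) P :=
    hHf.aemeasurable_inverseProc (hf.eval_pos one_pos)
  have hind₁ : ∀ t, IndepFun (fun ω t => Hψ t ω) (inverseProc Hf t) P := fun t =>
    hindep₁.comp measurable_id (measurable_pi_apply t)
  have hZ : ∀ t, AEMeasurable (fun ω => Hψ (inverseProc Hf t ω) ω) P := fun t =>
    hHψ.aemeasurable_randomTime (hT t)
  have hind₂ : ∀ t, IndepFun (fun ω t => N t ω) (fun ω => Hψ (inverseProc Hf t ω) ω) P := fun t =>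
    hHψ.indepFun_randomTime (hindep₂.comp measurable_id
      (measurable_fst.prodMk ((measurable_pi_apply t).comp measurable_snd)))
  -- Valid at t = 0 as well, so that the initial value comes from m_0 = δ_0 and the function can be
  -- rewritten on all times at once.
  have hprob : ∀ k t, probAt P (timeChanged N Hψ (inverseProc Hf)) k t =
      ∫ s, subordinatedWeight ψ.eval lam k s ∂lawAt P (inverseProc Hf) t := fun k t =>
    (hN.measureReal_countAt_eq (hZ _) (hind₂ _) k).trans
      (hHψ.integral_poissonWeight_randomTime (hT _) (hind₁ _) hlam' k)
  have hpgf : ∀ u, |u| < 1 → ∀ t, pgf P (timeChanged N Hψ (inverseProc Hf)) u t =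
      ∫ s, Real.exp (-(s * ψ.eval (lam * (1 - u)))) ∂lawAt P (inverseProc Hf) t := fun u hu t =>
    (hN.integral_powENat_countAt (hZ _) (hind₂ _) hu).trans
      (hHψ.integral_expNegMul_randomTime (hT _) (hind₁ _)
        (mul_pos hlam' (sub_pos.2 (lt_of_abs_lt hu))))
  have hdens : ∀ t, 0 < t → ∀ η, densityLaplace P (inverseProc Hf) t η =
      ∫ s, Real.exp (-(s * η)) ∂lawAt P (inverseProc Hf) t := fun t ht =>
    densityLaplace_eq_integral (hpair.m_absolutelyContinuous hf ht) (hpair.ae_m_pos ht)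
  refine ⟨fun t ht => ?_, fun k => ⟨fun t ht => ?_, ?_⟩, fun u hu => ⟨fun t ht => ⟨?_, ?_⟩, ?_⟩⟩
  · have hZt : ∀ x, 0 < x → densityLaplace P (inverseProc Hf) t (ψ.eval x) =
        ∫ ω, expNegMul x (Hψ (inverseProc Hf t.toNNReal ω) ω) ∂P := fun x hx =>
      (hdens t ht _).trans (hHψ.integral_expNegMul_randomTime (hT _) (hind₁ _) hx).symm
    refine ⟨hpair.m_absolutelyContinuous hf ht, ?_, fun k => ?_⟩
    · refine ContDiffOn.congr (fun x hx => ?_) hZt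
      exact (contDiffAt_integral_expNegMul (hZ _) hx _).contDiffWithinAt
    · rw [iteratedDeriv_congr_Ioi hZt k hlam', ← integral_poissonWeight (hZ _) hlam']
      exact hN.measureReal_countAt_eq (hZ _) (hind₂ _) k
  -- A triangular system: order k involves the weights of order at most k, with the coefficients of
  -- -ψ(λ(I - B)).
  · have h1 := hpair.hasCaputo_integral hf (fun k => Finset.range (k + 1))
      (fun k j => -(iteratedDeriv (k - j) ψ.eval lam *
        ((-lam) ^ (k - j) / ((k - j).factorial : ℝ))))
      (subordinatedWeight ψ.eval lam)
      (fun k s _ => (hasDerivAt_subordinatedWeight hψs hlam' k s).congr_deriv (by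
        rw [shiftOperator_eq_reflect, ← Finset.sum_neg_distrib]
        simp only [neg_mul]))
      (fun k s hs => (hHψ.subordinatedWeight_mem_Icc hlam' k hs).1)
      (fun k s hs => (hHψ.subordinatedWeight_mem_Icc hlam' k hs).2) k ht
    rw [funext (hprob k), shiftOperator_eq_reflect, ← Finset.sum_neg_distrib]
    simpa only [hprob, neg_mul] using h1
  · rw [hprob, hpair.m_zero hf, integral_dirac, subordinatedWeight_zero]
  · rw [hpgf u hu, hdens t ht]
  · have hη : 0 ≤ ψ.eval (lam * (1 - u)) :=
      ψ.eval_nonneg (mul_pos hlam' (sub_pos.2 (lt_of_abs_lt hu))).le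
    -- A system with the single function e^{-sη}, η = ψ(λ(1-u)); it takes values in [0, 1] on s ≥ 0
    -- because η ≥ 0.
    have h1 := hpair.hasCaputo_integral hf (fun _ : Unit => Finset.univ)
      (fun _ _ => -ψ.eval (lam * (1 - u)))
      (fun _ s => Real.exp (-(s * ψ.eval (lam * (1 - u)))))
      (fun _ s _ => ((hasDerivAt_mul_const _).fun_neg.exp).congr_deriv (by simp [mul_comm]))
      (fun _ s _ => (Real.exp_pos _).le)
      (fun _ s hs => by
        rw [Real.exp_le_one_iff, neg_nonpos]
        exact mul_nonneg hs hη) () ht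
    rw [funext (hpgf u hu)]
    simpa using h1
  · rw [hpgf u hu, hpair.m_zero hf, integral_dirac]
    simp
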